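/- Let $d\ge 1$, $a_1,\dots,a_d>0$ be constants, $t^*>0$, $\Omega=(0,1)^d$, and let $u$ solve $u_t=\sum_{j=1}^d a_j\,\partial_{x_jx_j}u+r(\vec x,t)$ in $\Omega\times(0,t^*]$, $u=\beta(\vec x,t)$ on $\partial\Omega\times(0,t^*]$, $u(\cdot,0)=u_0$ in $\Omega$, where $r$ and $\beta$ are continuous on $\bar\Omega\times[0,t^*]$ and $\partial\Omega\times[0,t^*]$, respectively. For positive integers $n_1,\dots,n_d$ let $\Delta x_l=1/(1+n_l)$, $h=\max_l\Delta x_l$, and let $\dot V=\sum_{j=0}^dF_j(t,V)$, $V(0)=u_0(\vec x_G)$, be the semidiscrete system on the interior points $\vec x_G$ of the uniform grid, where $F_0(t,V)=r(\vec x_G,t)$ and $F_j(t,V)$, $1\le j\le d$, is the second order central difference approximation of $a_j\partial_{x_jx_j}$ with the Dirichlet values $\beta(\cdot,t)$ inserted at the boundary grid-points. Let $\|V\|_{2,h}^2=\Delta x_1\cdots\Delta x_d\sum_{\vec x_G}|V(\vec x_G)|^2$. An $s$-stage AMF-W method $(A,L,b,\theta)$ ($A=(a_{ij})$, $L=(\ell_{ij})$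 strictly lower triangular real matrices, $b\in\mathbb R^s$, $\theta\in\mathbb R$) advances $V_n\approx V(t_n)$, $t_n=n\Delta t$, by $V_{n+1}=V_n+\sum_ib_iK_i$, where, with $\rho=(I-L)^{-1}\mathbf 1$ and $c=A\rho$, $K_i=K_i^{(d)}$ and $$K_i^{(-1)}=\Delta t\sum_{j=0}^dF_j\Big(t_n+c_i\Delta t,V_n+\sum_{k<i}a_{ik}K_k\Big)+\sum_{k<i}\ell_{ik}K_k,$$ $$\big(I-\theta\Delta t\,\partial_VF_j(t_n,V_n)\big)K_i^{(j)}=K_i^{(j-1)}+\theta\rho_i\Delta t^2\,\partial_tF_j(t_n,V_n)\qquad(j=0,\dots,d).$$ Let $p\ge1$ be an integer and assume: 1. $u$ has continuous mixed partial derivatives $\partial_t^k\partial_{x_1}^{\alpha_1}\cdots\partial_{x_d}^{\alpha_d}u$ on $\bar\Omega\times[0,t^*]$ for all $k\le p+1$ and all $\alpha_1,\dots,\alpha_d\le\max\{p+1,4\}$. 2. The method has order $p$ as a Rosenbrock method whenever $W=\partial_yF+\mathcal O(\Delta t)$: for every smooth ODE system $y'=F(t,y)$, every solution $y$ and every family of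 matrices $W(\Delta t)=\partial_yF(t_0,y(t_0))+\mathcal O(\Delta t)$, one step from $(t_0,y_0)$, $y_0=y(t_0)$, of $$(I-\theta\Delta tW)K_i=\Delta tF\Big(t_0+c_i\Delta t,y_0+\sum_{j<i}a_{ij}K_j\Big)+\sum_{j<i}\ell_{ij}K_j+\theta\rho_i\Delta t^2\,\partial_tF(t_0,y_0),\qquad y_1=y_0+\sum_ib_iK_i,$$ satisfies $y(t_0+\Delta t)-y_1=\mathcal O(\Delta t^{p+1})$ as $\Delta t\to0^+$. 3. With $z=\sum_jx_j$ and $\Pi=\prod_j(1-\theta x_j)$, the stability function $R(x_1,\dots,x_d)=1+z\,b^\top(\Pi I-L-zA)^{-1}\mathbf 1$ satisfies, for some constant $C>0$, $$-1\le R(x_1,\dots,x_d)\le1+C\,\frac{x_1+\cdots+x_d}{(1-\theta x_1)\cdots(1-\theta x_d)}\qquad\text{for all }x_1,\dots,x_d<0.$$ Then the global errors $\epsilon_h(t_n)=u(\vec x_G,t_n)-V_n$ satisfy, for all $n_1,\dots,n_d$, all $\Delta t>0$ and all $n$ with $t_n\le t^*$ for which the first $n$ steps evaluate the data only at times in $[0,t^*]$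 (this is automatic if $0\le c_i\le1$ for all $i$): (a) if the boundary conditions are time-independent ($\beta(\vec x,t)=\beta(\vec x)$), then for every real $q<3.25$ there are constants $C_1,C_2>0$, independent of $\Delta t$, $n$ and the grid, with $$\|\epsilon_h(t_n)\|_{2,h}\le C_1\Delta t^{\min\{p,q\}}+C_2h^2;$$ (b) for general, possibly time-dependent, boundary conditions there are constants $C_1,C_2>0$, independent of $\Delta t$, $n$ and the grid, with $$\|\epsilon_h(t_n)\|_{2,h}\le C_1\Delta t^{\min\{p,2\}}+C_2h^2 .$$ -/

import Mathlib

open Set Filter Topology Asymptotics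
open scoped ContDiff

noncomputable section

/-! ### Rosenbrock and AMF-W methods -/

/-- The coefficients `(A, L, b, θ)` of an `s`-stage method; `A` and `L` are strictly lower
triangular, since the stages are computed one after the other. -/
structure AMFWMethod (s : ℕ) where
  A : Matrix (Fin s) (Fin s) ℝ
  L : Matrix (Fin s) (Fin s) ℝ
  b : Fin s → ℝ
  θ : ℝ
  A_lower : ∀ i j, i ≤ j → A i j = 0
  L_lower : ∀ i j, i ≤ j → L i j = 0

namespace AMFWMethod

/-- `ρ = (I - L)⁻¹ 𝟙`. -/
def rho {s : ℕ} (M : AMFWMethod s) : Fin s → ℝ :=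
  Matrix.mulVec (1 - M.L)⁻¹ (fun _ => 1)

/-- The nodes `c = A ρ`. -/
def c {s : ℕ} (M : AMFWMethod s) : Fin s → ℝ :=
  Matrix.mulVec M.A M.rho

/-- The Rosenbrock-type method `(A, L, b, θ)` with matrix `W`: `v'` is the result of one step of
size `τ` from `(t, v)` for `y' = F(t, y)`. The sums over all stages are sums over the previous
ones, because `A` and `L` are strictly lower triangular. -/
def RosenbrockStep {s : ℕ} (M : AMFWMethod s) {E : Type*} [NormedAddCommGroup E]
    [NormedSpace ℝ E] (F : ℝ → E → E) (W : E →L[ℝ] E) (t τ : ℝ) (v v' : E) : Prop :=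
  ∃ K : Fin s → E,
    (∀ i, K i - (M.θ * τ) • W (K i) =
      τ • F (t + M.c i * τ) (v + ∑ j, M.A i j • K j) + ∑ j, M.L i j • K j
        + (M.θ * M.rho i * τ ^ 2) • deriv (fun σ => F σ v) t) ∧
    v' = v + ∑ i, M.b i • K i

/-- The method has (classical, ODE) order `p` as a Rosenbrock-type method whenever
`W = ∂F/∂y (t₀, y₀) + O(τ)`: for every smooth system of ordinary differential equations, every
solution `y` and every such family of matrices `W`, the local error is `O(τ ^ (p + 1))`. -/
def HasRosenbrockOrder {s : ℕ} (M : AMFWMethod s) (p : ℕ) : Prop :=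
  ∀ (m : ℕ) (F : ℝ → (Fin m → ℝ) → (Fin m → ℝ)), ContDiff ℝ ∞ (Function.uncurry F) →
  ∀ (t₀ : ℝ) (y : ℝ → Fin m → ℝ), (∀ᶠ t in 𝓝 t₀, HasDerivAt y (F t (y t)) t) →
  ∀ W : ℝ → ((Fin m → ℝ) →L[ℝ] (Fin m → ℝ)),
    ((fun τ => W τ - fderiv ℝ (F t₀) (y t₀)) =O[𝓝[>] 0] fun τ => τ) →
  ∀ v : ℝ → Fin m → ℝ,
    (∀ᶠ τ in 𝓝[>] 0, M.RosenbrockStep F (W τ) t₀ τ (y t₀) (v τ)) →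
    (fun τ => y (t₀ + τ) - v τ) =O[𝓝[>] 0] fun τ => τ ^ (p + 1)

/-- The linear stability function
`R(x₁, …, x_d) = 1 + z bᵀ (Π I - L - z A)⁻¹ 𝟙`, `z = ∑ x_j`, `Π = ∏ (1 - θ x_j)`. -/
def stabilityFunction {s d : ℕ} (M : AMFWMethod s) (x : Fin d → ℝ) : ℝ :=
  1 + (∑ j, x j) *
    dotProduct M.b (Matrix.mulVec
      ((∏ j, (1 - M.θ * x j)) • (1 : Matrix (Fin s) (Fin s) ℝ) - M.L - (∑ j, x j) • M.A)⁻¹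
      (fun _ => 1))

/-- One step of size `τ` from `(t, v)` of the AMF-W method for the system
`y' = F 0 (t, y) + ⋯ + F d (t, y)` posed for `t ∈ I`; `v'` is the result of the step.
`Q i 0, Q i 1, …, Q i (d + 1)` are the intermediate vectors `K_i^(-1), K_i^(0), …, K_i^(d)` and
`K_i = K_i^(d)`. Time derivatives are taken within `I` (one-sided at its end-points). -/
def AMFWStep {s d : ℕ} (M : AMFWMethod s) {E : Type*} [NormedAddCommGroup E]
    [NormedSpace ℝ E] (I : Set ℝ) (F : Fin (d + 1) → ℝ → E → E) (t τ : ℝ) (v v' : E) : Prop :=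
  ∃ Q : Fin s → Fin (d + 2) → E,
    (∀ i, Q i 0 =
      τ • (∑ k, F k (t + M.c i * τ) (v + ∑ j, M.A i j • Q j (Fin.last (d + 1))))
        + ∑ j, M.L i j • Q j (Fin.last (d + 1))) ∧
    (∀ i (k : Fin (d + 1)),
      Q i k.succ - (M.θ * τ) • fderiv ℝ (F k t) v (Q i k.succ) =
        Q i k.castSucc + (M.θ * M.rho i * τ ^ 2) • derivWithin (fun σ => F k σ v) I t) ∧
    v' = v + ∑ i, M.b i • Q i (Fin.last (d + 1))

end AMFWMethod

/-! ### The diffusion problem -/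

/-- The open unit cube `Ω = (0,1)^d`. -/
def unitCube (d : ℕ) : Set (Fin d → ℝ) := Set.univ.pi fun _ => Ioo 0 1

/-- Data of the problem `u_t = ∑ a_j ∂²u/∂x_j² + r(x,t)` in `Ω × (0,T]`, `u = β` on
`∂Ω × (0,T]`, `u(·,0) = u₀` in `Ω`, with constants `a_j > 0` and data continuous up to the
boundary. -/
structure DiffusionProblem (d : ℕ) where
  a : Fin d → ℝ
  a_pos : ∀ j, 0 < a j
  T : ℝ
  T_pos : 0 < T
  r : (Fin d → ℝ) → ℝ → ℝ
  r_cont : ContinuousOn (Function.uncurry r) (closure (unitCube d) ×ˢ Icc 0 T)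
  β : (Fin d → ℝ) → ℝ → ℝ
  β_cont : ContinuousOn (Function.uncurry β) (frontier (unitCube d) ×ˢ Icc 0 T)
  u₀ : (Fin d → ℝ) → ℝ

/-- On `[0,1]^d × [0,T]`, the function `u` has continuous (hence bounded) mixed partial
derivatives `∂_t^k ∂_x^α u` for all `k ≤ kt` and all multi-indices `α` with `α_j ≤ kx` for
every `j`; `D k α` is that derivative. -/
def HasContinuousPartials {d : ℕ} (T : ℝ) (kt kx : ℕ) (u : (Fin d → ℝ) → ℝ → ℝ) : Prop :=
  ∃ D : ℕ → (Fin d → ℕ) → (Fin d → ℝ) → ℝ → ℝ,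
    (∀ x ∈ Icc (0 : Fin d → ℝ) 1, ∀ t ∈ Icc 0 T, D 0 0 x t = u x t) ∧
    (∀ k ≤ kt, ∀ α : Fin d → ℕ, (∀ j, α j ≤ kx) →
      ContinuousOn (Function.uncurry (D k α)) (Icc 0 1 ×ˢ Icc 0 T)) ∧
    (∀ k < kt, ∀ α : Fin d → ℕ, (∀ j, α j ≤ kx) →
      ∀ x ∈ Icc (0 : Fin d → ℝ) 1, ∀ t ∈ Icc 0 T,
        HasDerivWithinAt (fun σ => D k α x σ) (D (k + 1) α x t) (Icc 0 T) t) ∧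
    (∀ k ≤ kt, ∀ α : Fin d → ℕ, (∀ j, α j ≤ kx) → ∀ j, α j < kx →
      ∀ x ∈ Icc (0 : Fin d → ℝ) 1, ∀ t ∈ Icc 0 T,
        HasDerivWithinAt (fun ξ => D k α (Function.update x j ξ) t)
          (D k (α + Pi.single j 1) x t) (Icc 0 1) (x j))

/-- The spacing `Δx_l = 1 / (1 + n_l)` of the uniform grid with `n_l` interior points in
direction `l`. -/
def meshWidth {d : ℕ} (n : Fin d → ℕ) (l : Fin d) : ℝ := 1 / (1 + n l)

/-- `h = max_l Δx_l`. -/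
def maxMeshWidth {d : ℕ} (n : Fin d → ℕ) : ℝ := ⨆ l, meshWidth n l

/-- The grid-point with (integer) index `k`, `0 ≤ k_l ≤ n_l + 1`. -/
def gridNode {d : ℕ} (n : Fin d → ℕ) (k : Fin d → ℕ) : Fin d → ℝ :=
  fun l => k l * meshWidth n l

/-- Functions on the interior grid-points; the component `i l` of an index stands for the grid
index `i l + 1 ∈ {1, …, n_l}`. -/
abbrev GridFun {d : ℕ} (n : Fin d → ℕ) : Type := ((l : Fin d) → Fin (n l)) → ℝ

/-- The grid index of an interior point. -/
def gridIndex {d : ℕ} {n : Fin d → ℕ} (i : (l : Fin d) → Fin (n l)) : Fin d → ℕ :=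
  fun l => (i l : ℕ) + 1

/-- The values of a function at the interior grid-points. -/
def gridRestrict {d : ℕ} (n : Fin d → ℕ) (f : (Fin d → ℝ) → ℝ) : GridFun n :=
  fun i => f (gridNode n (gridIndex i))

/-- Extension of a grid function to boundary grid-points by boundary values `g`. -/
def gridExtend {d : ℕ} {n : Fin d → ℕ} (g : (Fin d → ℝ) → ℝ) (V : GridFun n)
    (k : Fin d → ℕ) : ℝ :=
  open Classical in
  if hk : ∀ l, 1 ≤ k l ∧ k l ≤ n l then
    V (fun l => ⟨k l - 1, by have := hk l; omega⟩)
  else g (gridNode n k)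

/-- The weighted Euclidean norm
`‖V‖_{2,h} = (Δx_1 ⋯ Δx_d ∑ |V(x_G)|²)^{1/2}`, the sum over the interior grid-points. -/
def weightedNorm {d : ℕ} {n : Fin d → ℕ} (V : GridFun n) : ℝ :=
  Real.sqrt ((∏ l, meshWidth n l) * ∑ i, |V i| ^ 2)

namespace DiffusionProblem

/-- `u` solves the initial-boundary value problem. -/
structure IsSolution {d : ℕ} (P : DiffusionProblem d) (u : (Fin d → ℝ) → ℝ → ℝ) : Prop where
  pde : ∀ x ∈ unitCube d, ∀ t ∈ Ioc 0 P.T,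
    derivWithin (fun σ => u x σ) (Icc 0 P.T) t =
      ∑ j, P.a j * iteratedDeriv 2 (fun ξ => u (Function.update x j ξ) t) (x j) + P.r x t
  bc : ∀ x ∈ frontier (unitCube d), ∀ t ∈ Ioc 0 P.T, u x t = P.β x t
  ic : ∀ x ∈ unitCube d, u x 0 = P.u₀ x

/-- Time-independent boundary conditions. -/
def TimeIndependentBC {d : ℕ} (P : DiffusionProblem d) : Prop :=
  ∀ x ∈ frontier (unitCube d), ∀ t ∈ Icc 0 P.T, ∀ t' ∈ Icc 0 P.T, P.β x t = P.β x t'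

/-- `F_j(t, V)`, the second order central difference approximation of `a_j ∂²/∂x_j²`, with the
Dirichlet values inserted at the boundary grid-points. -/
def diffusionTerm {d : ℕ} (P : DiffusionProblem d) (n : Fin d → ℕ) (j : Fin d) (t : ℝ)
    (V : GridFun n) : GridFun n :=
  fun i =>
    P.a j * (gridExtend (fun x => P.β x t) V
          (Function.update (gridIndex i) j (gridIndex i j + 1))
        - 2 * gridExtend (fun x => P.β x t) V (gridIndex i)
        + gridExtend (fun x => P.β x t) V
          (Function.update (gridIndex i) j (gridIndex i j - 1)))
      / meshWidth n j ^ 2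

/-- The directional splitting `F_0, F_1, …, F_d` of the semidiscrete system, with the source term
in the first place. -/
def splitting {d : ℕ} (P : DiffusionProblem d) (n : Fin d → ℕ) :
    Fin (d + 1) → ℝ → GridFun n → GridFun n :=
  Fin.cases (fun t _ => gridRestrict n fun x => P.r x t) (fun j => P.diffusionTerm n j)

/-- `V 0, …, V N` is the AMF-W solution with step size `τ` on the grid `n`, where `N τ ≤ T` and
the data are evaluated only at times in `[0, T]`. -/
structure IsAMFWSolution {d s : ℕ} (P : DiffusionProblem d) (M : AMFWMethod s)
    (n : Fin d → ℕ) (τ : ℝ) (N : ℕ) (V : ℕ → GridFun n) : Prop where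
  final : N * τ ≤ P.T
  nodes : ∀ m < N, ∀ i, m * τ + M.c i * τ ∈ Icc 0 P.T
  init : V 0 = gridRestrict n P.u₀
  step : ∀ m < N, M.AMFWStep (Icc 0 P.T) (P.splitting n) (m * τ) τ (V m) (V (m + 1))

/-- `‖ε_h(t_N)‖_{2,h} ≤ C₁ τ^q + C₂ h²`, uniformly over all step sizes `τ`, all grids and all
step points `t_N = N τ`. -/
def GlobalErrorBound {d s : ℕ} (P : DiffusionProblem d) (M : AMFWMethod s)
    (u : (Fin d → ℝ) → ℝ → ℝ) (q C₁ C₂ : ℝ) : Prop :=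
  ∀ (n : Fin d → ℕ) (τ : ℝ), 0 < τ → ∀ (N : ℕ) (V : ℕ → GridFun n),
    P.IsAMFWSolution M n τ N V →
    weightedNorm ((gridRestrict n fun x => u x (N * τ)) - V N) ≤
      C₁ * τ ^ q + C₂ * maxMeshWidth n ^ 2

end DiffusionProblem

end

/-! The discrete sine modes diagonalize every directional difference operator simultaneously, so in
each mode the method is a scalar recursion `e_{m+1} = R(x) e_m + (local error)`, with `x_j < 0` the
step size times the eigenvalue in direction `j`. Parseval's identity turns mode-wise bounds into the
weighted norm; it remains to bound each mode uniformly in the mesh and to sum squares over the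
modes.

Taylor expansion of the exact mode writes the local error as terms `τ^k u^(k)` times symbols
`taylorSymbol k x`, which are rational in `x` with a power of `Π = ∏ (1 - θ x_j)` as denominator.
The order condition, tested on scalar problems whose `W` satisfies `1 - θ τ W = Π`, says that the
symbols are `O(τ^(p+1-k))` along rays. Together with boundedness this gives `|taylorSymbol k x| ≤ C
min 1 (w^(p+1-k))`, `w = ∑ -x_j` (`exists_taylorSymbol_le`).

Adding up local errors in absolute value would lose a power of `τ`. Summation by parts in time
avoids this: `(1 - R)` times the accumulated sum is controlled by the size and the time variation of
the source, and the stability hypothesis gives `1 - R ≥ C w / Π`. The price is the factor `Π / w`,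
which is not bounded because `Π` contains products of several `x_j`. It is paid for by the decay of
the sine coefficients in the wave numbers `k_l`.

For smooth functions these coefficients decay like `∏ 1/k_l`. With order two, the accumulated error
is then `τ^2` times a weight whose squares sum to a bounded quantity
(`exists_sum_sq_modeWeight_mul_min_le`); subsets of two directions in the expansion of `Π` are the
borderline case. This gives (b).

If the boundary values do not depend on time, the time derivatives of `u` vanish on the boundary and
their coefficients decay like `∏ 1/k_l^3`. Moreover the splitting part of the error becomes the
symbol of index one, which contains only products of at least two `x_j`. Counting powers with `-x_j
≤ c τ k_j^2` gives `τ^(3+σ) (∏ k_l)^(-1+2σ)` per mode, and these are square summable exactly for `σ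
< 1/4`, whence the exponent 3.25 in (a). -/

noncomputable section

/-! ### The stage equations -/

namespace AMFWMethod

variable {s d : ℕ} (M : AMFWMethod s)

/-- The factor `Π = ∏ (1 - θ x_j)`. -/
def ampl (x : Fin d → ℝ) : ℝ := ∏ j, (1 - M.θ * x j)

/-- The matrix `Π I - L - z A` of the stage equations. -/
def stageMatrix (x : Fin d → ℝ) : Matrix (Fin s) (Fin s) ℝ :=
  M.ampl x • (1 : Matrix (Fin s) (Fin s) ℝ) - M.L - (∑ j, x j) • M.A

/-- The functional `y ↦ bᵀ (Π I - L - z A)⁻¹ y`. -/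
def stageFun (x : Fin d → ℝ) : (Fin s → ℝ) →ₗ[ℝ] ℝ where
  toFun y := dotProduct M.b (Matrix.mulVec (M.stageMatrix x)⁻¹ y)
  map_add' y z := by simp [Matrix.mulVec_add, dotProduct_add]
  map_smul' r y := by simp [Matrix.mulVec_smul, dotProduct_smul]

theorem stageFun_apply (x : Fin d → ℝ) (y : Fin s → ℝ) :
    M.stageFun x y = dotProduct M.b (Matrix.mulVec (M.stageMatrix x)⁻¹ y) := rfl

theorem stabilityFunction_eq (x : Fin d → ℝ) :
    M.stabilityFunction x = 1 + (∑ j, x j) * M.stageFun x (fun _ => 1) := rfl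

/-- `L` and `A` have zero diagonal, so the pencil is triangular with constant diagonal. The stages
can therefore be eliminated as soon as `Π ≠ 0`, and unipotent pencils have polynomial inverses. -/
theorem det_lowerTriangular_pencil {R : Type*} [CommRing R] (f : ℝ →+* R) (p q r : R) :
    (p • (1 : Matrix (Fin s) (Fin s) R) - q • M.L.map f - r • M.A.map f).det = p ^ s := by
  rw [Matrix.det_of_isLowerTriangular]
  · simp [M.A_lower _ _ le_rfl, M.L_lower _ _ le_rfl]
  · intro i j hij
    have hij' : i < j := hij
    simp [M.A_lower _ _ hij'.le, M.L_lower _ _ hij'.le, Matrix.one_apply_ne hij'.ne]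

theorem det_stageMatrix (x : Fin d → ℝ) : (M.stageMatrix x).det = M.ampl x ^ s := by
  have := M.det_lowerTriangular_pencil (RingHom.id ℝ) (M.ampl x) 1 (∑ j, x j)
  simpa [stageMatrix, Matrix.map_id] using this

theorem stageFun_mulVec (x : Fin d → ℝ) (hx : M.ampl x ≠ 0) (q : Fin s → ℝ) :
    M.stageFun x (Matrix.mulVec (M.stageMatrix x) q) = dotProduct M.b q := by
  rw [stageFun_apply, Matrix.mulVec_mulVec, Matrix.nonsing_inv_mul, Matrix.one_mulVec]
  rw [det_stageMatrix]
  exact (pow_ne_zero _ hx).isUnit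

theorem exists_stageMatrix_mulVec_eq (x : Fin d → ℝ) (hx : M.ampl x ≠ 0) (y : Fin s → ℝ) :
    ∃ q, Matrix.mulVec (M.stageMatrix x) q = y := by
  refine ⟨Matrix.mulVec (M.stageMatrix x)⁻¹ y, ?_⟩
  rw [Matrix.mulVec_mulVec, Matrix.mul_nonsing_inv, Matrix.one_mulVec]
  rw [det_stageMatrix]
  exact (pow_ne_zero _ hx).isUnit

theorem stageMatrix_mulVec_apply (x : Fin d → ℝ) (q : Fin s → ℝ) (i : Fin s) :
    Matrix.mulVec (M.stageMatrix x) q i =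
      M.ampl x * q i - ∑ j, M.L i j * q j - (∑ j, x j) * ∑ j, M.A i j * q j := by
  simp only [stageMatrix, Matrix.sub_mulVec, Matrix.smul_mulVec, Matrix.one_mulVec, Pi.sub_apply,
    Pi.smul_apply, smul_eq_mul]
  rfl

theorem rho_sub_L_mulVec (i : Fin s) : M.rho i - ∑ j, M.L i j * M.rho j = 1 := by
  have hdet : (1 - M.L).det = 1 := by
    have := M.det_lowerTriangular_pencil (RingHom.id ℝ) 1 1 0
    simpa [Matrix.map_id] using this
  have h : Matrix.mulVec (1 - M.L) M.rho = fun _ => 1 := by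
    rw [rho, Matrix.mulVec_mulVec, Matrix.mul_nonsing_inv _ (by rw [hdet]; exact isUnit_one),
      Matrix.one_mulVec]
  have h' := congrFun h i
  simp only [Matrix.sub_mulVec, Matrix.one_mulVec, Pi.sub_apply] at h'
  exact h'

/-- Uses `ρ - Lρ = 1` and `Aρ = c`. The right-hand side is the combination in which the first time
derivative enters the local error, so that this contribution can be evaluated exactly as `b·ρ`. -/
theorem stageMatrix_mulVec_rho (x : Fin d → ℝ) (i : Fin s) :
    Matrix.mulVec (M.stageMatrix x) M.rho i =
      1 - (∑ j, x j) * M.c i - (1 - M.ampl x) * M.rho i := by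
  rw [stageMatrix_mulVec_apply]
  have h := M.rho_sub_L_mulVec i
  have hc : M.c i = ∑ j, M.A i j * M.rho j := rfl
  rw [hc]
  linarith

theorem ampl_pos (hθ : 0 < M.θ) {x : Fin d → ℝ} (hx : ∀ j, x j < 0) : 0 < M.ampl x :=
  Finset.prod_pos fun j _ => by nlinarith [hx j]

/-- The product is bounded below by its linear part. -/
theorem one_add_sum_le_prod {ι : Type*} (S : Finset ι) (y : ι → ℝ) (hy : ∀ i ∈ S, 0 ≤ y i) :
    1 + ∑ i ∈ S, y i ≤ ∏ i ∈ S, (1 + y i) := by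
  classical
  induction S using Finset.induction_on with
  | empty => simp
  | insert a S ha ih =>
    rw [Finset.sum_insert ha, Finset.prod_insert ha]
    have h1 := ih fun i hi => hy i (Finset.mem_insert_of_mem hi)
    have h2 := hy a (Finset.mem_insert_self _ _)
    have h3 : 0 ≤ ∑ i ∈ S, y i :=
      Finset.sum_nonneg fun i hi => hy i (Finset.mem_insert_of_mem hi)
    nlinarith

theorem ampl_eq_prod (x : Fin d → ℝ) : M.ampl x = ∏ j, (1 + M.θ * -x j) :=
  Finset.prod_congr rfl fun j _ => by ring

theorem theta_mul_sum_le_ampl (hθ : 0 < M.θ) {x : Fin d → ℝ} (hx : ∀ j, x j < 0) :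
    1 + M.θ * ∑ j, -x j ≤ M.ampl x := by
  rw [ampl_eq_prod, Finset.mul_sum]
  exact one_add_sum_le_prod _ _ fun j _ => by nlinarith [hx j]

theorem one_le_ampl (hθ : 0 < M.θ) {x : Fin d → ℝ} (hx : ∀ j, x j < 0) : 1 ≤ M.ampl x := by
  have h1 := M.theta_mul_sum_le_ampl hθ hx
  have h2 : 0 ≤ ∑ j, -x j := Finset.sum_nonneg fun j _ => by linarith [hx j]
  nlinarith

/-- Pulling out `Π` leaves the matrix `I - L/Π - (z/Π)A`. The pair `(1/Π, z/Π)` stays in the compact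
set `[0,1] × [-1/θ,0]` because `Π ≥ 1 + θ|z|`, and since the determinant is 1 the inverse is the
adjugate, which is continuous there. -/
theorem exists_ampl_mul_stageFun_le (hθ : 0 < M.θ) :
    ∃ C > 0, ∀ x : Fin d → ℝ, (∀ j, x j < 0) → ∀ (y : Fin s → ℝ) (Y : ℝ), 0 ≤ Y → (∀ i, |y i| ≤ Y) →
      M.ampl x * |M.stageFun x y| ≤ C * Y := by
  set G : ℝ × ℝ → Matrix (Fin s) (Fin s) ℝ := fun q => 1 - q.1 • M.L - q.2 • M.A with hG
  have hcont : Continuous fun q => Matrix.vecMul M.b (G q).adjugate := by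
    apply Continuous.matrix_vecMul continuous_const
    apply Continuous.matrix_adjugate
    fun_prop
  obtain ⟨C, hC⟩ := (isCompact_Icc (a := ((0 : ℝ), -(1 / M.θ))) (b := (1, 0))).exists_bound_of_continuousOn
    hcont.continuousOn
  refine ⟨(s + 1) * (|C| + 1), by positivity, fun x hx y Y hY hy => ?_⟩
  have hP := M.one_le_ampl hθ hx
  have hP0 := M.ampl_pos hθ hx
  have hz : ∑ j, x j ≤ 0 := Finset.sum_nonpos fun j _ => (hx j).le
  have hw := M.theta_mul_sum_le_ampl hθ hx
  rw [Finset.sum_neg_distrib] at hw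
  have hmem : (1 / M.ampl x, (∑ j, x j) / M.ampl x) ∈ Icc ((0 : ℝ), -(1 / M.θ)) (1, 0) := by
    refine ⟨⟨by positivity, ?_⟩, ⟨?_, ?_⟩⟩
    · show -(1 / M.θ) ≤ (∑ j, x j) / M.ampl x
      rw [le_div_iff₀ hP0, neg_mul, neg_le, one_div, ← div_eq_inv_mul, le_div_iff₀ hθ]
      linarith
    · show 1 / M.ampl x ≤ 1
      rw [div_le_one hP0]; exact hP
    · exact div_nonpos_of_nonpos_of_nonneg hz hP0.le
  have hb := hC _ hmem
  have hmat : M.stageMatrix x = M.ampl x • G (1 / M.ampl x, (∑ j, x j) / M.ampl x) := by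
    simp only [hG, stageMatrix, smul_sub, smul_smul, mul_div_cancel₀ _ hP0.ne', one_smul]
  have hdet : (G (1 / M.ampl x, (∑ j, x j) / M.ampl x)).det = 1 := by
    have := M.det_lowerTriangular_pencil (RingHom.id ℝ) 1 (1 / M.ampl x) ((∑ j, x j) / M.ampl x)
    simpa [hG, Matrix.map_id] using this
  have hinv : (M.stageMatrix x)⁻¹ =
      (M.ampl x)⁻¹ • (G (1 / M.ampl x, (∑ j, x j) / M.ampl x)).adjugate := by
    apply Matrix.inv_eq_right_inv
    rw [hmat, Matrix.smul_mul, Matrix.mul_smul, smul_smul, mul_inv_cancel₀ hP0.ne', one_smul,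
      Matrix.mul_adjugate, hdet, one_smul]
  have hval : M.ampl x * M.stageFun x y = ∑ i, Matrix.vecMul M.b
      (G (1 / M.ampl x, (∑ j, x j) / M.ampl x)).adjugate i * y i := by
    rw [stageFun_apply, hinv, Matrix.smul_mulVec, dotProduct_smul, smul_eq_mul, ← mul_assoc,
      mul_inv_cancel₀ hP0.ne', one_mul, Matrix.dotProduct_mulVec]
    rfl
  calc M.ampl x * |M.stageFun x y| = |M.ampl x * M.stageFun x y| := by
        rw [abs_mul, abs_of_pos hP0]
    _ ≤ ∑ i : Fin s, (|C| + 1) * Y := by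
        rw [hval]
        refine (Finset.abs_sum_le_sum_abs _ _).trans (Finset.sum_le_sum fun i _ => ?_)
        rw [abs_mul]
        refine mul_le_mul ?_ (hy i) (abs_nonneg _) (by positivity)
        have := (norm_le_pi_norm _ i).trans hb
        rw [Real.norm_eq_abs] at this
        linarith [le_abs_self C]
    _ ≤ (s + 1) * (|C| + 1) * Y := by
        rw [Finset.sum_const, Finset.card_univ, Fintype.card_fin, nsmul_eq_mul]
        nlinarith [mul_nonneg (by positivity : (0 : ℝ) ≤ |C| + 1) hY]

end AMFWMethod

/-! ### The Taylor symbols as rational functions, and polynomials that are small along rays. -/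

namespace AMFWMethod

variable {s d : ℕ} (M : AMFWMethod s)

/-- The coefficient of `τ ^ k u^(k)(t)` in the local error of the method for a scalar linear
problem. -/
def taylorSymbol (k : ℕ) (x : Fin d → ℝ) : ℝ :=
  1 / k.factorial
    - M.stageFun x (fun i => M.c i ^ (k - 1) / (k - 1).factorial
        + if k = 2 then M.θ * M.rho i else 0)
    + (∑ j, x j) * M.stageFun x (fun i => M.c i ^ k / k.factorial
        + if k = 1 then M.θ * M.rho i else 0)

/-- Cramer's rule: the determinant is `Π^s`, so `Π^s` is a common denominator and the adjugate
supplies the numerator. -/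
theorem exists_mvPolynomial_stageFun (y : Fin s → ℝ) :
    ∃ N : MvPolynomial (Fin d) ℝ, ∀ x : Fin d → ℝ, M.ampl x ≠ 0 →
      M.ampl x ^ s * M.stageFun x y = MvPolynomial.eval x N := by
  set P : Matrix (Fin s) (Fin s) (MvPolynomial (Fin d) ℝ) :=
    (∏ j : Fin d, (1 - MvPolynomial.C M.θ * MvPolynomial.X j)) •
      (1 : Matrix (Fin s) (Fin s) (MvPolynomial (Fin d) ℝ)) - M.L.map (MvPolynomial.C : ℝ →+* MvPolynomial (Fin d) ℝ)
      - (∑ j : Fin d, (MvPolynomial.X j : MvPolynomial (Fin d) ℝ)) • M.A.map (MvPolynomial.C : ℝ →+* MvPolynomial (Fin d) ℝ) with hP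
  refine ⟨∑ i, (MvPolynomial.C (M.b i) : MvPolynomial (Fin d) ℝ) * ∑ j, P.adjugate i j * MvPolynomial.C (y j),
    fun x hx => ?_⟩
  have hmap : (MvPolynomial.eval x).mapMatrix P = M.stageMatrix x := by
    ext i j
    simp only [hP, stageMatrix, ampl, RingHom.mapMatrix_apply, Matrix.map_apply, Matrix.sub_apply,
      Matrix.smul_apply, smul_eq_mul, map_sub, map_mul, map_prod, map_one, MvPolynomial.eval_C,
      MvPolynomial.eval_X, map_sum]
    by_cases hij : i = j <;> simp [Matrix.one_apply, hij]
  have hadj : ∀ i j, MvPolynomial.eval x (P.adjugate i j) = (M.stageMatrix x).adjugate i j := by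
    intro i j
    rw [← hmap, ← RingHom.map_adjugate]
    rfl
  rw [stageFun_apply, Matrix.inv_def, det_stageMatrix, Ring.inverse_eq_inv', Matrix.smul_mulVec,
    dotProduct_smul, smul_eq_mul, ← mul_assoc, mul_inv_cancel₀ (pow_ne_zero _ hx), one_mul]
  simp only [map_sum, map_mul, MvPolynomial.eval_C, hadj]
  rfl

theorem exists_mvPolynomial_taylorSymbol (k : ℕ) :
    ∃ N : MvPolynomial (Fin d) ℝ, ∀ x : Fin d → ℝ, M.ampl x ≠ 0 →
      M.ampl x ^ s * M.taylorSymbol k x = MvPolynomial.eval x N := by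
  obtain ⟨N₁, h₁⟩ := M.exists_mvPolynomial_stageFun (d := d)
    (fun i => M.c i ^ (k - 1) / (k - 1).factorial + if k = 2 then M.θ * M.rho i else 0)
  obtain ⟨N₂, h₂⟩ := M.exists_mvPolynomial_stageFun (d := d)
    (fun i => M.c i ^ k / k.factorial + if k = 1 then M.θ * M.rho i else 0)
  refine ⟨MvPolynomial.C (1 / (k.factorial : ℝ))
    * (∏ j : Fin d, (1 - MvPolynomial.C M.θ * MvPolynomial.X j)) ^ s - N₁
    + (∑ j : Fin d, MvPolynomial.X j) * N₂, fun x hx => ?_⟩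
  simp only [map_add, map_sub, map_mul, map_pow, map_prod, map_one, map_sum, MvPolynomial.eval_C,
    MvPolynomial.eval_X, ← h₁ x hx, ← h₂ x hx, taylorSymbol, ampl]
  ring

/-- One factor `X` is split off at a time: the remaining quotient is `O(τ)` from the right, hence
vanishes at 0 by continuity. -/
theorem X_pow_dvd_of_isBigO (m : ℕ) (q : Polynomial ℝ)
    (h : (fun τ : ℝ => q.eval τ) =O[𝓝[>] 0] fun τ => τ ^ m) : Polynomial.X ^ m ∣ q := by
  induction m with
  | zero => simp
  | succ m ih =>
    have h0 : (fun τ : ℝ => τ ^ (m + 1)) =O[𝓝[>] 0] fun τ => τ ^ m := by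
      have : (fun τ : ℝ => τ) =O[𝓝[>] 0] fun _ => (1 : ℝ) :=
        (Filter.Tendsto.isBigO_one ℝ (tendsto_nhdsWithin_of_tendsto_nhds tendsto_id))
      simpa [pow_succ] using (isBigO_refl (fun τ : ℝ => τ ^ m) _).mul this
    obtain ⟨g, rfl⟩ := ih (h.trans h0)
    have hg : (fun τ : ℝ => g.eval τ) =O[𝓝[>] 0] fun τ => τ := by
      have h1 := h.mul (isBigO_refl (fun τ : ℝ => (τ ^ m)⁻¹) (𝓝[>] 0))
      refine (h1.congr' ?_ ?_)
      · filter_upwards [self_mem_nhdsWithin] with τ hτ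
        have hτ' : (τ : ℝ) ≠ 0 := ne_of_gt hτ
        simp only [Polynomial.eval_mul, Polynomial.eval_pow, Polynomial.eval_X]
        field_simp
      · filter_upwards [self_mem_nhdsWithin] with τ hτ
        have hτ' : (τ : ℝ) ≠ 0 := ne_of_gt hτ
        field_simp
        ring
    have ht : Tendsto (fun τ : ℝ => g.eval τ) (𝓝[>] 0) (𝓝 0) :=
      hg.trans_tendsto (tendsto_nhdsWithin_of_tendsto_nhds tendsto_id)
    have ht' : Tendsto (fun τ : ℝ => g.eval τ) (𝓝[>] 0) (𝓝 (g.eval 0)) :=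
      tendsto_nhdsWithin_of_tendsto_nhds g.continuous.continuousAt
    have h00 : g.eval 0 = 0 := tendsto_nhds_unique ht' ht
    have : Polynomial.X ∣ g := by
      rw [Polynomial.X_dvd_iff, Polynomial.coeff_zero_eq_eval_zero, h00]
    rw [pow_succ]
    exact mul_dvd_mul_left _ this

/-- A polynomial that is `O(τ ^ m)` along every ray in the negative orthant is so uniformly. -/
theorem exists_abs_eval_le_of_isBigO (hd : 0 < d) (N : MvPolynomial (Fin d) ℝ) (m : ℕ)
    (h : ∀ ζ : Fin d → ℝ, (∀ j, ζ j < 0) →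
      (fun τ : ℝ => MvPolynomial.eval (τ • ζ) N) =O[𝓝[>] 0] fun τ => τ ^ m) :
    ∃ C > 0, ∀ x : Fin d → ℝ, (∀ j, x j < 0) → ∑ j, -x j ≤ 1 →
      |MvPolynomial.eval x N| ≤ C * (∑ j, -x j) ^ m := by
  set D := N.totalDegree + 1
  -- Grouping by homogeneous degree makes the restriction to a ray a univariate polynomial in `τ`
  -- whose coefficients are the values of the homogeneous components.
  have hexp : ∀ (τ : ℝ) (ζ : Fin d → ℝ), MvPolynomial.eval (τ • ζ) N =
      ∑ i ∈ Finset.range D, MvPolynomial.eval ζ (N.homogeneousComponent i) * τ ^ i := by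
    intro τ ζ
    conv_lhs => rw [← MvPolynomial.sum_homogeneousComponent N]
    rw [map_sum]
    refine Finset.sum_congr rfl fun i _ => ?_
    rw [MvPolynomial.eval_eq', MvPolynomial.eval_eq', Finset.sum_mul]
    refine Finset.sum_congr rfl fun e he => ?_
    have hdeg := MvPolynomial.homogeneousComponent_isHomogeneous i N (MvPolynomial.mem_support_iff.1 he)
    simp only [Pi.smul_apply, smul_eq_mul, mul_pow, Finset.prod_mul_distrib,
      Finset.prod_pow_eq_pow_sum]
    have : ∑ j, e j = i := by
      rw [← hdeg, Finsupp.weight_apply, Finsupp.sum_fintype] <;> simp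
    rw [this]; ring
  have hzero : ∀ ζ : Fin d → ℝ, (∀ j, ζ j < 0) → ∀ i < m,  i < D →
      MvPolynomial.eval ζ (N.homogeneousComponent i) = 0 := by
    intro ζ hζ i hi hiD
    have hdvd := X_pow_dvd_of_isBigO m
      (∑ i ∈ Finset.range D, Polynomial.C (MvPolynomial.eval ζ (N.homogeneousComponent i))
        * Polynomial.X ^ i) (by
        refine (h ζ hζ).congr_left fun τ => ?_
        rw [hexp]
        simp [Polynomial.eval_finsetSum])
    rw [Polynomial.X_pow_dvd_iff] at hdvd
    have := hdvd i hi
    simpa [Polynomial.finsetSum_coeff, Polynomial.coeff_X_pow, hiD] using this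
  have hbd : ∀ i, ∃ c, ∀ ζ ∈ Icc (fun _ : Fin d => (-1 : ℝ)) (fun _ => 0),
      ‖MvPolynomial.eval ζ (N.homogeneousComponent i)‖ ≤ c := fun i =>
    isCompact_Icc.exists_bound_of_continuousOn (MvPolynomial.continuous_eval _).continuousOn
  choose c hc using hbd
  refine ⟨∑ i ∈ Finset.range D, |c i| + 1, by positivity, fun x hx hx1 => ?_⟩
  set w := ∑ j, -x j with hw
  have hw0 : 0 ≤ w := Finset.sum_nonneg fun j _ => by linarith [hx j]
  have hxw : ∀ j, -x j ≤ w := fun j =>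
    Finset.single_le_sum (f := fun j => -x j) (fun j _ => by linarith [hx j]) (Finset.mem_univ j)
  rcases hw0.eq_or_lt with h0 | hwpos
  · have := hxw ⟨0, hd⟩
    linarith [hx ⟨0, hd⟩]
  -- The direction is normalised into the compact cube `[-1,0]^d`, where the homogeneous components
  -- are bounded. Those of degree below `m` vanish in this direction, and the others carry `w ^ i ≤
  -- w ^ m` because `w ≤ 1`.
  · set ζ : Fin d → ℝ := w⁻¹ • x with hζ
    have hxζ : x = w • ζ := by rw [hζ, smul_smul, mul_inv_cancel₀ hwpos.ne', one_smul]
    have hζneg : ∀ j, ζ j < 0 := fun j => by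
      simp only [hζ, Pi.smul_apply, smul_eq_mul]
      exact mul_neg_of_pos_of_neg (inv_pos.2 hwpos) (hx j)
    have hζmem : ζ ∈ Icc (fun _ : Fin d => (-1 : ℝ)) (fun _ => 0) := by
      refine ⟨fun j => ?_, fun j => (hζneg j).le⟩
      simp only [hζ, Pi.smul_apply, smul_eq_mul]
      rw [← div_eq_inv_mul, le_div_iff₀ hwpos]
      linarith [hxw j]
    rw [hxζ, hexp]
    calc |∑ i ∈ Finset.range D, MvPolynomial.eval ζ (N.homogeneousComponent i) * w ^ i|
        ≤ ∑ i ∈ Finset.range D, |c i| * w ^ m := by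
          refine (Finset.abs_sum_le_sum_abs _ _).trans (Finset.sum_le_sum fun i hi => ?_)
          rcases lt_or_ge i m with him | him
          · rw [hzero ζ hζneg i him (Finset.mem_range.1 hi)]
            simp only [zero_mul, abs_zero]
            positivity
          · rw [abs_mul, abs_of_nonneg (pow_nonneg hw0 i)]
            refine mul_le_mul ?_ (pow_le_pow_of_le_one hw0 hx1 him) (by positivity) (abs_nonneg _)
            exact (hc i ζ hζmem).trans (le_abs_self _)
      _ ≤ _ := by
          rw [← Finset.sum_mul, hw]
          have : 0 ≤ w ^ m := by positivity
          nlinarith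

end AMFWMethod

/-! ### The order conditions, extracted from scalar test problems. -/

namespace AMFWMethod

variable {s d : ℕ} (M : AMFWMethod s)

/-- The order conditions, read off from the scalar problems `y' = λ y + g(t)` with solution
`y = t ^ k / k!` and `W` such that `1 - θ τ W = ∏ (1 - θ τ ζ_j)`. -/
theorem HasRosenbrockOrder.taylorSymbol_isBigO {M : AMFWMethod s} {p : ℕ}
    (h : M.HasRosenbrockOrder p) {k : ℕ} (hk : 1 ≤ k) (ζ : Fin d → ℝ) :
    (fun τ : ℝ => τ ^ k * M.taylorSymbol k (τ • ζ)) =O[𝓝[>] 0] fun τ => τ ^ (p + 1) := by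
  set lam := ∑ j, ζ j with hlam
  set g : ℝ → ℝ := fun t => t ^ (k - 1) / (k - 1).factorial - lam * (t ^ k / k.factorial) with hg
  set F : ℝ → (Fin 1 → ℝ) → (Fin 1 → ℝ) := fun t y => lam • y + fun _ => g t with hF
  set y : ℝ → Fin 1 → ℝ := fun t _ => t ^ k / k.factorial with hy
  -- The telescoped product gives `Π = 1 - θ τ om(τ)`. Since `om` is a polynomial in `τ` with `om 0
  -- = λ`, the choice `W = om(τ)` is an admissible `O(τ)` perturbation of the exact Jacobian.
  set om : ℝ → ℝ := fun τ => ∑ j, ζ j * ∏ i ∈ Finset.univ with i < j, (1 - M.θ * (τ * ζ i)) with hom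
  have hamp : ∀ τ : ℝ, M.ampl (τ • ζ) = 1 - M.θ * τ * om τ := by
    intro τ
    simp only [ampl, hom, Pi.smul_apply, smul_eq_mul]
    rw [Finset.prod_one_sub_ordered, Finset.mul_sum]
    congr 1
    exact Finset.sum_congr rfl fun j _ => by ring
  have hFs : ContDiff ℝ ∞ (Function.uncurry F) := by
    rw [contDiff_pi]
    intro i
    simp only [Function.uncurry, hF, hg]
    fun_prop
  have hpow : ∀ t : ℝ, HasDerivAt (fun t : ℝ => t ^ k / k.factorial)
      (t ^ (k - 1) / (k - 1).factorial) t := by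
    intro t
    have h1 := (hasDerivAt_pow k t).div_const (k.factorial : ℝ)
    refine h1.congr_deriv ?_
    obtain ⟨m, rfl⟩ : ∃ m, k = m + 1 := ⟨k - 1, by omega⟩
    simp only [Nat.add_sub_cancel, Nat.factorial_succ]
    push_cast
    have : (m.factorial : ℝ) ≠ 0 := by positivity
    have : (m : ℝ) + 1 ≠ 0 := by positivity
    field_simp
  have hsol : ∀ t, HasDerivAt y (F t (y t)) t := by
    intro t
    rw [hasDerivAt_pi]
    intro i
    refine (hpow t).congr_deriv ?_
    simp only [hF, hy, hg, Pi.add_apply, Pi.smul_apply, smul_eq_mul]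
    ring
  have hy0 : y 0 = 0 := by
    funext i
    simp [hy, show k ≠ 0 by omega]
  have hderivg : deriv g 0 = (if k = 2 then 1 else 0) - lam * (if k = 1 then 1 else 0) := by
    have h1 := ((hasDerivAt_pow (k - 1) (0 : ℝ)).div_const ((k - 1).factorial : ℝ)).sub
      ((hpow 0).const_mul lam)
    have h2 : deriv g 0 = _ := h1.deriv
    rw [h2]
    obtain ⟨m, rfl⟩ : ∃ m, k = m + 1 := ⟨k - 1, by omega⟩
    rcases m with _ | _ | m <;> simp
  have hderivF : deriv (fun σ => F σ (y 0)) 0 = fun _ => deriv g 0 := by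
    have hgd : DifferentiableAt ℝ g 0 := by simp only [hg]; fun_prop
    have : HasDerivAt (fun σ => F σ (y 0)) (fun _ => deriv g 0) 0 := by
      rw [hasDerivAt_pi]
      intro i
      simp only [hF, Pi.add_apply]
      exact hgd.hasDerivAt.const_add _
    exact this.deriv
  set W : ℝ → ((Fin 1 → ℝ) →L[ℝ] (Fin 1 → ℝ)) := fun τ => om τ • ContinuousLinearMap.id ℝ _ with hW
  have hfd : fderiv ℝ (F 0) (y 0) = om 0 • ContinuousLinearMap.id ℝ _ := by
    have h0 : om 0 = lam := by simp [hom, hlam]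
    have : HasFDerivAt (F 0) (lam • ContinuousLinearMap.id ℝ (Fin 1 → ℝ)) (y 0) := by
      simp only [hF]
      exact ((hasFDerivAt_id _).const_smul lam).add_const _
    rw [this.fderiv, h0]
  have hWO : (fun τ => W τ - fderiv ℝ (F 0) (y 0)) =O[𝓝[>] 0] fun τ => τ := by
    rw [hfd]
    have hd : DifferentiableAt ℝ W 0 := by
      simp only [hW, hom]
      apply DifferentiableAt.smul_const
      fun_prop
    have := hd.isBigO_sub
    simp only [sub_zero] at this
    exact this.mono nhdsWithin_le_nhds
  set rhs : ℝ → Fin s → ℝ := fun τ i =>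
    τ * g (M.c i * τ) + M.θ * M.rho i * τ ^ 2 * deriv g 0 with hrhs
  set v : ℝ → Fin 1 → ℝ := fun τ _ => M.stageFun (τ • ζ) (rhs τ) with hv
  have hne : ∀ᶠ τ : ℝ in 𝓝[>] 0, M.ampl (τ • ζ) ≠ 0 := by
    have hc : ContinuousAt (fun τ : ℝ => M.ampl (τ • ζ)) 0 := by
      simp only [ampl, Pi.smul_apply, smul_eq_mul]
      fun_prop
    have := hc.eventually_ne (y := 0) (by simp [ampl])
    exact this.filter_mono nhdsWithin_le_nhds
  have hstep : ∀ᶠ τ in 𝓝[>] 0, M.RosenbrockStep F (W τ) 0 τ (y 0) (v τ) := by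
    filter_upwards [hne] with τ hτ
    obtain ⟨q, hq⟩ := M.exists_stageMatrix_mulVec_eq (τ • ζ) hτ (rhs τ)
    refine ⟨fun i _ => q i, fun i => ?_, ?_⟩
    · have h1 := congrFun hq i
      rw [stageMatrix_mulVec_apply, hamp] at h1
      have hz : ∑ j, (τ • ζ) j = τ * lam := by
        simp [hlam, Finset.mul_sum]
      rw [hz] at h1
      simp only [hrhs] at h1
      rw [hderivF]
      funext e
      simp only [hW, hF, hy0, Pi.sub_apply, Pi.add_apply, Pi.smul_apply, smul_eq_mul,
        _root_.smul_apply, ContinuousLinearMap.id_apply, Finset.sum_apply, zero_add]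
      linarith
    · funext e
      simp only [hv, hy0, ← hq, M.stageFun_mulVec _ hτ, zero_add, Finset.sum_apply, Pi.smul_apply,
        smul_eq_mul]
      rfl
  have hmain := h 1 F hFs 0 y (Eventually.of_forall hsol) W hWO v hstep
  refine ((isBigO_pi.1 hmain) 0).congr_left fun τ => ?_
  -- For a monomial solution the stage data are homogeneous in `τ`, apart from the factor `τ λ = z`.
  -- The exceptional terms come from `g'(0)`, which is nonzero only through `k = 2` (from `y'`) and
  -- `k = 1` (from `λ y`).
  have hsplit : rhs τ = τ ^ k • (fun i => M.c i ^ (k - 1) / (k - 1).factorial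
        + if k = 2 then M.θ * M.rho i else 0) - (τ ^ k * (τ * lam)) •
        (fun i => M.c i ^ k / k.factorial + if k = 1 then M.θ * M.rho i else 0) := by
    funext i
    simp only [hrhs, hderivg]
    simp only [hg, Pi.sub_apply, Pi.smul_apply, smul_eq_mul]
    obtain ⟨m, rfl⟩ : ∃ m, k = m + 1 := ⟨k - 1, by omega⟩
    rcases m with _ | _ | m
    · simp; ring
    · simp; ring
    · simp; ring
  have hz : ∑ j, (τ • ζ) j = τ * lam := by
    simp [hlam, Finset.mul_sum]
  simp only [zero_add, hy, hv, Pi.sub_apply, hsplit, map_sub, map_smul, smul_eq_mul, taylorSymbol,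
    hz]
  ring

theorem HasRosenbrockOrder.mono {M : AMFWMethod s} {p p' : ℕ} (h : M.HasRosenbrockOrder p)
    (hp : p' ≤ p) : M.HasRosenbrockOrder p' := by
  intro m F hF t₀ y hy W hW v hv
  refine (h m F hF t₀ y hy W hW v hv).trans ?_
  refine IsBigO.of_bound 1 ?_
  have : ∀ᶠ τ : ℝ in 𝓝[>] 0, τ < 1 := by
    apply Filter.Eventually.filter_mono nhdsWithin_le_nhds
    exact gt_mem_nhds one_pos
  filter_upwards [self_mem_nhdsWithin, this] with τ h0 h1
  rw [one_mul, Real.norm_of_nonneg (pow_nonneg (le_of_lt h0) _),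
    Real.norm_of_nonneg (pow_nonneg (le_of_lt h0) _)]
  exact pow_le_pow_of_le_one (le_of_lt h0) h1.le (by omega)

/-- The order conditions in the form in which they control the symbols along rays. -/
theorem HasRosenbrockOrder.taylorSymbol_isBigO' {M : AMFWMethod s} {p : ℕ}
    (h : M.HasRosenbrockOrder p) {k : ℕ} (hk : 1 ≤ k) (hkp : k ≤ p + 1) (ζ : Fin d → ℝ) :
    (fun τ : ℝ => M.taylorSymbol k (τ • ζ)) =O[𝓝[>] 0] fun τ => τ ^ (p + 1 - k) := by
  have h1 := (h.taylorSymbol_isBigO hk ζ).mul (isBigO_refl (fun τ : ℝ => (τ ^ k)⁻¹) (𝓝[>] 0))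
  refine h1.congr' ?_ ?_
  · filter_upwards [self_mem_nhdsWithin] with τ hτ
    have hτ' : (τ : ℝ) ≠ 0 := ne_of_gt hτ
    field_simp
  · filter_upwards [self_mem_nhdsWithin] with τ hτ
    have hτ' : (τ : ℝ) ≠ 0 := ne_of_gt hτ
    rw [pow_sub₀ _ hτ' hkp]

/-- Writing the vector of ones through `stageMatrix_mulVec_rho` cancels the contributions of `c`.
What is left is the factorization defect `Π - 1 + θ z`, which contains only products of at least two
of the `x_j`. -/
theorem taylorSymbol_one (x : Fin d → ℝ) (hx : M.ampl x ≠ 0) :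
    M.taylorSymbol 1 x = 1 - dotProduct M.b M.rho
      + (M.ampl x - 1 + M.θ * ∑ j, x j) * M.stageFun x M.rho := by
  have h1 : (fun _ => 1 : Fin s → ℝ) = Matrix.mulVec (M.stageMatrix x) M.rho
      + (∑ j, x j) • M.c + (1 - M.ampl x) • M.rho := by
    funext i
    simp only [Pi.add_apply, Pi.smul_apply, smul_eq_mul, stageMatrix_mulVec_rho]
    ring
  have h2 : (fun i => M.c i + M.θ * M.rho i) = M.c + M.θ • M.rho := by
    funext i; simp
  simp only [taylorSymbol, Nat.factorial, Nat.cast_one, div_one, Nat.sub_self, pow_zero, if_true,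
    pow_one, OfNat.one_ne_ofNat, if_false, add_zero, mul_one]
  rw [h1, h2]
  simp only [map_add, map_smul, M.stageFun_mulVec x hx, smul_eq_mul]
  ring

/-- The case of no directions is used: then `Π = 1`, `z = 0`, and the symbol of index one is the
constant `1 - b·ρ`, which has to tend to 0. -/
theorem HasRosenbrockOrder.dotProduct_rho {M : AMFWMethod s} {p : ℕ} (hp : 1 ≤ p)
    (h : M.HasRosenbrockOrder p) : dotProduct M.b M.rho = 1 := by
  have h1 := (h.taylorSymbol_isBigO' le_rfl (by omega) (0 : Fin 0 → ℝ)).trans_tendsto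
    (tendsto_nhdsWithin_of_tendsto_nhds ((continuous_pow (p + 1 - 1)).tendsto' (0 : ℝ) 0
      (by simp; omega)))
  have h2 : ∀ τ : ℝ, M.taylorSymbol 1 (τ • (0 : Fin 0 → ℝ)) = 1 - dotProduct M.b M.rho := by
    intro τ
    rw [taylorSymbol_one] <;> simp [ampl]
  simp only [h2] at h1
  have := tendsto_nhds_unique h1 tendsto_const_nhds
  linarith

end AMFWMethod

/-! ### Positivity of `θ` and bounds of the symbols on the negative orthant. -/

namespace AMFWMethod

variable {s d : ℕ} (M : AMFWMethod s)

/-- The two stability bounds together force `-2 ≤ C z / Π`. This fails for large arguments when `Π`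
does not grow, and near a zero of `Π` when `θ < 0`. -/
theorem theta_pos_of_stable {M : AMFWMethod s} (hd : 1 ≤ d) {C : ℝ} (hC : 0 < C)
    (hstab : ∀ x : Fin d → ℝ, (∀ j, x j < 0) →
      -1 ≤ M.stabilityFunction x ∧
      M.stabilityFunction x ≤ 1 + C * ((∑ j, x j) / ∏ j, (1 - M.θ * x j))) : 0 < M.θ := by
  have key : ∀ x : Fin d → ℝ, (∀ j, x j < 0) →
      -2 ≤ C * ((∑ j, x j) / ∏ j, (1 - M.θ * x j)) := fun x hx => by
    have := hstab x hx
    linarith [this.1, this.2]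
  have hd' : (1 : ℝ) ≤ d := by exact_mod_cast hd
  by_contra hneg
  rcases (not_lt.1 hneg).eq_or_lt with h0 | h0
  · have := key (fun _ => -(3 / C)) (fun _ => by simp; positivity)
    simp only [h0, zero_mul, sub_zero, Finset.prod_const_one, div_one, Finset.sum_const,
      Finset.card_univ, Fintype.card_fin, nsmul_eq_mul] at this
    have h3 : C * (d * -(3 / C)) = -3 * d := by field_simp
    linarith
  · set θ := M.θ
    set e : ℝ := C / (C + 4 * -θ) with he
    have hden : 0 < C + 4 * -θ := by linarith
    have he0 : 0 < e := by positivity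
    have he1 : e < 1 := by rw [he, div_lt_one hden]; linarith
    have hθ' : θ ≠ 0 := h0.ne
    have hx : ∀ _ : Fin d, (1 - e) / θ < 0 := fun _ => div_neg_of_pos_of_neg (by linarith) h0
    have := key (fun _ => (1 - e) / θ) hx
    simp only [mul_div_cancel₀ _ hθ', Finset.prod_const, Finset.sum_const, sub_sub_cancel,
      Finset.card_univ, Fintype.card_fin, nsmul_eq_mul] at this
    have hed : e ^ d ≤ e := by
      calc e ^ d ≤ e ^ 1 := pow_le_pow_of_le_one he0.le he1.le hd
        _ = e := pow_one e
    have hed0 : 0 < e ^ d := pow_pos he0 d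
    rw [mul_div_assoc', le_div_iff₀ hed0] at this
    have h4 : C * (d * ((1 - e) / θ)) ≤ C * ((1 - e) / θ) := by
      have : d * ((1 - e) / θ) ≤ (1 - e) / θ := by nlinarith [hx ⟨0, hd⟩]
      exact mul_le_mul_of_nonneg_left this hC.le
    have h5 : -2 * e ≤ C * ((1 - e) / θ) := by nlinarith
    have h6 : C * ((1 - e) / θ) = -4 * e := by
      have h7 : e * (C + 4 * -θ) = C := div_mul_cancel₀ _ hden.ne'
      field_simp
      linarith
    linarith

theorem abs_sum_eq {x : Fin d → ℝ} (hx : ∀ j, x j < 0) : |∑ j, x j| = ∑ j, -x j := by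
  rw [Finset.sum_neg_distrib, abs_of_nonpos (Finset.sum_nonpos fun j _ => (hx j).le)]

/-- Bounds for the functional of the stages, with and without a factor `z`. -/
theorem exists_stageFun_le (hθ : 0 < M.θ) :
    ∃ C > 0, ∀ x : Fin d → ℝ, (∀ j, x j < 0) → ∀ (y : Fin s → ℝ) (Y : ℝ), 0 ≤ Y →
      (∀ i, |y i| ≤ Y) → M.ampl x * |M.stageFun x y| ≤ C * Y ∧ |M.stageFun x y| ≤ C * Y ∧
        |(∑ j, x j) * M.stageFun x y| ≤ C * Y := by
  obtain ⟨C, hC, h⟩ := M.exists_ampl_mul_stageFun_le (d := d) hθ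
  refine ⟨C * (1 + 1 / M.θ), by positivity, fun x hx y Y hY hy => ?_⟩
  have h1 := h x hx y Y hY hy
  have h2 := M.one_le_ampl hθ hx
  have h3 := M.theta_mul_sum_le_ampl hθ hx
  have hCY : 0 ≤ C * Y := by positivity
  have hCY' : C * Y ≤ C * (1 + 1 / M.θ) * Y := by
    have : 0 ≤ C * Y * (1 / M.θ) := by positivity
    nlinarith
  have h4 : |M.stageFun x y| ≤ C * Y := by nlinarith [abs_nonneg (M.stageFun x y)]
  refine ⟨h1.trans hCY', h4.trans hCY', ?_⟩
  rw [abs_mul, abs_sum_eq hx]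
  have h5 : ∑ j, -x j ≤ (1 / M.θ) * M.ampl x := by
    rw [div_mul_eq_mul_div, one_mul, le_div_iff₀ hθ]; linarith
  calc (∑ j, -x j) * |M.stageFun x y| ≤ (1 / M.θ) * M.ampl x * |M.stageFun x y| :=
        mul_le_mul_of_nonneg_right h5 (abs_nonneg _)
    _ = (1 / M.θ) * (M.ampl x * |M.stageFun x y|) := by ring
    _ ≤ (1 / M.θ) * (C * Y) := mul_le_mul_of_nonneg_left h1 (by positivity)
    _ ≤ _ := by nlinarith

/-- A bounded rational symbol that is `O(τ ^ m)` along rays is bounded by `min 1 |x| ^ m`. -/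
theorem exists_abs_le_min (hd : 0 < d) (hθ : 0 < M.θ) (f : (Fin d → ℝ) → ℝ) (m : ℕ)
    (hb : ∃ B, ∀ x : Fin d → ℝ, (∀ j, x j < 0) → |f x| ≤ B)
    (hN : ∃ N : MvPolynomial (Fin d) ℝ, ∀ x : Fin d → ℝ, M.ampl x ≠ 0 →
      M.ampl x ^ s * f x = MvPolynomial.eval x N)
    (hray : ∀ ζ : Fin d → ℝ, (∀ j, ζ j < 0) →
      (fun τ : ℝ => f (τ • ζ)) =O[𝓝[>] 0] fun τ => τ ^ m) :
    ∃ C > 0, ∀ x : Fin d → ℝ, (∀ j, x j < 0) → |f x| ≤ C * min 1 ((∑ j, -x j) ^ m) := by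
  obtain ⟨B, hB⟩ := hb
  obtain ⟨N, hN⟩ := hN
  obtain ⟨C, hC, hC'⟩ := exists_abs_eval_le_of_isBigO hd N m (by
    intro ζ hζ
    have h1 : (fun τ : ℝ => M.ampl (τ • ζ) ^ s) =O[𝓝[>] 0] fun _ => (1 : ℝ) := by
      have hc : ContinuousAt (fun τ : ℝ => M.ampl (τ • ζ) ^ s) 0 := by
        simp only [ampl, Pi.smul_apply, smul_eq_mul]
        fun_prop
      exact (tendsto_nhdsWithin_of_tendsto_nhds hc).isBigO_one ℝ
    have h2 := h1.mul (hray ζ hζ)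
    simp only [one_mul] at h2
    refine h2.congr' ?_ EventuallyEq.rfl
    filter_upwards [self_mem_nhdsWithin] with τ hτ
    exact hN _ (M.ampl_pos hθ fun j => mul_neg_of_pos_of_neg hτ (hζ j)).ne')
  refine ⟨|B| + C, by positivity, fun x hx => ?_⟩
  have hw0 : 0 ≤ ∑ j, -x j := Finset.sum_nonneg fun j _ => by linarith [hx j]
  rcases le_total (∑ j, -x j) 1 with h1 | h1
  · have h2 := hC' x hx h1
    rw [← hN x (M.ampl_pos hθ hx).ne', abs_mul, abs_of_pos (pow_pos (M.ampl_pos hθ hx) s)] at h2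
    have h3 : 1 ≤ M.ampl x ^ s := one_le_pow₀ (M.one_le_ampl hθ hx)
    rw [min_eq_right (pow_le_one₀ hw0 h1)]
    have : 0 ≤ |B| * (∑ j, -x j) ^ m := by positivity
    nlinarith [abs_nonneg (f x)]
  · rw [min_eq_left (one_le_pow₀ h1)]
    linarith [hB x hx, le_abs_self B]

/-- The decay near 0 comes from the order conditions, the bound by a constant far away from the
boundedness of the stage functional with and without the factor `z`. The saturation at 1 is what
makes the estimate uniform in the mesh. -/
theorem exists_taylorSymbol_le {M : AMFWMethod s} {p : ℕ} (hd : 0 < d) (hθ : 0 < M.θ)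
    (h : M.HasRosenbrockOrder p) {k : ℕ} (hk : 1 ≤ k) (hkp : k ≤ p + 1) :
    ∃ C > 0, ∀ x : Fin d → ℝ, (∀ j, x j < 0) →
      |M.taylorSymbol k x| ≤ C * min 1 ((∑ j, -x j) ^ (p + 1 - k)) := by
  refine M.exists_abs_le_min hd hθ _ _ ?_ (M.exists_mvPolynomial_taylorSymbol k)
    fun ζ _ => h.taylorSymbol_isBigO' hk hkp ζ
  obtain ⟨C, hC, hC'⟩ := M.exists_stageFun_le (d := d) hθ
  set y₁ : Fin s → ℝ := fun i => M.c i ^ (k - 1) / (k - 1).factorial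
        + if k = 2 then M.θ * M.rho i else 0
  set y₂ : Fin s → ℝ := fun i => M.c i ^ k / k.factorial + if k = 1 then M.θ * M.rho i else 0
  refine ⟨|1 / (k.factorial : ℝ)| + C * ‖y₁‖ + C * ‖y₂‖, fun x hx => ?_⟩
  have h1 := (hC' x hx y₁ ‖y₁‖ (norm_nonneg _) fun i => norm_le_pi_norm y₁ i).2.1
  have h2 := (hC' x hx y₂ ‖y₂‖ (norm_nonneg _) fun i => norm_le_pi_norm y₂ i).2.2
  refine (abs_add_le _ _).trans (add_le_add ?_ h2)
  exact (abs_sub _ _).trans (add_le_add le_rfl h1)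

theorem add_mul_le_prod {ι : Type*} [DecidableEq ι] (S : Finset ι) (y : ι → ℝ)
    (hy : ∀ i ∈ S, 0 ≤ y i) {a b : ι} (ha : a ∈ S) (hb : b ∈ S) (hab : a ≠ b) :
    1 + ∑ i ∈ S, y i + y a * y b ≤ ∏ i ∈ S, (1 + y i) := by
  rw [← Finset.mul_prod_erase S _ ha, ← Finset.add_sum_erase S _ ha]
  have h1 := one_add_sum_le_prod (S.erase a) y fun i hi => hy i (Finset.mem_of_mem_erase hi)
  have h2 : y b ≤ ∑ i ∈ S.erase a, y i :=
    Finset.single_le_sum (fun i hi => hy i (Finset.mem_of_mem_erase hi))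
      (Finset.mem_erase.2 ⟨hab.symm, hb⟩)
  have h3 := hy a ha
  nlinarith

/-- The symbol of index one is `(Π - 1 + θ z)` times the stage functional of `ρ` and is `O(τ^p)`
along rays. With two different directions the defect is at least `θ² x_a x_b`, of exact order `τ²`,
so dividing it out leaves `O(τ^(p-2))`. With a single direction the defect is zero and nothing can
be concluded. -/
theorem exists_stageFun_rho_le {M : AMFWMethod s} {p : ℕ} (hd : 2 ≤ d) (hθ : 0 < M.θ)
    (h : M.HasRosenbrockOrder p) (hp : 2 ≤ p) :
    ∃ C > 0, ∀ x : Fin d → ℝ, (∀ j, x j < 0) →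
      M.ampl x * |M.stageFun x M.rho| ≤ C * min 1 ((∑ j, -x j) ^ (p - 2)) := by
  have hrho := h.dotProduct_rho (by omega)
  have := M.exists_abs_le_min (d := d) (by omega) hθ (fun x => M.ampl x * M.stageFun x M.rho) (p - 2)
    ?_ ?_ ?_
  · obtain ⟨C, hC, h'⟩ := this
    refine ⟨C, hC, fun x hx => ?_⟩
    have := h' x hx
    rwa [abs_mul, abs_of_pos (M.ampl_pos hθ hx)] at this
  · obtain ⟨C, hC, hC'⟩ := M.exists_stageFun_le (d := d) hθ
    refine ⟨C * ‖M.rho‖, fun x hx => ?_⟩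
    rw [abs_mul, abs_of_pos (M.ampl_pos hθ hx)]
    exact (hC' x hx M.rho ‖M.rho‖ (norm_nonneg _) fun i => norm_le_pi_norm M.rho i).1
  · obtain ⟨N, hN⟩ := M.exists_mvPolynomial_stageFun (d := d) M.rho
    refine ⟨(∏ j : Fin d, (1 - MvPolynomial.C M.θ * MvPolynomial.X j)) * N, fun x hx => ?_⟩
    simp only [map_mul, map_prod, map_sub, map_one, MvPolynomial.eval_C, MvPolynomial.eval_X,
      ← hN x hx, ampl]
    ring
  · intro ζ hζ
    set a : Fin d := ⟨0, by omega⟩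
    set b : Fin d := ⟨1, by omega⟩
    have hab : a ≠ b := by simp [a, b]
    have h1 : (fun τ : ℝ => M.stageFun (τ • ζ) M.rho) =O[𝓝[>] 0] fun τ => τ ^ (p - 2) := by
      have h2 := h.taylorSymbol_isBigO' le_rfl (by omega) ζ
      have h3 : (fun τ : ℝ => M.stageFun (τ • ζ) M.rho)
          =O[𝓝[>] 0] fun τ => M.taylorSymbol 1 (τ • ζ) * (τ ^ 2)⁻¹ := by
        have hc : 0 < M.θ * ζ a * (M.θ * ζ b) :=
          mul_pos_of_neg_of_neg (by nlinarith [hζ a]) (by nlinarith [hζ b])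
        refine IsBigO.of_bound (M.θ * ζ a * (M.θ * ζ b))⁻¹ ?_
        filter_upwards [self_mem_nhdsWithin] with τ hτ
        have hτ0 : 0 < τ := hτ
        have hneg : ∀ j, (τ • ζ) j < 0 := fun j => mul_neg_of_pos_of_neg hτ0 (hζ j)
        have hlow := add_mul_le_prod Finset.univ (fun j => M.θ * -(τ • ζ) j)
          (fun j _ => by nlinarith [hneg j]) (Finset.mem_univ a) (Finset.mem_univ b) hab
        rw [← ampl_eq_prod, ← Finset.mul_sum, Finset.sum_neg_distrib] at hlow
        simp only [Pi.smul_apply, smul_eq_mul] at hlow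
        have hlow' : M.θ * ζ a * (M.θ * ζ b) * τ ^ 2 ≤
            M.ampl (τ • ζ) - 1 + M.θ * ∑ j, (τ • ζ) j := by
          simp only [Pi.smul_apply, smul_eq_mul]
          nlinarith
        have hpos : 0 < M.θ * ζ a * (M.θ * ζ b) * τ ^ 2 := by positivity
        rw [taylorSymbol_one _ _ (M.ampl_pos hθ hneg).ne', hrho, sub_self, zero_add, norm_mul,
          norm_mul, norm_inv, Real.norm_of_nonneg (hpos.le.trans hlow'),
          Real.norm_of_nonneg (by positivity : (0 : ℝ) ≤ τ ^ 2)]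
        rw [← mul_assoc, mul_comm, ← mul_assoc]
        have : 1 ≤ (τ ^ 2)⁻¹ * (M.θ * ζ a * (M.θ * ζ b))⁻¹ *
            (M.ampl (τ • ζ) - 1 + M.θ * ∑ j, (τ • ζ) j) := by
          rw [← mul_inv, ← div_eq_inv_mul, one_le_div (by positivity)]
          linarith
        calc ‖M.stageFun (τ • ζ) M.rho‖ ≤ _ := le_mul_of_one_le_left (norm_nonneg _) this
          _ = _ := by ring
      refine h3.trans ?_
      refine (h2.mul (isBigO_refl (fun τ : ℝ => (τ ^ 2)⁻¹) (𝓝[>] 0))).congr' EventuallyEq.rfl ?_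
      filter_upwards [self_mem_nhdsWithin] with τ hτ
      have hτ' : (τ : ℝ) ≠ 0 := ne_of_gt hτ
      rw [← pow_sub₀ _ hτ' (by omega)]
      congr 1
    have h4 : (fun τ : ℝ => M.ampl (τ • ζ)) =O[𝓝[>] 0] fun _ => (1 : ℝ) := by
      have hc : ContinuousAt (fun τ : ℝ => M.ampl (τ • ζ)) 0 := by
        simp only [ampl, Pi.smul_apply, smul_eq_mul]
        fun_prop
      exact (tendsto_nhdsWithin_of_tendsto_nhds hc).isBigO_one ℝ
    simpa using h4.mul h1

theorem min_one_pow_le_rpow {w : ℝ} (hw : 0 ≤ w) {m : ℕ} {a : ℝ} (ha : 0 ≤ a) (ham : a ≤ m) :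
    min 1 (w ^ m) ≤ w ^ a := by
  rcases le_total w 1 with h | h
  · refine (min_le_right _ _).trans ?_
    rw [← Real.rpow_natCast]
    exact Real.rpow_le_rpow_of_exponent_ge_of_imp hw h ham (fun _ h1 => le_antisymm (h1 ▸ ham) ha)
  · exact (min_le_left _ _).trans (Real.one_le_rpow h ha)

end AMFWMethod

/-! ### One-dimensional estimates -/

/-- `g 0, g 1, …, g r` are functions on `[a, b]`, each being the derivative of the previous one. -/
def IsDerivChain (a b : ℝ) (r : ℕ) (g : ℕ → ℝ → ℝ) : Prop :=
  ∀ i < r, ∀ x ∈ Icc a b, HasDerivWithinAt (g i) (g (i + 1) x) (Icc a b) x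

theorem IsDerivChain.mono {a b : ℝ} {r r' : ℕ} {g : ℕ → ℝ → ℝ} (h : IsDerivChain a b r g)
    (hr : r' ≤ r) : IsDerivChain a b r' g := fun i hi x hx => h i (hi.trans_le hr) x hx

theorem IsDerivChain.shift {a b : ℝ} {r m : ℕ} {g : ℕ → ℝ → ℝ} (h : IsDerivChain a b (r + m) g) :
    IsDerivChain a b r (fun i => g (i + m)) := fun i hi x hx => by
  have := h (i + m) (by omega) x hx
  rwa [show i + m + 1 = i + 1 + m by omega] at this

/-- The remainder has as derivative the remainder of the shifted chain, so induction and the mean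
value inequality suffice. The factor `1/r!` is given up, which only affects constants. -/
theorem IsDerivChain.taylor {a b : ℝ} {r : ℕ} {g : ℕ → ℝ → ℝ} (h : IsDerivChain a b r g) {B : ℝ}
    (hB : ∀ x ∈ Icc a b, |g r x| ≤ B) {x y : ℝ} (hx : x ∈ Icc a b) (hy : y ∈ Icc a b) :
    |g 0 y - ∑ i ∈ Finset.range r, (y - x) ^ i / i.factorial * g i x| ≤ B * |y - x| ^ r := by
  induction r generalizing g y with
  | zero => simpa using hB y hy
  | succ r ih =>
    have hsub : uIcc x y ⊆ Icc a b := uIcc_subset_Icc hx hy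
    have hB0 : 0 ≤ B := (abs_nonneg _).trans (hB x hx)
    set f : ℝ → ℝ := fun z => g 0 z -
      ∑ i ∈ Finset.range (r + 1), (z - x) ^ i / i.factorial * g i x with hf
    have hpow : ∀ (i : ℕ) (z : ℝ), HasDerivAt (fun z : ℝ => (z - x) ^ (i + 1) / (i + 1).factorial)
        ((z - x) ^ i / i.factorial) z := by
      intro i z
      refine ((((hasDerivAt_id z).sub_const x).pow (i + 1)).div_const _).congr_deriv ?_
      simp only [Nat.add_sub_cancel, Nat.factorial_succ, id]
      push_cast
      have : (i.factorial : ℝ) ≠ 0 := by positivity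
      have : (i : ℝ) + 1 ≠ 0 := by positivity
      field_simp
    have hder : ∀ z ∈ uIcc x y, HasDerivWithinAt f
        (g 1 z - ∑ i ∈ Finset.range r, (z - x) ^ i / i.factorial * g (i + 1) x) (uIcc x y) z := by
      intro z hz
      have h1 := (h 0 (by omega) z (hsub hz)).mono hsub
      have h2 : HasDerivWithinAt
          (fun z => ∑ i ∈ Finset.range (r + 1), (z - x) ^ i / i.factorial * g i x)
          (∑ i ∈ Finset.range r, (z - x) ^ i / i.factorial * g (i + 1) x) (uIcc x y) z := by
        simp only [Finset.sum_range_succ' _ r]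
        have h3 : HasDerivWithinAt
            (fun z => ∑ i ∈ Finset.range r, (z - x) ^ (i + 1) / (i + 1).factorial * g (i + 1) x)
            (∑ i ∈ Finset.range r, (z - x) ^ i / i.factorial * g (i + 1) x) (uIcc x y) z :=
          HasDerivWithinAt.fun_sum fun i _ => ((hpow i z).hasDerivWithinAt).mul_const _
        simpa using h3.add_const (g 0 x)
      exact h1.sub h2
    have hbd : ∀ z ∈ uIcc x y,
        ‖g 1 z - ∑ i ∈ Finset.range r, (z - x) ^ i / i.factorial * g (i + 1) x‖ ≤
          B * |y - x| ^ r := by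
      intro z hz
      rw [Real.norm_eq_abs]
      refine (ih (g := fun i => g (i + 1)) (fun i hi => h (i + 1) (by omega)) hB (hsub hz)).trans ?_
      refine mul_le_mul_of_nonneg_left (pow_le_pow_left₀ (abs_nonneg _) ?_ _) hB0
      exact abs_sub_left_of_mem_uIcc hz
    have := (convex_uIcc x y).norm_image_sub_le_of_norm_hasDerivWithin_le hder hbd
      left_mem_uIcc right_mem_uIcc
    have hfx : f x = 0 := by
      simp [hf, Finset.sum_range_succ']
    rw [hfx, sub_zero, Real.norm_eq_abs, Real.norm_eq_abs, mul_assoc, ← pow_succ] at this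
    exact this

theorem IsDerivChain.abs_sub_le {a b : ℝ} {g : ℕ → ℝ → ℝ} (h : IsDerivChain a b 1 g) {B : ℝ}
    (hB : ∀ x ∈ Icc a b, |g 1 x| ≤ B) {x y : ℝ} (hx : x ∈ Icc a b) (hy : y ∈ Icc a b) :
    |g 0 y - g 0 x| ≤ B * |y - x| := by
  simpa using h.taylor hB hx hy

theorem IsDerivChain.second_difference_le {a b : ℝ} {g : ℕ → ℝ → ℝ} (h : IsDerivChain a b 2 g)
    {B : ℝ} (hB : ∀ x ∈ Icc a b, |g 2 x| ≤ B) {x k : ℝ} (hk : 0 ≤ k) (hx : x ∈ Icc a b)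
    (hp : x + k ∈ Icc a b) (hm : x - k ∈ Icc a b) :
    |g 0 (x + k) - 2 * g 0 x + g 0 (x - k)| ≤ 2 * B * k ^ 2 := by
  have h1 := abs_le.1 (h.taylor hB hx hp)
  have h2 := abs_le.1 (h.taylor hB hx hm)
  simp only [add_sub_cancel_left, sub_sub_cancel_left, Finset.sum_range_succ, Finset.sum_range_zero,
    abs_neg, abs_of_nonneg hk, Nat.factorial] at h1 h2
  norm_num at h1 h2
  rw [abs_le]
  constructor <;> nlinarith [h1.1, h1.2, h2.1, h2.2]

/-- The difference is `g(x+2k) - 3g(x+k) + 3g(x) - g(x-k)`; the Taylor remainders contribute `8 + 3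
+ 1 = 12`. -/
theorem IsDerivChain.third_difference_le {a b : ℝ} {g : ℕ → ℝ → ℝ} (h : IsDerivChain a b 3 g)
    {B : ℝ} (hB : ∀ x ∈ Icc a b, |g 3 x| ≤ B) {x k : ℝ} (hk : 0 ≤ k) (hx : x ∈ Icc a b)
    (hp : x + k ∈ Icc a b) (hm : x - k ∈ Icc a b) (hpp : x + k + k ∈ Icc a b) :
    |(g 0 (x + k + k) - 2 * g 0 (x + k) + g 0 x) - (g 0 (x + k) - 2 * g 0 x + g 0 (x - k))| ≤
      12 * B * k ^ 3 := by
  have h1 := abs_le.1 (h.taylor hB hx hp)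
  have h2 := abs_le.1 (h.taylor hB hx hm)
  have h3 := abs_le.1 (h.taylor hB hx hpp)
  rw [show x + k + k - x = 2 * k by ring, abs_of_nonneg (by positivity : 0 ≤ 2 * k)] at h3
  simp only [add_sub_cancel_left, sub_sub_cancel_left, Finset.sum_range_succ, Finset.sum_range_zero,
    abs_neg, abs_of_nonneg hk, Nat.factorial] at h1 h2 h3
  norm_num at h1 h2 h3
  ring_nf at h1 h2 h3 ⊢
  rw [abs_le]
  constructor <;> linarith [h1.1, h1.2, h2.1, h2.2, h3.1, h3.2]

theorem IsDerivChain.second_difference_sub_le {a b : ℝ} {g : ℕ → ℝ → ℝ}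
    (h : IsDerivChain a b 4 g) {B : ℝ} (hB : ∀ x ∈ Icc a b, |g 4 x| ≤ B) {x k : ℝ} (hk : 0 ≤ k)
    (hx : x ∈ Icc a b) (hp : x + k ∈ Icc a b) (hm : x - k ∈ Icc a b) :
    |g 0 (x + k) - 2 * g 0 x + g 0 (x - k) - k ^ 2 * g 2 x| ≤ 2 * B * k ^ 4 := by
  have h1 := abs_le.1 (h.taylor hB hx hp)
  have h2 := abs_le.1 (h.taylor hB hx hm)
  simp only [add_sub_cancel_left, sub_sub_cancel_left, Finset.sum_range_succ, Finset.sum_range_zero,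
    abs_neg, abs_of_nonneg hk, Nat.factorial] at h1 h2
  norm_num at h1 h2
  ring_nf at h1 h2 ⊢
  rw [abs_le]
  constructor <;> linarith [h1.1, h1.2, h2.1, h2.2]

/-- Summation by parts against a sine. -/
theorem abs_sum_sin_mul_le (t : ℝ) (G : ℕ → ℝ) (m : ℕ) {B V : ℝ} (hB : ∀ j < m, |G j| ≤ B)
    (hB0 : 0 ≤ B) (hV0 : 0 ≤ V) (hV : ∀ j, j + 1 < m → |G (j + 1) - G j| ≤ V) :
    |2 * Real.sin (t / 2) * ∑ j ∈ Finset.range m, Real.sin ((j + 1) * t) * G j| ≤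
      2 * B + m * V := by
  set c : ℕ → ℝ := fun j => Real.cos ((j + 1 / 2) * t) with hc
  have hc1 : ∀ j, |c j| ≤ 1 := fun j => Real.abs_cos_le_one _
  -- Multiplied by `2 sin(t/2)`, the sine becomes a difference of cosines at half-integer points, so
  -- the sum can be summed by parts.
  have hid : ∀ j : ℕ, 2 * Real.sin (t / 2) * Real.sin ((j + 1) * t) = c j - c (j + 1) := by
    intro j
    simp only [hc]
    rw [Real.cos_sub_cos]
    push_cast
    rw [show ((j + 1 / 2 : ℝ) * t + (j + 1 + 1 / 2) * t) / 2 = (j + 1) * t by ring,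
      show ((j + 1 / 2 : ℝ) * t - (j + 1 + 1 / 2) * t) / 2 = -(t / 2) by ring, Real.sin_neg]
    ring
  have hS : 2 * Real.sin (t / 2) * ∑ j ∈ Finset.range m, Real.sin ((j + 1) * t) * G j =
      ∑ j ∈ Finset.range m, G j * (c j - c (j + 1)) := by
    rw [Finset.mul_sum]
    refine Finset.sum_congr rfl fun j _ => ?_
    rw [← hid]; ring
  rw [hS]
  rcases m with _ | m
  · simpa using hB0
  -- With the boundary term `G q * c (q + 1)` included, passing from `q` to `q + 1` adds only one
  -- difference of `G`.
  have key : ∀ q ≤ m, |∑ j ∈ Finset.range (q + 1), G j * (c j - c (j + 1)) + G q * c (q + 1)| ≤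
      B + q * V := by
    intro q
    induction q with
    | zero =>
      intro _
      have : ∑ j ∈ Finset.range (0 + 1), G j * (c j - c (j + 1)) + G 0 * c (0 + 1) = G 0 * c 0 := by
        simp; ring
      rw [this, abs_mul]
      have := hB 0 (by omega)
      push_cast
      nlinarith [hc1 0, abs_nonneg (G 0), abs_nonneg (c 0)]
    | succ q ih =>
      intro hq
      have ih' := ih (by omega)
      have h1 : ∑ j ∈ Finset.range (q + 1 + 1), G j * (c j - c (j + 1)) + G (q + 1) * c (q + 1 + 1)
          = (∑ j ∈ Finset.range (q + 1), G j * (c j - c (j + 1)) + G q * c (q + 1))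
            + (G (q + 1) - G q) * c (q + 1) := by
        rw [Finset.sum_range_succ]; ring
      have h2 : |(G (q + 1) - G q) * c (q + 1)| ≤ V := by
        rw [abs_mul]
        have := hV q (by omega)
        nlinarith [hc1 (q + 1), abs_nonneg (G (q + 1) - G q), abs_nonneg (c (q + 1))]
      rw [h1]
      refine (abs_add_le _ _).trans ?_
      push_cast
      linarith
  have h1 := key m le_rfl
  have h2 : |G m * c (m + 1)| ≤ B := by
    rw [abs_mul]
    have := hB m (by omega)
    nlinarith [hc1 (m + 1), abs_nonneg (G m), abs_nonneg (c (m + 1))]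
  have h3 := abs_sub (∑ j ∈ Finset.range (m + 1), G j * (c j - c (j + 1)) + G m * c (m + 1))
    (G m * c (m + 1))
  rw [add_sub_cancel_right] at h3
  push_cast
  linarith

/-- The discrete Green identity. -/
theorem sum_mul_second_difference (f g : ℕ → ℝ) (m : ℕ) :
    ∑ j ∈ Finset.range m, (f (j + 1) * (g (j + 2) - 2 * g (j + 1) + g j)
      - g (j + 1) * (f (j + 2) - 2 * f (j + 1) + f j)) =
    (f m * g (m + 1) - f (m + 1) * g m) - (f 0 * g 1 - f 1 * g 0) := by
  induction m with
  | zero => simp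
  | succ m ih => rw [Finset.sum_range_succ, ih]; ring

theorem sin_second_difference (t : ℝ) (j : ℕ) :
    Real.sin ((j + 2 : ℕ) * t) - 2 * Real.sin ((j + 1 : ℕ) * t) + Real.sin (j * t) =
      -(4 * Real.sin (t / 2) ^ 2) * Real.sin ((j + 1 : ℕ) * t) := by
  push_cast
  rw [show ((j : ℝ) + 2) * t = (j + 1) * t + t by ring, show (j : ℝ) * t = (j + 1) * t - t by ring,
    Real.sin_add, Real.sin_sub]
  have h1 : Real.cos t = 1 - 2 * Real.sin (t / 2) ^ 2 := by
    rw [show t = 2 * (t / 2) by ring, Real.cos_two_mul, Real.cos_sq']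
    ring_nf
  rw [h1]; ring

/-- The sine vectors of the one-dimensional grid with `m` interior points. -/
def sineVec (m : ℕ) (k j : Fin m) : ℝ :=
  √2 * Real.sin (((j : ℕ) + 1) * (Real.pi * ((k : ℕ) + 1) / (m + 1)))

/-- Jordan's inequality `sin y ≥ 2y/π`. After division by the sine it yields one power of decay in
the wave number. -/
theorem sin_half_freq_ge {m : ℕ} (k : Fin m) :
    ((k : ℕ) + 1 : ℝ) / (m + 1) ≤ Real.sin (Real.pi * ((k : ℕ) + 1) / (m + 1) / 2) := by
  have hkm : ((k : ℕ) + 1 : ℝ) ≤ m := by exact_mod_cast k.2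
  have h := Real.mul_le_sin (x := Real.pi * ((k : ℕ) + 1) / (m + 1) / 2) (by positivity) (by
    rw [div_le_div_iff_of_pos_right two_pos, div_le_iff₀ (by positivity)]
    nlinarith [Real.pi_pos])
  refine le_trans (le_of_eq ?_) h
  field_simp

theorem sqrt_two_le : √2 ≤ (3 / 2 : ℝ) := by
  rw [Real.sqrt_le_left (by norm_num)]
  norm_num

/-- Summation by parts bounds the sum by `3B` over `2 sin(t/2)`, and the sine is at least the wave
number times the spacing. The constant is `√2 · 3/2 ≤ 9/4`, rounded up to 3. -/
theorem abs_sineVec_sum_le {m : ℕ} (k : Fin m) {g : ℕ → ℝ → ℝ} {B : ℝ}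
    (h : IsDerivChain 0 1 1 g) (hB : ∀ i ≤ 1, ∀ x ∈ Icc (0 : ℝ) 1, |g i x| ≤ B) :
    |∑ j : Fin m, (1 / (1 + m : ℝ) * sineVec m k j) * g 0 (((j : ℕ) + 1 : ℕ) * (1 / (1 + m : ℝ)))|
      ≤ 3 / ((k : ℕ) + 1 : ℝ) * B := by
  set t := Real.pi * ((k : ℕ) + 1 : ℝ) / (m + 1) with ht
  set e : ℝ := 1 / (1 + m) with he
  have he0 : 0 < e := by positivity
  have hem : m * e ≤ 1 := by rw [he, mul_one_div, div_le_one (by positivity)]; linarith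
  have hmem : ∀ j : ℕ, j < m → ((j + 1 : ℕ) : ℝ) * e ∈ Icc (0 : ℝ) 1 := by
    intro j hj
    refine ⟨by positivity, ?_⟩
    have : ((j + 1 : ℕ) : ℝ) ≤ m := by exact_mod_cast hj
    nlinarith
  have hB0 : 0 ≤ B := (abs_nonneg _).trans (hB 0 (by omega) 0 (by simp))
  have habel := abs_sum_sin_mul_le t (fun j => g 0 ((j + 1 : ℕ) * e)) m (B := B) (V := B * e)
    (fun j hj => hB 0 (by omega) _ (hmem j hj)) hB0 (by positivity) (by
      intro j hj
      refine (h.abs_sub_le (hB 1 le_rfl) (hmem j (by omega)) (hmem (j + 1) hj)).trans ?_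
      rw [← sub_mul]
      push_cast
      rw [show ((j : ℝ) + 1 + 1 - (j + 1)) * e = e by ring, abs_of_pos he0])
  have hsin := sin_half_freq_ge k
  rw [← ht] at hsin
  have hk0 : (0 : ℝ) < (k : ℕ) + 1 := by positivity
  have hsum : ∑ j : Fin m, (e * sineVec m k j) * g 0 (((j : ℕ) + 1 : ℕ) * e) =
      √2 * e * ∑ j ∈ Finset.range m, Real.sin ((j + 1) * t) * g 0 ((j + 1 : ℕ) * e) := by
    rw [Finset.mul_sum, Finset.sum_range]
    refine Finset.sum_congr rfl fun j _ => ?_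
    rw [sineVec]; ring
  rw [hsum]
  set S := ∑ j ∈ Finset.range m, Real.sin ((j + 1) * t) * g 0 ((j + 1 : ℕ) * e)
  have hsin' : ((k : ℕ) + 1 : ℝ) * e ≤ Real.sin (t / 2) := by
    refine le_trans (le_of_eq ?_) hsin
    rw [he, add_comm (1 : ℝ), mul_one_div]
  have h1 : 2 * (((k : ℕ) + 1 : ℝ) * e) * |S| ≤ 3 * B := by
    rw [abs_mul, abs_mul, abs_two, abs_of_nonneg (le_trans (by positivity) hsin')] at habel
    have : m * (B * e) ≤ B := by nlinarith
    nlinarith [mul_le_mul_of_nonneg_right hsin' (abs_nonneg S)]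
  rw [abs_mul, abs_mul, abs_of_pos he0, abs_of_nonneg (Real.sqrt_nonneg _), div_mul_eq_mul_div,
    le_div_iff₀ hk0]
  calc √2 * e * |S| * ((k : ℕ) + 1 : ℝ) = √2 * (e * |S| * ((k : ℕ) + 1 : ℝ)) := by ring
    _ ≤ 3 / 2 * (e * |S| * ((k : ℕ) + 1 : ℝ)) :=
        mul_le_mul_of_nonneg_right sqrt_two_le
          (mul_nonneg (mul_nonneg he0.le (abs_nonneg S)) hk0.le)
    _ ≤ 3 * B := by linarith

/-- The sine vector is an eigenvector of the second difference with eigenvalue `-4 sin²(t/2)`. As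
`g` vanishes at both ends, the discrete Green identity has no boundary terms and moves the second
difference onto `g`, which gains two powers of the wave number. Summation by parts against the
second difference gains the third one. -/
theorem abs_sineVec_sum_le_of_vanish {m : ℕ} (k : Fin m) {g : ℕ → ℝ → ℝ} {B : ℝ}
    (h : IsDerivChain 0 1 3 g) (hB : ∀ i ≤ 3, ∀ x ∈ Icc (0 : ℝ) 1, |g i x| ≤ B)
    (h0 : g 0 0 = 0) (h1 : g 0 1 = 0) :
    |∑ j : Fin m, (1 / (1 + m : ℝ) * sineVec m k j) * g 0 (((j : ℕ) + 1 : ℕ) * (1 / (1 + m : ℝ)))|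
      ≤ 3 / ((k : ℕ) + 1 : ℝ) ^ 3 * B := by
  set t := Real.pi * ((k : ℕ) + 1 : ℝ) / (m + 1) with ht
  set e : ℝ := 1 / (1 + m) with he
  have he0 : 0 < e := by positivity
  have hem' : (m + 1) * e = 1 := by rw [he]; field_simp; ring
  have hem : m * e ≤ 1 := by linarith
  have hmem : ∀ j : ℕ, j ≤ m + 1 → (j : ℝ) * e ∈ Icc (0 : ℝ) 1 := by
    intro j hj
    refine ⟨by positivity, ?_⟩
    have : (j : ℝ) ≤ m + 1 := by exact_mod_cast hj
    nlinarith
  have hB0 : 0 ≤ B := (abs_nonneg _).trans (hB 0 (by omega) 0 (by simp))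
  set G : ℕ → ℝ := fun j => g 0 ((j + 2 : ℕ) * e) - 2 * g 0 ((j + 1 : ℕ) * e) + g 0 ((j : ℕ) * e)
    with hG
  have hstep : ∀ j : ℕ, ((j + 1 : ℕ) : ℝ) * e = (j : ℝ) * e + e := by intro j; push_cast; ring
  have hstep' : ∀ j : ℕ, ((j : ℕ) : ℝ) * e = ((j + 1 : ℕ) : ℝ) * e - e := by
    intro j; push_cast; ring
  have habel := abs_sum_sin_mul_le t G m (B := 2 * B * e ^ 2) (V := 12 * B * e ^ 3)
    (by
      intro j hj
      have := (h.mono (by omega : 2 ≤ 3)).second_difference_le (hB 2 (by omega)) he0.le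
        (hmem (j + 1) (by omega)) (by rw [← hstep]; exact hmem (j + 2) (by omega))
        (by rw [← hstep']; exact hmem j (by omega))
      rw [← hstep (j + 1), ← hstep' j] at this
      exact this) (by positivity) (by positivity) (by
      intro j hj
      have := h.third_difference_le (hB 3 le_rfl) he0.le
        (hmem (j + 1) (by omega)) (by rw [← hstep]; exact hmem (j + 2) (by omega))
        (by rw [← hstep']; exact hmem j (by omega))
        (by rw [← hstep, ← hstep]; exact hmem (j + 3) (by omega))
      rw [← hstep (j + 1), ← hstep (j + 2), ← hstep' j] at this
      exact this)
  have hsin := sin_half_freq_ge k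
  rw [← ht] at hsin
  have hk0 : (0 : ℝ) < (k : ℕ) + 1 := by positivity
  have hsum : ∑ j : Fin m, (e * sineVec m k j) * g 0 (((j : ℕ) + 1 : ℕ) * e) =
      √2 * e * ∑ j ∈ Finset.range m, Real.sin ((j + 1 : ℕ) * t) * g 0 ((j + 1 : ℕ) * e) := by
    rw [Finset.mul_sum, Finset.sum_range]
    refine Finset.sum_congr rfl fun j _ => ?_
    rw [sineVec]; push_cast; ring
  rw [hsum]
  set S := ∑ j ∈ Finset.range m, Real.sin ((j + 1 : ℕ) * t) * g 0 ((j + 1 : ℕ) * e) with hS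
  have hgreen := sum_mul_second_difference (fun j => Real.sin (j * t)) (fun j => g 0 (j * e)) m
  have hsinm : Real.sin ((m + 1 : ℕ) * t) = 0 := by
    rw [ht]
    have : ((m + 1 : ℕ) : ℝ) * (Real.pi * ((k : ℕ) + 1 : ℝ) / (m + 1)) =
        ((k : ℕ) + 1 : ℕ) * Real.pi := by push_cast; field_simp
    rw [this, Real.sin_nat_mul_pi]
  have hgm : g 0 ((m + 1 : ℕ) * e) = 0 := by
    rw [show ((m + 1 : ℕ) : ℝ) * e = 1 by push_cast; exact hem', h1]
  simp only [hsinm, hgm, Nat.cast_zero, zero_mul, Real.sin_zero, h0, mul_zero, sub_zero,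
    sin_second_difference, Finset.sum_sub_distrib] at hgreen
  have hGS : ∑ j ∈ Finset.range m, Real.sin ((j + 1) * t) * G j =
      -(4 * Real.sin (t / 2) ^ 2) * S := by
    rw [hS, Finset.mul_sum]
    rw [sub_eq_zero] at hgreen
    refine Eq.trans ?_ (hgreen.trans ?_)
    · refine Finset.sum_congr rfl fun j _ => ?_
      simp only [hG]; push_cast; ring
    · refine Finset.sum_congr rfl fun j _ => ?_
      ring
  rw [hGS] at habel
  have hsin' : ((k : ℕ) + 1 : ℝ) * e ≤ Real.sin (t / 2) := by
    refine le_trans (le_of_eq ?_) hsin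
    rw [he, add_comm (1 : ℝ), mul_one_div]
  have h2 : 8 * (((k : ℕ) + 1 : ℝ) * e) ^ 3 * |S| ≤ 16 * B * e ^ 2 := by
    have h3 : 2 * Real.sin (t / 2) * (-(4 * Real.sin (t / 2) ^ 2) * S) =
      -(8 * Real.sin (t / 2) ^ 3 * S) := by ring
    rw [h3, abs_neg, abs_mul, abs_of_nonneg (by
      have := le_trans (by positivity) hsin'
      positivity)] at habel
    have h4 : m * (12 * B * e ^ 3) ≤ 12 * B * e ^ 2 := by
      have : 0 ≤ 12 * B * e ^ 2 := by positivity
      nlinarith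
    have h5 := mul_le_mul_of_nonneg_right (pow_le_pow_left₀ (by positivity) hsin' 3) (abs_nonneg S)
    nlinarith
  rw [abs_mul, abs_mul, abs_of_pos he0, abs_of_nonneg (Real.sqrt_nonneg _), div_mul_eq_mul_div,
    le_div_iff₀ (by positivity)]
  have h3 : e * |S| * ((k : ℕ) + 1 : ℝ) ^ 3 ≤ 2 * B := by
    have he2 : 0 < 8 * e ^ 2 := by positivity
    refine le_of_mul_le_mul_left (le_trans (le_of_eq ?_) (h2.trans (le_of_eq ?_))) he2 <;> ring
  calc √2 * e * |S| * ((k : ℕ) + 1 : ℝ) ^ 3 = √2 * (e * |S| * ((k : ℕ) + 1 : ℝ) ^ 3) := by ring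
    _ ≤ 3 / 2 * (e * |S| * ((k : ℕ) + 1 : ℝ) ^ 3) :=
        mul_le_mul_of_nonneg_right sqrt_two_le
          (mul_nonneg (mul_nonneg he0.le (abs_nonneg S)) (pow_nonneg hk0.le 3))
    _ ≤ 3 * B := by linarith

/-- A Dirichlet kernel. The first hypothesis says that `q` is an integer, and then the sum depends
only on the parity of `q`. -/
theorem sum_cos_arith {m : ℕ} {q : ℝ} (hq : Real.sin (q * Real.pi) = 0)
    (hs : Real.sin (Real.pi * q / (m + 1) / 2) ≠ 0) :
    ∑ j ∈ Finset.range m, Real.cos ((j + 1) * (Real.pi * q / (m + 1))) =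
      -(Real.cos (q * Real.pi) + 1) / 2 := by
  set x := Real.pi * q / (m + 1) with hx
  have key : ∀ r : ℕ, 2 * Real.sin (x / 2) * ∑ j ∈ Finset.range r, Real.cos ((j + 1) * x) =
      Real.sin ((r + 1 / 2) * x) - Real.sin (x / 2) := by
    intro r
    induction r with
    | zero => simp; ring_nf
    | succ r ih =>
      rw [Finset.sum_range_succ, mul_add, ih]
      have : Real.sin (((r + 1 : ℕ) + 1 / 2 : ℝ) * x) - Real.sin ((r + 1 / 2) * x) =
          2 * Real.sin (x / 2) * Real.cos ((r + 1) * x) := by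
        rw [Real.sin_sub_sin]
        push_cast
        rw [show ((r + 1 + 1 / 2 : ℝ) * x - (r + 1 / 2) * x) / 2 = x / 2 by ring,
          show ((r + 1 + 1 / 2 : ℝ) * x + (r + 1 / 2) * x) / 2 = (r + 1) * x by ring]
      linarith
  have h1 := key m
  have h2 : ((m : ℝ) + 1 / 2) * x = q * Real.pi - x / 2 := by
    rw [hx]; field_simp; ring
  rw [h2, Real.sin_sub, hq, zero_mul, zero_sub] at h1
  have h3 : 2 * Real.sin (x / 2) * (∑ j ∈ Finset.range m, Real.cos ((j + 1) * x)
      - -(Real.cos (q * Real.pi) + 1) / 2) = 0 := by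
    rw [mul_sub, h1]; ring
  rcases mul_eq_zero.1 h3 with h | h
  · exact absurd h (mul_ne_zero two_ne_zero hs)
  · linarith

theorem sin_half_arith_ne_zero {m : ℕ} {q : ℝ} (h0 : 0 < q) (h1 : q < 2 * (m + 1)) :
    Real.sin (Real.pi * q / (m + 1) / 2) ≠ 0 := by
  apply ne_of_gt
  apply Real.sin_pos_of_pos_of_lt_pi (by positivity)
  rw [div_div, div_lt_iff₀ (by positivity)]
  nlinarith [Real.pi_pos]

theorem sineVec_comm {m : ℕ} (k j : Fin m) : sineVec m k j = sineVec m j k := by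
  rw [sineVec, sineVec]
  congr 2
  ring

/-- The product formula gives cosine sums with frequencies `k - l` and `k + l + 2`. These have equal
parity, so the sums cancel off the diagonal; on the diagonal they are `m` and `-1`. -/
theorem sum_sineVec_mul_self {m : ℕ} (k l : Fin m) :
    ∑ j, sineVec m k j * sineVec m l j = if k = l then (m + 1 : ℝ) else 0 := by
  have hprod : ∀ k l : Fin m, ∑ j, sineVec m k j * sineVec m l j =
      ∑ j ∈ Finset.range m, Real.cos ((j + 1) * (Real.pi * ((k : ℕ) - (l : ℕ) : ℝ) / (m + 1)))
      - ∑ j ∈ Finset.range m,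
        Real.cos ((j + 1) * (Real.pi * ((k : ℕ) + (l : ℕ) + 2 : ℝ) / (m + 1))) := by
    intro k l
    rw [Finset.sum_range, Finset.sum_range, ← Finset.sum_sub_distrib]
    refine Finset.sum_congr rfl fun j _ => ?_
    rw [sineVec, sineVec, Real.cos_sub_cos]
    have h1 : ((((j : ℕ) : ℝ) + 1) * (Real.pi * ((k : ℕ) - (l : ℕ) : ℝ) / (m + 1))
        + (((j : ℕ) : ℝ) + 1) * (Real.pi * ((k : ℕ) + (l : ℕ) + 2 : ℝ) / (m + 1))) / 2 =
        (((j : ℕ) : ℝ) + 1) * (Real.pi * ((k : ℕ) + 1) / (m + 1)) := by ring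
    have h2 : ((((j : ℕ) : ℝ) + 1) * (Real.pi * ((k : ℕ) - (l : ℕ) : ℝ) / (m + 1))
        - (((j : ℕ) : ℝ) + 1) * (Real.pi * ((k : ℕ) + (l : ℕ) + 2 : ℝ) / (m + 1))) / 2 =
        -((((j : ℕ) : ℝ) + 1) * (Real.pi * ((l : ℕ) + 1) / (m + 1))) := by ring
    rw [h1, h2, Real.sin_neg]
    have h3 : √2 * √2 = (2 : ℝ) := Real.mul_self_sqrt (by norm_num)
    linear_combination (Real.sin ((((j : ℕ) : ℝ) + 1) * (Real.pi * ((k : ℕ) + 1) / (m + 1)))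
      * Real.sin ((((j : ℕ) : ℝ) + 1) * (Real.pi * ((l : ℕ) + 1) / (m + 1)))) * h3
  have hplus : ∀ k l : Fin m, ∑ j ∈ Finset.range m,
      Real.cos ((j + 1) * (Real.pi * ((k : ℕ) + (l : ℕ) + 2 : ℝ) / (m + 1))) =
      -(Real.cos (((k : ℕ) + (l : ℕ) + 2 : ℝ) * Real.pi) + 1) / 2 := by
    intro k l
    refine sum_cos_arith ?_ (sin_half_arith_ne_zero (by positivity) ?_)
    · have := Real.sin_nat_mul_pi ((k : ℕ) + l + 2)
      push_cast at this; exact this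
    · have h1 : ((k : ℕ) : ℝ) < m := by exact_mod_cast k.2
      have h2 : ((l : ℕ) : ℝ) < m := by exact_mod_cast l.2
      linarith
  have hlt : ∀ k l : Fin m, l < k → ∑ j, sineVec m k j * sineVec m l j = 0 := by
    intro k l hlk
    have hlk' : ((l : ℕ) : ℝ) < (k : ℕ) := by exact_mod_cast hlk
    have hkm : ((k : ℕ) : ℝ) < m := by exact_mod_cast k.2
    have hl0 : (0 : ℝ) ≤ (l : ℕ) := by positivity
    rw [hprod, hplus, sum_cos_arith (q := ((k : ℕ) - (l : ℕ) : ℝ)) ?_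
      (sin_half_arith_ne_zero (by linarith) (by linarith))]
    · have : Real.cos (((k : ℕ) + (l : ℕ) + 2 : ℝ) * Real.pi) =
          Real.cos (((k : ℕ) - (l : ℕ) : ℝ) * Real.pi) := by
        have := Real.cos_add_nat_mul_two_pi (((k : ℕ) - (l : ℕ) : ℝ) * Real.pi) ((l : ℕ) + 1)
        rw [← this]
        congr 1
        push_cast; ring
      rw [this]; ring
    · have := Real.sin_int_mul_pi ((k : ℤ) - (l : ℤ))
      push_cast at this; exact this
  rcases lt_trichotomy k l with h | h | h
  · rw [if_neg h.ne, ← hlt l k h]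
    exact Finset.sum_congr rfl fun j _ => mul_comm _ _
  · subst h
    rw [if_pos rfl, hprod, hplus]
    have : Real.cos (((k : ℕ) + (k : ℕ) + 2 : ℝ) * Real.pi) = 1 := by
      have := Real.cos_nat_mul_two_pi ((k : ℕ) + 1)
      rw [← this]
      congr 1
      push_cast; ring
    rw [this]
    simp
  · rw [if_neg h.ne', hlt k l h]

/-! ### The discrete sine transform on the grid -/

section Transform

variable {d : ℕ} (n : Fin d → ℕ)

theorem meshWidth_pos (l : Fin d) : 0 < meshWidth n l := by
  unfold meshWidth; positivity

theorem meshWidth_mul (l : Fin d) : meshWidth n l * (n l + 1) = 1 := by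
  unfold meshWidth; field_simp; ring

/-- The tensor product sine modes. -/
def sineMode (k : (l : Fin d) → Fin (n l)) : GridFun n :=
  fun i => ∏ l, sineVec (n l) (k l) (i l)

/-- The coefficients with respect to the sine modes. -/
def sineCoeff : GridFun n →ₗ[ℝ] GridFun n where
  toFun V k := ∑ i, (∏ l, meshWidth n l * sineVec (n l) (k l) (i l)) * V i
  map_add' V W := by
    funext k; simp [mul_add, Finset.sum_add_distrib]
  map_smul' r V := by
    funext k
    simp only [Pi.smul_apply, smul_eq_mul, RingHom.id_apply, Finset.mul_sum]
    exact Finset.sum_congr rfl fun i _ => by ring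

theorem sineCoeff_apply (V : GridFun n) (k : (l : Fin d) → Fin (n l)) :
    sineCoeff n V k = ∑ i, (∏ l, meshWidth n l * sineVec (n l) (k l) (i l)) * V i := rfl

theorem sineMode_orthogonal (k k' : (l : Fin d) → Fin (n l)) :
    ∑ i, (∏ l, meshWidth n l * sineVec (n l) (k l) (i l)) * sineMode n k' i =
      if k = k' then 1 else 0 := by
  simp only [sineMode, ← Finset.prod_mul_distrib]
  have h := Finset.prod_univ_sum (fun l : Fin d => (Finset.univ : Finset (Fin (n l))))
    (fun l j => meshWidth n l * sineVec (n l) (k l) j * sineVec (n l) (k' l) j)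
  rw [Fintype.piFinset_univ] at h
  rw [← h]
  have h1 : ∀ l, ∑ j, meshWidth n l * sineVec (n l) (k l) j * sineVec (n l) (k' l) j =
      if k l = k' l then 1 else 0 := by
    intro l
    simp only [mul_assoc]
    rw [← Finset.mul_sum, sum_sineVec_mul_self, mul_ite, mul_zero, meshWidth_mul]
  simp only [h1]
  split_ifs with hk
  · subst hk; simp
  · obtain ⟨l, hl⟩ := Function.ne_iff.1 hk
    exact Finset.prod_eq_zero (Finset.mem_univ l) (if_neg hl)

theorem sineMode_comm (k i : (l : Fin d) → Fin (n l)) : sineMode n k i = sineMode n i k :=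
  Finset.prod_congr rfl fun _ _ => sineVec_comm _ _

/-- The matrix of the sine modes is symmetric, so its row orthogonality is also column
orthogonality, which is completeness. -/
theorem sum_sineCoeff_smul (V : GridFun n) : ∑ k, sineCoeff n V k • sineMode n k = V := by
  funext i
  simp only [Finset.sum_apply, Pi.smul_apply, smul_eq_mul, sineCoeff_apply, Finset.sum_mul]
  rw [Finset.sum_comm]
  have h : ∀ i', ∑ k, (∏ l, meshWidth n l * sineVec (n l) (k l) (i' l)) * V i' * sineMode n k i =
      V i' * if i' = i then 1 else 0 := by
    intro i'
    rw [← sineMode_orthogonal n i' i, Finset.mul_sum]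
    refine Finset.sum_congr rfl fun k _ => ?_
    rw [sineMode_comm n k i]
    simp only [fun l => sineVec_comm (k l) (i' l)]
    ring
  simp [h]

theorem sineCoeff_sineMode (k k' : (l : Fin d) → Fin (n l)) :
    sineCoeff n (sineMode n k') k = if k = k' then 1 else 0 := sineMode_orthogonal n k k'

/-- Parseval: one of the two coefficients is written out as a sum over the grid, and the inversion
formula evaluates the sum over the modes. -/
theorem sum_sineCoeff_sq (V : GridFun n) : ∑ k, sineCoeff n V k ^ 2 = weightedNorm V ^ 2 := by
  rw [weightedNorm, Real.sq_sqrt (mul_nonneg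
    (Finset.prod_nonneg fun l _ => (meshWidth_pos n l).le)
    (Finset.sum_nonneg fun i _ => by positivity))]
  have h : ∀ k, sineCoeff n V k ^ 2 = ∑ i, (∏ l, meshWidth n l) *
      (V i * (sineCoeff n V k * sineMode n k i)) := by
    intro k
    rw [sq]
    nth_rewrite 2 [sineCoeff_apply]
    rw [Finset.mul_sum]
    refine Finset.sum_congr rfl fun i _ => ?_
    rw [Finset.prod_mul_distrib, sineMode]
    ring
  simp only [h]
  rw [Finset.sum_comm, Finset.mul_sum]
  refine Finset.sum_congr rfl fun i _ => ?_
  rw [← Finset.mul_sum, ← Finset.mul_sum, sq_abs, sq]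
  congr 2
  have := congrFun (sum_sineCoeff_smul n V) i
  simpa only [Finset.sum_apply, Pi.smul_apply, smul_eq_mul] using this

end Transform

/-- Tensor products of one-dimensional functionals of smooth functions: the bounds of the factors
multiply. The flag `Z` records that the functions vanish at the end-points. -/
theorem abs_tensor_sum_le (Z : Prop) (r : ℕ) {d : ℕ} {ι : Fin d → Type} [∀ l, Fintype (ι l)]
    (w p : ∀ l, ι l → ℝ) (κ : Fin d → ℝ) (hp : ∀ l j, p l j ∈ Icc (0 : ℝ) 1)
    (hκ : ∀ l, 0 ≤ κ l)
    (h1 : ∀ l (g : ℕ → ℝ → ℝ) (B : ℝ), IsDerivChain 0 1 r g →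
      (∀ i ≤ r, ∀ x ∈ Icc (0 : ℝ) 1, |g i x| ≤ B) → (Z → g 0 0 = 0 ∧ g 0 1 = 0) →
      |∑ j, w l j * g 0 (p l j)| ≤ κ l * B)
    (D : (Fin d → ℕ) → (Fin d → ℝ) → ℝ) (B : ℝ)
    (hder : ∀ α : Fin d → ℕ, (∀ j, α j ≤ r) → ∀ j, α j < r → ∀ x ∈ Icc (0 : Fin d → ℝ) 1,
      HasDerivWithinAt (fun ξ => D α (Function.update x j ξ)) (D (α + Pi.single j 1) x)
        (Icc 0 1) (x j))
    (hbd : ∀ α : Fin d → ℕ, (∀ j, α j ≤ r) → ∀ x ∈ Icc (0 : Fin d → ℝ) 1, |D α x| ≤ B)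
    (hvan : Z → ∀ α : Fin d → ℕ, (∀ j, α j ≤ r) → ∀ j, α j = 0 → ∀ x ∈ Icc (0 : Fin d → ℝ) 1,
      (x j = 0 ∨ x j = 1) → D α x = 0) :
    |∑ i : (∀ l, ι l), (∏ l, w l (i l)) * D 0 (fun l => p l (i l))| ≤ (∏ l, κ l) * B := by
  induction d generalizing B with
  | zero =>
    simp only [Finset.univ_unique, Finset.univ_eq_empty, Finset.prod_empty, one_mul,
      Finset.sum_singleton]
    exact hbd 0 (fun j => j.elim0) _ ⟨fun j => j.elim0, fun j => j.elim0⟩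
  | succ d ih =>
    have hcons : ∀ ξ ∈ Icc (0 : ℝ) 1, ∀ x ∈ Icc (0 : Fin d → ℝ) 1,
        (Fin.cons ξ x : Fin (d + 1) → ℝ) ∈ Icc (0 : Fin (d + 1) → ℝ) 1 := by
      intro ξ hξ x hx
      refine ⟨fun j => ?_, fun j => ?_⟩
      · refine Fin.cases hξ.1 (fun j => ?_) j
        simpa using hx.1 j
      · refine Fin.cases hξ.2 (fun j => ?_) j
        simpa using hx.2 j
    have hcons_le : ∀ i ≤ r, ∀ α : Fin d → ℕ, (∀ j, α j ≤ r) →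
        ∀ j, (Fin.cons i α : Fin (d + 1) → ℕ) j ≤ r := by
      intro i hi α hα j
      refine Fin.cases hi (fun j => ?_) j
      simpa using hα j
    -- Applying the functional in coordinate 0 leaves a family of the same kind in the other
    -- coordinates. Its bound `κ 0 * B` follows from `h1` for the chain of derivatives in coordinate
    -- 0 with the remaining multi-index fixed; this is why mixed derivatives are needed.
    set D' : (Fin d → ℕ) → (Fin d → ℝ) → ℝ := fun α x =>
      ∑ j, w 0 j * D (Fin.cons 0 α) (Fin.cons (p 0 j) x) with hD'
    have hsum : ∑ i : (∀ l, ι l), (∏ l, w l (i l)) * D 0 (fun l => p l (i l)) =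
        ∑ i : (∀ l : Fin d, ι l.succ), (∏ l, w l.succ (i l)) *
          D' 0 (fun l => p l.succ (i l)) := by
      rw [← (Fin.consEquiv ι).sum_comp, Fintype.sum_prod_type, Finset.sum_comm]
      refine Finset.sum_congr rfl fun i _ => ?_
      simp only [hD', Finset.mul_sum]
      refine Finset.sum_congr rfl fun j _ => ?_
      rw [Fin.prod_univ_succ]
      have h2 : (Fin.cons 0 0 : Fin (d + 1) → ℕ) = 0 := by
        funext l; refine Fin.cases rfl (fun l => ?_) l; simp
      have h3 : (Fin.cons (p 0 j) (fun l => p l.succ (i l)) : Fin (d + 1) → ℝ) =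
          fun l => p l ((Fin.consEquiv ι) (j, i) l) := by
        funext l; refine Fin.cases ?_ (fun l => ?_) l <;> simp [Fin.consEquiv]
      rw [h2, h3]
      simp only [Fin.consEquiv, Equiv.coe_fn_mk, Fin.cons_zero, Fin.cons_succ]
      ring
    rw [hsum, Fin.prod_univ_succ]
    have := ih (fun l => w l.succ) (fun l => p l.succ) (fun l => κ l.succ) (fun l => hp l.succ)
      (fun l => hκ l.succ) (fun l => h1 l.succ) D' (κ 0 * B) ?_ ?_ ?_
    · refine this.trans (le_of_eq ?_)
      ring
    · intro α hα j hj x hx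
      have h2 : ∀ e : ι 0, HasDerivWithinAt
          (fun ξ => w 0 e * D (Fin.cons 0 α) (Fin.cons (p 0 e) (Function.update x j ξ)))
          (w 0 e * D (Fin.cons 0 (α + Pi.single j 1)) (Fin.cons (p 0 e) x)) (Icc 0 1) (x j) := by
        intro e
        have h3 := hder (Fin.cons 0 α) (hcons_le 0 (by omega) α hα) j.succ (by simpa using hj)
          (Fin.cons (p 0 e) x) (hcons _ (hp 0 e) x hx)
        have h4 : (Fin.cons 0 α : Fin (d + 1) → ℕ) + Pi.single j.succ 1 =
            Fin.cons 0 (α + Pi.single j 1) := by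
          funext l
          refine Fin.cases ?_ (fun l => ?_) l
          · simp
          · by_cases hl : l = j
            · subst hl; simp
            · simp [Pi.single_eq_of_ne hl, Pi.single_eq_of_ne (fun h => hl (Fin.succ_injective _ h) : l.succ ≠ j.succ)]
        rw [h4] at h3
        simp only [← Fin.cons_update] at h3
        simp only [Fin.cons_succ] at h3
        exact h3.const_mul _
      exact HasDerivWithinAt.fun_sum fun e _ => h2 e
    · intro α hα x hx
      refine h1 0 (fun i ξ => D (Fin.cons i α) (Fin.cons ξ x)) B ?_ ?_ ?_
      · intro i hi ξ hξ
        have h3 := hder (Fin.cons i α) (hcons_le i hi.le α hα) 0 (by simpa using hi)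
          (Fin.cons ξ x) (hcons ξ hξ x hx)
        have h4 : (Fin.cons i α : Fin (d + 1) → ℕ) + Pi.single 0 1 = Fin.cons (i + 1) α := by
          funext l
          refine Fin.cases ?_ (fun l => ?_) l
          · simp
          · simp
        rw [h4] at h3
        simpa only [Fin.update_cons_zero, Fin.cons_zero] using h3
      · intro i hi ξ hξ
        exact hbd _ (hcons_le i hi α hα) _ (hcons ξ hξ x hx)
      · intro hZ
        exact ⟨hvan hZ _ (hcons_le 0 (by omega) α hα) 0 rfl _ (hcons 0 (by simp) x hx) (Or.inl rfl),
          hvan hZ _ (hcons_le 0 (by omega) α hα) 0 rfl _ (hcons 1 (by simp) x hx) (Or.inr rfl)⟩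
    · intro hZ α hα j hj x hx hxj
      refine Finset.sum_eq_zero fun e _ => ?_
      rw [hvan hZ _ (hcons_le 0 (by omega) α hα) j.succ (by simpa using hj) _
        (hcons _ (hp 0 e) x hx) (by simpa using hxj), mul_zero]

/-! ### Sine coefficients of smooth functions and diagonalization of the difference operators. -/

section GridOperators

variable {d : ℕ} (n : Fin d → ℕ)

theorem gridNode_mem {k : Fin d → ℕ} (hk : ∀ l, k l ≤ n l + 1) :
    gridNode n k ∈ Icc (0 : Fin d → ℝ) 1 := by
  refine ⟨fun l => mul_nonneg (Nat.cast_nonneg _) (meshWidth_pos n l).le, fun l => ?_⟩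
  have h := meshWidth_mul n l
  have h1 : (k l : ℝ) ≤ n l + 1 := by exact_mod_cast hk l
  have := meshWidth_pos n l
  show (k l : ℝ) * meshWidth n l ≤ 1
  nlinarith

theorem gridNode_gridIndex_mem (i : (l : Fin d) → Fin (n l)) :
    gridNode n (gridIndex i) ∈ Icc (0 : Fin d → ℝ) 1 :=
  gridNode_mem n fun l => by have := (i l).2; simp only [gridIndex]; omega

theorem abs_sineCoeff_gridRestrict_le {D : (Fin d → ℕ) → (Fin d → ℝ) → ℝ} {B : ℝ}
    (hder : ∀ α : Fin d → ℕ, (∀ j, α j ≤ 1) → ∀ j, α j < 1 → ∀ x ∈ Icc (0 : Fin d → ℝ) 1,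
      HasDerivWithinAt (fun ξ => D α (Function.update x j ξ)) (D (α + Pi.single j 1) x)
        (Icc 0 1) (x j))
    (hbd : ∀ α : Fin d → ℕ, (∀ j, α j ≤ 1) → ∀ x ∈ Icc (0 : Fin d → ℝ) 1, |D α x| ≤ B)
    (k : (l : Fin d) → Fin (n l)) :
    |sineCoeff n (gridRestrict n (D 0)) k| ≤ (∏ l, 3 / ((k l : ℕ) + 1 : ℝ)) * B := by
  refine abs_tensor_sum_le False 1 (ι := fun l => Fin (n l))
    (fun l j => meshWidth n l * sineVec (n l) (k l) j)
    (fun l j => ((j : ℕ) + 1 : ℕ) * meshWidth n l) (fun l => 3 / ((k l : ℕ) + 1 : ℝ)) ?_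
    (fun l => by positivity) ?_ D B hder hbd (fun h => h.elim)
  · intro l j
    have h := meshWidth_mul n l
    have h1 : (((j : ℕ) + 1 : ℕ) : ℝ) ≤ n l + 1 := by exact_mod_cast (by omega)
    have := meshWidth_pos n l
    exact ⟨by positivity, by nlinarith⟩
  · intro l g B hg hB _
    exact abs_sineVec_sum_le (k l) hg hB

theorem abs_sineCoeff_gridRestrict_le_of_vanish {D : (Fin d → ℕ) → (Fin d → ℝ) → ℝ} {B : ℝ}
    (hder : ∀ α : Fin d → ℕ, (∀ j, α j ≤ 3) → ∀ j, α j < 3 → ∀ x ∈ Icc (0 : Fin d → ℝ) 1,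
      HasDerivWithinAt (fun ξ => D α (Function.update x j ξ)) (D (α + Pi.single j 1) x)
        (Icc 0 1) (x j))
    (hbd : ∀ α : Fin d → ℕ, (∀ j, α j ≤ 3) → ∀ x ∈ Icc (0 : Fin d → ℝ) 1, |D α x| ≤ B)
    (hvan : ∀ α : Fin d → ℕ, (∀ j, α j ≤ 3) → ∀ j, α j = 0 → ∀ x ∈ Icc (0 : Fin d → ℝ) 1,
      (x j = 0 ∨ x j = 1) → D α x = 0)
    (k : (l : Fin d) → Fin (n l)) :
    |sineCoeff n (gridRestrict n (D 0)) k| ≤ (∏ l, 3 / ((k l : ℕ) + 1 : ℝ) ^ 3) * B := by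
  refine abs_tensor_sum_le True 3 (ι := fun l => Fin (n l))
    (fun l j => meshWidth n l * sineVec (n l) (k l) j)
    (fun l j => ((j : ℕ) + 1 : ℕ) * meshWidth n l) (fun l => 3 / ((k l : ℕ) + 1 : ℝ) ^ 3) ?_
    (fun l => by positivity) ?_ D B hder hbd (fun _ => hvan)
  · intro l j
    have h := meshWidth_mul n l
    have h1 : (((j : ℕ) + 1 : ℕ) : ℝ) ≤ n l + 1 := by exact_mod_cast (by omega)
    have := meshWidth_pos n l
    exact ⟨by positivity, by nlinarith⟩
  · intro l g B hg hB h0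
    exact abs_sineVec_sum_le_of_vanish (k l) hg hB (h0 trivial).1 (h0 trivial).2

/-- The number of interior points times the volume of a cell is at most 1. -/
theorem weightedNorm_le {V : GridFun n} {B : ℝ} (hB : 0 ≤ B) (hV : ∀ i, |V i| ≤ B) :
    weightedNorm V ≤ B := by
  have hH : 0 ≤ ∏ l, meshWidth n l := Finset.prod_nonneg fun l _ => (meshWidth_pos n l).le
  rw [weightedNorm, Real.sqrt_le_left hB]
  have h1 : ∑ i, |V i| ^ 2 ≤ ∑ _i : ((l : Fin d) → Fin (n l)), B ^ 2 :=
    Finset.sum_le_sum fun i _ => pow_le_pow_left₀ (abs_nonneg _) (hV i) 2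
  have h2 : (∏ l, meshWidth n l) * ∏ l, (n l : ℝ) ≤ 1 := by
    rw [← Finset.prod_mul_distrib]
    refine Finset.prod_le_one (fun l _ => mul_nonneg (meshWidth_pos n l).le (Nat.cast_nonneg _))
      fun l _ => ?_
    have := meshWidth_mul n l
    have := meshWidth_pos n l
    nlinarith
  rw [Finset.sum_const, Finset.card_univ, Fintype.card_pi] at h1
  simp only [Fintype.card_fin, nsmul_eq_mul, Nat.cast_prod] at h1
  calc _ ≤ (∏ l, meshWidth n l) * ((∏ l, (n l : ℝ)) * B ^ 2) := mul_le_mul_of_nonneg_left h1 hH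
    _ = ((∏ l, meshWidth n l) * ∏ l, (n l : ℝ)) * B ^ 2 := by ring
    _ ≤ 1 * B ^ 2 := mul_le_mul_of_nonneg_right h2 (by positivity)
    _ = B ^ 2 := one_mul _

theorem gridExtend_add {n : Fin d → ℕ} (g g' : (Fin d → ℝ) → ℝ) (V W : GridFun n)
    (k : Fin d → ℕ) :
    gridExtend (fun x => g x + g' x) (V + W) k = gridExtend g V k + gridExtend g' W k := by
  simp only [gridExtend]
  split_ifs <;> rfl

theorem gridExtend_smul {n : Fin d → ℕ} (r : ℝ) (V : GridFun n) (k : Fin d → ℕ) :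
    gridExtend (fun _ => 0) (r • V) k = r * gridExtend (fun _ => 0) V k := by
  simp only [gridExtend]
  split_ifs <;> simp

/-- The central difference operator `a D_jj` with homogeneous boundary values. -/
def dirLaplacian (a : ℝ) (j : Fin d) : GridFun n →ₗ[ℝ] GridFun n where
  toFun V i := a * (gridExtend (fun _ => 0) V
          (Function.update (gridIndex i) j (gridIndex i j + 1))
        - 2 * gridExtend (fun _ => 0) V (gridIndex i)
        + gridExtend (fun _ => 0) V
          (Function.update (gridIndex i) j (gridIndex i j - 1)))
      / meshWidth n j ^ 2
  map_add' V W := by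
    funext i
    have h := fun k => gridExtend_add (n := n) (fun _ => 0) (fun _ => 0) V W k
    simp only [add_zero] at h
    simp only [h, Pi.add_apply]
    ring
  map_smul' r V := by
    funext i
    simp only [gridExtend_smul, Pi.smul_apply, smul_eq_mul, RingHom.id_apply]
    ring

/-- The eigenvalues of `dirLaplacian`. -/
def dirEigenvalue (a : ℝ) (j : Fin d) (k : (l : Fin d) → Fin (n l)) : ℝ :=
  -(a * (4 * Real.sin (Real.pi * ((k j : ℕ) + 1) / (n j + 1) / 2) ^ 2) / meshWidth n j ^ 2)

/-- The sine modes as functions of a grid index. -/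
def sineIndex (k : (l : Fin d) → Fin (n l)) (i : Fin d → ℕ) : ℝ :=
  ∏ l, √2 * Real.sin ((i l : ℝ) * (Real.pi * ((k l : ℕ) + 1) / (n l + 1)))

/-- The sines vanish at the indices 0 and `n_l + 1`, so extension by zero agrees with the sine
formula there. Points next to the boundary then need no separate treatment in the eigenvalue
equation. -/
theorem gridExtend_sineMode (k : (l : Fin d) → Fin (n l)) (i : Fin d → ℕ)
    (hi : ∀ l, i l ≤ n l + 1) :
    gridExtend (fun _ => 0) (sineMode n k) i = sineIndex n k i := by
  simp only [gridExtend]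
  split_ifs with h
  · refine Finset.prod_congr rfl fun l _ => ?_
    rw [sineVec]
    have : ((i l - 1 : ℕ) : ℝ) + 1 = i l := by
      have := (h l).1
      rw [Nat.cast_sub this]; simp
    rw [this]
  · push Not at h
    obtain ⟨l, hl⟩ := h
    refine (Finset.prod_eq_zero (Finset.mem_univ l) ?_).symm
    rcases Nat.eq_zero_or_pos (i l) with h0 | h0
    · simp [h0]
    · have h1 : i l = n l + 1 := le_antisymm (hi l) (hl h0)
      have h2 : ((n l + 1 : ℕ) : ℝ) * (Real.pi * ((k l : ℕ) + 1 : ℝ) / (n l + 1)) =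
          ((k l : ℕ) + 1 : ℕ) * Real.pi := by push_cast; field_simp
      rw [h1, h2, Real.sin_nat_mul_pi, mul_zero]

theorem dirLaplacian_sineMode (a : ℝ) (j : Fin d) (k : (l : Fin d) → Fin (n l)) :
    dirLaplacian n a j (sineMode n k) = dirEigenvalue n a j k • sineMode n k := by
  funext i
  have hi : ∀ l, gridIndex i l ≤ n l := fun l => (i l).2
  have hup : ∀ (m : ℕ), m ≤ n j + 1 → ∀ l, Function.update (gridIndex i) j m l ≤ n l + 1 := by
    intro m hm l
    by_cases hl : l = j
    · subst hl; simpa using hm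
    · rw [Function.update_of_ne hl]; exact (hi l).trans (Nat.le_succ _)
  have hsplit : ∀ m : ℕ, sineIndex n k (Function.update (gridIndex i) j m) =
      √2 * Real.sin ((m : ℝ) * (Real.pi * ((k j : ℕ) + 1) / (n j + 1))) *
      ∏ l ∈ Finset.univ.erase j,
        √2 * Real.sin ((gridIndex i l : ℝ) * (Real.pi * ((k l : ℕ) + 1) / (n l + 1))) := by
    intro m
    rw [sineIndex, ← Finset.mul_prod_erase _ _ (Finset.mem_univ j), Function.update_self]
    congr 1
    refine Finset.prod_congr rfl fun l hl => ?_
    rw [Function.update_of_ne (Finset.ne_of_mem_erase hl)]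
  have hself : ∀ m, m = gridIndex i j → Function.update (gridIndex i) j m = gridIndex i := by
    rintro m rfl; exact Function.update_eq_self _ _
  have hmode : sineMode n k i = sineIndex n k (gridIndex i) := by
    refine Finset.prod_congr rfl fun l _ => ?_
    rw [sineVec, gridIndex]; push_cast; rfl
  have hmid : sineIndex n k (gridIndex i) = sineIndex n k (Function.update (gridIndex i) j
      ((i j : ℕ) + 1)) := congrArg _ (hself _ rfl).symm
  have hsin := sin_second_difference (Real.pi * ((k j : ℕ) + 1) / (n j + 1)) (i j)
  show a * (gridExtend (fun _ => 0) (sineMode n k)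
          (Function.update (gridIndex i) j (gridIndex i j + 1))
        - 2 * gridExtend (fun _ => 0) (sineMode n k) (gridIndex i)
        + gridExtend (fun _ => 0) (sineMode n k)
          (Function.update (gridIndex i) j (gridIndex i j - 1)))
      / meshWidth n j ^ 2 = dirEigenvalue n a j k * sineMode n k i
  rw [gridExtend_sineMode n k _ (hup _ (by have := hi j; omega)),
    gridExtend_sineMode n k _ (hup _ (by have := hi j; omega)),
    gridExtend_sineMode n k _ (fun l => (hi l).trans (Nat.le_succ _)), hmode, hmid, hsplit, hsplit,
    hsplit]
  have h1 : gridIndex i j + 1 = (i j : ℕ) + 2 := rfl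
  have h2 : gridIndex i j - 1 = (i j : ℕ) := rfl
  rw [h1, h2, dirEigenvalue]
  set Q := ∏ l ∈ Finset.univ.erase j,
        √2 * Real.sin ((gridIndex i l : ℝ) * (Real.pi * ((k l : ℕ) + 1) / (n l + 1)))
  linear_combination (a * √2 * Q / meshWidth n j ^ 2) * hsin

theorem sineCoeff_dirLaplacian (a : ℝ) (j : Fin d) (V : GridFun n) (k : (l : Fin d) → Fin (n l)) :
    sineCoeff n (dirLaplacian n a j V) k = dirEigenvalue n a j k * sineCoeff n V k := by
  conv_lhs => rw [← sum_sineCoeff_smul n V]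
  simp only [map_sum, map_smul, dirLaplacian_sineMode, Finset.sum_apply, Pi.smul_apply, smul_eq_mul,
    sineCoeff_sineMode]
  simp [mul_comm]

theorem diffusionTerm_eq (P : DiffusionProblem d) (j : Fin d) (t : ℝ) (V : GridFun n) :
    P.diffusionTerm n j t V = dirLaplacian n (P.a j) j V + P.diffusionTerm n j t 0 := by
  funext i
  have h := fun k => gridExtend_add (n := n) (fun _ => 0) (fun x => P.β x t) V 0 k
  simp only [zero_add, add_zero] at h
  simp only [DiffusionProblem.diffusionTerm, h, Pi.add_apply, dirLaplacian, LinearMap.coe_mk,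
    AddHom.coe_mk]
  ring

theorem sin_half_freq_pos {m : ℕ} (k : Fin m) :
    0 < Real.sin (Real.pi * ((k : ℕ) + 1) / (m + 1) / 2) :=
  lt_of_lt_of_le (by positivity) (sin_half_freq_ge k)

theorem dirEigenvalue_neg {a : ℝ} (ha : 0 < a) (j : Fin d) (k : (l : Fin d) → Fin (n l)) :
    dirEigenvalue n a j k < 0 := by
  have h1 := sin_half_freq_pos (k j)
  have h2 := meshWidth_pos n j
  rw [dirEigenvalue, neg_lt_zero]
  positivity

/-- From `sin y ≤ y` and `π² ≤ 10`. The bound does not involve the mesh; it is the source of `-x_j ≤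
c τ k_j²`. -/
theorem neg_dirEigenvalue_le {a : ℝ} (ha : 0 < a) (j : Fin d) (k : (l : Fin d) → Fin (n l)) :
    -dirEigenvalue n a j k ≤ a * 10 * ((k j : ℕ) + 1 : ℝ) ^ 2 := by
  have h1 := sin_half_freq_pos (k j)
  have h2 := meshWidth_pos n j
  have h3 : Real.sin (Real.pi * ((k j : ℕ) + 1) / (n j + 1) / 2) ≤
      Real.pi / 2 * ((k j : ℕ) + 1) * meshWidth n j := by
    refine (Real.sin_le (by positivity)).trans (le_of_eq ?_)
    rw [meshWidth]
    field_simp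
    ring
  have h4 := pow_le_pow_left₀ h1.le h3 2
  have h5 : Real.pi ^ 2 ≤ 10 := by
    nlinarith [Real.pi_lt_d2, Real.pi_pos]
  rw [dirEigenvalue, neg_neg, div_le_iff₀ (by positivity)]
  have h6 : a * (4 * (Real.pi / 2 * ((k j : ℕ) + 1 : ℝ) * meshWidth n j) ^ 2) =
      Real.pi ^ 2 * (a * ((k j : ℕ) + 1 : ℝ) ^ 2 * meshWidth n j ^ 2) := by ring
  have h7 : 0 ≤ a * ((k j : ℕ) + 1 : ℝ) ^ 2 * meshWidth n j ^ 2 := by positivity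
  nlinarith

end GridOperators

/-! ### The exact solution on the grid -/

theorem closure_unitCube (d : ℕ) : closure (unitCube d) = Icc (0 : Fin d → ℝ) 1 := by
  rw [unitCube, closure_pi_set, ← Set.pi_univ_Icc]
  congr 1
  funext i
  exact closure_Ioo (by norm_num)

theorem unitCube_subset (d : ℕ) : unitCube d ⊆ Icc (0 : Fin d → ℝ) 1 := by
  rw [← closure_unitCube]; exact subset_closure

theorem mem_frontier_unitCube {d : ℕ} {x : Fin d → ℝ} (hx : x ∈ Icc (0 : Fin d → ℝ) 1) (j : Fin d)
    (hj : x j = 0 ∨ x j = 1) : x ∈ frontier (unitCube d) := by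
  have ho : IsOpen (unitCube d) := isOpen_set_pi Set.finite_univ fun _ _ => isOpen_Ioo
  rw [frontier, closure_unitCube, ho.interior_eq]
  refine ⟨hx, fun h => ?_⟩
  have := h j (Set.mem_univ j)
  rcases hj with h0 | h0 <;> rw [h0] at this <;> simp at this

theorem frontier_unitCube_subset (d : ℕ) : frontier (unitCube d) ⊆ Icc (0 : Fin d → ℝ) 1 := by
  rw [← closure_unitCube]; exact frontier_subset_closure

/-- `D k α = ∂_t^k ∂_x^α u` is a family of partial derivatives of a classical solution, whose
equations hold up to the initial time. -/
structure SmoothSolution {d : ℕ} (P : DiffusionProblem d) (p : ℕ)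
    (D : ℕ → (Fin d → ℕ) → (Fin d → ℝ) → ℝ → ℝ) : Prop where
  cont : ∀ k ≤ p + 1, ∀ α : Fin d → ℕ, (∀ j, α j ≤ 4) →
    ContinuousOn (Function.uncurry (D k α)) (Icc 0 1 ×ˢ Icc 0 P.T)
  dt : ∀ k < p + 1, ∀ α : Fin d → ℕ, (∀ j, α j ≤ 4) → ∀ x ∈ Icc (0 : Fin d → ℝ) 1,
    ∀ t ∈ Icc 0 P.T, HasDerivWithinAt (fun σ => D k α x σ) (D (k + 1) α x t) (Icc 0 P.T) t
  dx : ∀ k ≤ p + 1, ∀ α : Fin d → ℕ, (∀ j, α j ≤ 4) → ∀ j, α j < 4 →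
    ∀ x ∈ Icc (0 : Fin d → ℝ) 1, ∀ t ∈ Icc 0 P.T,
      HasDerivWithinAt (fun ξ => D k α (Function.update x j ξ) t)
        (D k (α + Pi.single j 1) x t) (Icc 0 1) (x j)
  pde : ∀ x ∈ unitCube d, ∀ t ∈ Icc 0 P.T,
    P.r x t = D 1 0 x t - ∑ j, P.a j * D 0 (Pi.single j 2) x t
  bc : ∀ x ∈ frontier (unitCube d), ∀ t ∈ Icc 0 P.T, P.β x t = D 0 0 x t
  ic : ∀ x ∈ unitCube d, P.u₀ x = D 0 0 x 0

theorem eqOn_Icc_of_eqOn_Ioc {T : ℝ} (hT : 0 < T) {f g : ℝ → ℝ} (hf : ContinuousOn f (Icc 0 T))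
    (hg : ContinuousOn g (Icc 0 T)) (h : ∀ t ∈ Ioc 0 T, f t = g t) : ∀ t ∈ Icc 0 T, f t = g t := by
  have hcl : closure (Ioc 0 T) = Icc 0 T := closure_Ioc hT.ne
  have : EqOn f g (closure (Ioc 0 T)) :=
    EqOn.of_subset_closure (s := Ioc 0 T) h (hcl ▸ hf) (hcl ▸ hg) subset_closure subset_rfl
  rwa [hcl] at this

theorem ContinuousOn.slice_time {d : ℕ} {f : (Fin d → ℝ) → ℝ → ℝ} {S : Set (Fin d → ℝ)} {I : Set ℝ}
    (hf : ContinuousOn (Function.uncurry f) (S ×ˢ I)) {x : Fin d → ℝ} (hx : x ∈ S) :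
    ContinuousOn (f x) I :=
  hf.comp (f := fun t => (x, t)) (by fun_prop) fun _ ht => ⟨hx, ht⟩

theorem update_mem_Icc {d : ℕ} {x : Fin d → ℝ} (hx : x ∈ Icc (0 : Fin d → ℝ) 1) (j : Fin d) {ξ : ℝ}
    (hξ : ξ ∈ Icc (0 : ℝ) 1) : Function.update x j ξ ∈ Icc (0 : Fin d → ℝ) 1 := by
  refine ⟨fun l => ?_, fun l => ?_⟩ <;> by_cases hl : l = j
  · subst hl; simpa using hξ.1
  · simpa [hl] using hx.1 l
  · subst hl; simpa using hξ.2
  · simpa [hl] using hx.2 l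

/-- The equations are given only for positive times, while the method also uses data at time 0;
density and continuity extend them. The freedom `p' ≤ p` allows working with an order lower than
that of the method. -/
theorem exists_smoothSolution {d p p' : ℕ} (hp : p' ≤ p) {P : DiffusionProblem d}
    {u : (Fin d → ℝ) → ℝ → ℝ} (hu : P.IsSolution u)
    (hreg : HasContinuousPartials P.T (p + 1) (max (p + 1) 4) u) :
    ∃ D, SmoothSolution P p' D ∧
      ∀ x ∈ Icc (0 : Fin d → ℝ) 1, ∀ t ∈ Icc 0 P.T, D 0 0 x t = u x t := by
  obtain ⟨D, h0, hc, ht, hx⟩ := hreg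
  have h4 : ∀ α : Fin d → ℕ, (∀ j, α j ≤ 4) → ∀ j, α j ≤ max (p + 1) 4 :=
    fun α hα j => (hα j).trans (le_max_right _ _)
  have hT := P.T_pos
  have hs : ∀ j : Fin d, ∀ l, (Pi.single j 2 : Fin d → ℕ) l ≤ 4 := by
    intro j l
    by_cases hl : l = j
    · subst hl; simp
    · simp [hl]
  have hz : ∀ l : Fin d, (0 : Fin d → ℕ) l ≤ 4 := fun _ => by simp
  refine ⟨D, ⟨fun k hk α hα => hc k (by omega) α (h4 α hα),
    fun k hk α hα => ht k (by omega) α (h4 α hα),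
    fun k hk α hα j hj => hx k (by omega) α (h4 α hα) j (hj.trans_le (le_max_right _ _)), ?_, ?_, ?_⟩,
    h0⟩
  · intro x hxc
    have hxI := unitCube_subset d hxc
    refine eqOn_Icc_of_eqOn_Ioc hT
      (P.r_cont.slice_time (subset_closure hxc)) ?_ fun t htt => ?_
    · refine ContinuousOn.sub ((hc 1 (by omega) 0 (h4 0 hz)).slice_time hxI) ?_
      exact continuousOn_finsetSum _ fun j _ =>
        continuousOn_const.mul ((hc 0 (by omega) _ (h4 _ (hs j))).slice_time hxI)
    · have htI : t ∈ Icc 0 P.T := ⟨htt.1.le, htt.2⟩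
      have h1 := hu.pde x hxc t htt
      have h2 : derivWithin (fun σ => u x σ) (Icc 0 P.T) t = D 1 0 x t := by
        refine HasDerivWithinAt.derivWithin ?_ (uniqueDiffOn_Icc hT t htI)
        exact (ht 0 (by omega) 0 (h4 0 hz) x hxI t htI).congr (fun σ hσ => (h0 x hxI σ hσ).symm)
          (h0 x hxI t htI).symm
      have h3 : ∀ j, iteratedDeriv 2 (fun ξ => u (Function.update x j ξ) t) (x j) =
          D 0 (Pi.single j 2) x t := by
        intro j
        have hj : ∀ᶠ ξ in 𝓝 (x j), ξ ∈ Ioo (0 : ℝ) 1 :=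
          isOpen_Ioo.mem_nhds (hxc j (Set.mem_univ j))
        have hupd : ∀ (α : Fin d → ℕ), (∀ l, α l ≤ 4) → α j < 4 → ∀ ξ ∈ Ioo (0 : ℝ) 1,
            HasDerivAt (fun ξ => D 0 α (Function.update x j ξ) t)
              (D 0 (α + Pi.single j 1) (Function.update x j ξ) t) ξ := by
          intro α hα hαj ξ hξ
          have := hx 0 (by omega) α (h4 α hα) j (hαj.trans_le (le_max_right _ _))
            (Function.update x j ξ) (update_mem_Icc hxI j ⟨hξ.1.le, hξ.2.le⟩) t htI
          simp only [Function.update_idem, Function.update_self] at this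
          exact this.hasDerivAt (Icc_mem_nhds hξ.1 hξ.2)
        have e1 : deriv (fun ξ => u (Function.update x j ξ) t) =ᶠ[𝓝 (x j)]
            fun ξ => D 0 (Pi.single j 1) (Function.update x j ξ) t := by
          filter_upwards [hj.eventually_nhds, hj] with ξ hξ hξ'
          have e2 : (fun ξ => u (Function.update x j ξ) t) =ᶠ[𝓝 ξ]
              fun ξ => D 0 0 (Function.update x j ξ) t := by
            filter_upwards [hξ] with ζ hζ
            exact (h0 _ (update_mem_Icc hxI j ⟨hζ.1.le, hζ.2.le⟩) t htI).symm
          rw [e2.deriv_eq]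
          have := (hupd 0 hz (by simp) ξ hξ').deriv
          rwa [zero_add] at this
        rw [iteratedDeriv_succ, iteratedDeriv_one, e1.deriv_eq]
        have hs1 : ∀ l, (Pi.single j 1 : Fin d → ℕ) l ≤ 4 := by
          intro l
          by_cases hl : l = j
          · subst hl; simp
          · simp [hl]
        have := (hupd (Pi.single j 1) hs1 (by simp) (x j) (hxc j (Set.mem_univ j))).deriv
        rw [this, Function.update_eq_self, ← Pi.single_add]
      rw [h2] at h1
      simp only [h3] at h1
      linarith
  · intro x hxf
    have hxI := frontier_unitCube_subset d hxf
    refine eqOn_Icc_of_eqOn_Ioc hT (P.β_cont.slice_time hxf)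
      ((hc 0 (by omega) 0 (h4 0 hz)).slice_time hxI) fun t htt => ?_
    rw [h0 x hxI t ⟨htt.1.le, htt.2⟩, hu.bc x hxf t htt]
  · intro x hxc
    rw [h0 x (unitCube_subset d hxc) 0 ⟨le_rfl, hT.le⟩, hu.ic x hxc]

namespace SmoothSolution

variable {d p : ℕ} {P : DiffusionProblem d} {D : ℕ → (Fin d → ℕ) → (Fin d → ℝ) → ℝ → ℝ}

theorem exists_bound (hD : SmoothSolution P p D) :
    ∃ B > 0, ∀ k ≤ p + 1, ∀ α : Fin d → ℕ, (∀ j, α j ≤ 4) → ∀ x ∈ Icc (0 : Fin d → ℝ) 1,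
      ∀ t ∈ Icc 0 P.T, |D k α x t| ≤ B := by
  have h : ∀ k α, ∃ c, k ≤ p + 1 → (∀ j, α j ≤ 4) → ∀ x ∈ Icc (0 : Fin d → ℝ) 1,
      ∀ t ∈ Icc 0 P.T, |D k α x t| ≤ c := by
    intro k α
    by_cases hk : k ≤ p + 1 ∧ ∀ j, α j ≤ 4
    · obtain ⟨c, hc⟩ := (isCompact_Icc.prod isCompact_Icc).exists_bound_of_continuousOn
        (hD.cont k hk.1 α hk.2)
      exact ⟨c, fun _ _ x hx t ht => hc (x, t) ⟨hx, ht⟩⟩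
    · exact ⟨0, fun h1 h2 => (hk ⟨h1, h2⟩).elim⟩
  choose c hc using h
  refine ⟨∑ k ∈ Finset.range (p + 2), ∑ α ∈ Finset.Iic (fun _ : Fin d => 4), |c k α| + 1,
    by positivity, fun k hk α hα x hx t ht => ?_⟩
  have h1 : |c k α| ≤ ∑ α ∈ Finset.Iic (fun _ : Fin d => 4), |c k α| :=
    Finset.single_le_sum (f := fun α => |c k α|) (fun _ _ => abs_nonneg _)
      (Finset.mem_Iic.2 fun j => hα j)
  have h2 := Finset.single_le_sum
    (f := fun k => ∑ α ∈ Finset.Iic (fun _ : Fin d => 4), |c k α|)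
    (fun _ _ => Finset.sum_nonneg fun _ _ => abs_nonneg _)
    (Finset.mem_range.2 (by omega : k < p + 2))
  have h3 := hc k α hk hα x hx t ht
  have h4 := le_abs_self (c k α)
  linarith

theorem vanish_of_timeIndependent (hD : SmoothSolution P p D) (hP : P.TimeIndependentBC)
    {k : ℕ} (hk1 : 1 ≤ k) (hk : k ≤ p + 1) (α : Fin d → ℕ) (hα : ∀ j, α j ≤ 4) (l : Fin d)
    (hl : α l = 0) {x : Fin d → ℝ} (hx : x ∈ Icc (0 : Fin d → ℝ) 1) (hxl : x l = 0 ∨ x l = 1)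
    {t : ℝ} (ht : t ∈ Icc 0 P.T) : D k α x t = 0 := by
  have hT := P.T_pos
  have hz : ∀ l : Fin d, (0 : Fin d → ℕ) l ≤ 4 := fun _ => by simp
  have htime : ∀ k, k ≤ p → ∀ x ∈ Icc (0 : Fin d → ℝ) 1, (x l = 0 ∨ x l = 1) →
      ∀ t ∈ Icc 0 P.T, D (k + 1) 0 x t = 0 := by
    intro k
    induction k with
    | zero =>
      intro _ x hx hxl t ht
      have h1 := hD.dt 0 (by omega) 0 hz x hx t ht
      have h2 : HasDerivWithinAt (fun σ => D 0 0 x σ) 0 (Icc 0 P.T) t := by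
        have hf := mem_frontier_unitCube hx l hxl
        refine (hasDerivWithinAt_const t _ (D 0 0 x t)).congr (fun σ hσ => ?_) rfl
        rw [← hD.bc x hf σ hσ, ← hD.bc x hf t ht]
        exact hP x hf σ hσ t ht
      exact (uniqueDiffOn_Icc hT t ht).eq_deriv _ h1 h2
    | succ k ih =>
      intro hk x hx hxl t ht
      have h1 := hD.dt (k + 1) (by omega) 0 hz x hx t ht
      have h2 : HasDerivWithinAt (fun σ => D (k + 1) 0 x σ) 0 (Icc 0 P.T) t :=
        (hasDerivWithinAt_const t _ (0 : ℝ)).congr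
          (fun σ hσ => ih (by omega) x hx hxl σ hσ) (ih (by omega) x hx hxl t ht)
      exact (uniqueDiffOn_Icc hT t ht).eq_deriv _ h1 h2
  obtain ⟨k, rfl⟩ : ∃ m, k = m + 1 := ⟨k - 1, by omega⟩
  have hspace : ∀ N : ℕ, ∀ α : Fin d → ℕ, ∑ j, α j = N → (∀ j, α j ≤ 4) → α l = 0 →
      ∀ x ∈ Icc (0 : Fin d → ℝ) 1, (x l = 0 ∨ x l = 1) → D (k + 1) α x t = 0 := by
    intro N
    induction N with
    | zero =>
      intro α hsum _ _ x hx hxl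
      have : α = 0 := by
        funext j
        exact Finset.sum_eq_zero_iff.1 hsum j (Finset.mem_univ j)
      rw [this]
      exact htime k (by omega) x hx hxl t ht
    | succ N ih =>
      intro α hsum hα hαl x hx hxl
      obtain ⟨j, hj⟩ : ∃ j, α j ≠ 0 := by
        by_contra hne
        push Not at hne
        simp [hne] at hsum
      have hjl : l ≠ j := by rintro rfl; exact hj hαl
      set α' : Fin d → ℕ := α - Pi.single j 1 with hα'
      have hadd : α' + Pi.single j 1 = α := by
        funext i
        by_cases hi : i = j
        · subst hi; simp [hα']; omega
        · simp [hα', hi]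
      have hle : ∀ i, α' i ≤ α i := fun i => by simp [hα']
      have hαj : α' j < 4 := by
        have := hα j
        simp [hα']; omega
      have hsum' : ∑ i, α' i = N := by
        have : ∑ i, α i = ∑ i, α' i + 1 := by
          rw [← hadd]; simp [Finset.sum_add_distrib]
        omega
      have hα4 : ∀ i, α' i ≤ 4 := fun i => (hle i).trans (hα i)
      have hα0 : α' l = 0 := Nat.eq_zero_of_le_zero (hαl ▸ hle l)
      have h1 := hD.dx (k + 1) hk α' hα4 j hαj x hx t ht
      rw [hadd] at h1
      have hxj : x j ∈ Icc (0 : ℝ) 1 := ⟨hx.1 j, hx.2 j⟩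
      have h2 : HasDerivWithinAt (fun ξ => D (k + 1) α' (Function.update x j ξ) t) 0 (Icc 0 1)
          (x j) := by
        refine (hasDerivWithinAt_const (x j) _ (0 : ℝ)).congr (fun ξ hξ => ?_) ?_
        · exact ih α' hsum' hα4 hα0 _ (update_mem_Icc hx j hξ)
            (by rwa [Function.update_of_ne hjl])
        · rw [Function.update_eq_self]
          exact ih α' hsum' hα4 hα0 x hx hxl
      exact (uniqueDiffOn_Icc one_pos (x j) hxj).eq_deriv _ h1 h2
  exact hspace _ α rfl hα hl x hx hxl

end SmoothSolution

/-- The second difference quotient in direction `j` of a function on the cube. -/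
def secondDiff {d : ℕ} (n : Fin d → ℕ) (j : Fin d) (f : (Fin d → ℝ) → ℝ) : GridFun n := fun i =>
  (f (Function.update (gridNode n (gridIndex i)) j (gridNode n (gridIndex i) j + meshWidth n j))
    - 2 * f (gridNode n (gridIndex i))
    + f (Function.update (gridNode n (gridIndex i)) j
        (gridNode n (gridIndex i) j - meshWidth n j))) / meshWidth n j ^ 2

/-! ### Difference quotients of the exact solution and time derivatives of the splitting. -/

section GridNodes

variable {d : ℕ} (n : Fin d → ℕ)

theorem gridNode_update (k : Fin d → ℕ) (j : Fin d) (m : ℕ) :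
    gridNode n (Function.update k j m) = Function.update (gridNode n k) j (m * meshWidth n j) := by
  funext l
  by_cases hl : l = j
  · subst hl; simp [gridNode]
  · simp [gridNode, hl]

theorem gridNode_mem_unitCube (i : (l : Fin d) → Fin (n l)) :
    gridNode n (gridIndex i) ∈ unitCube d := by
  intro l _
  have h := meshWidth_mul n l
  have h0 := meshWidth_pos n l
  have h1 : (((i l : ℕ) + 1 : ℕ) : ℝ) ≤ n l := by exact_mod_cast (i l).2
  have h2 : (0 : ℝ) < ((i l : ℕ) + 1 : ℕ) := by positivity
  show 0 < (((i l : ℕ) + 1 : ℕ) : ℝ) * meshWidth n l ∧ (((i l : ℕ) + 1 : ℕ) : ℝ) * meshWidth n l < 1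
  exact ⟨by positivity, by nlinarith⟩

theorem gridNode_add_mem (i : (l : Fin d) → Fin (n l)) (j : Fin d) :
    gridNode n (gridIndex i) j + meshWidth n j ∈ Icc (0 : ℝ) 1 := by
  have h := meshWidth_mul n j
  have h0 := meshWidth_pos n j
  have h1 : (((i j : ℕ) + 1 : ℕ) : ℝ) ≤ n j := by exact_mod_cast (i j).2
  have h2 : (0 : ℝ) < ((i j : ℕ) + 1 : ℕ) := by positivity
  show 0 ≤ (((i j : ℕ) + 1 : ℕ) : ℝ) * meshWidth n j + _ ∧
    (((i j : ℕ) + 1 : ℕ) : ℝ) * meshWidth n j + _ ≤ 1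
  exact ⟨by positivity, by nlinarith⟩

theorem gridNode_sub_mem (i : (l : Fin d) → Fin (n l)) (j : Fin d) :
    gridNode n (gridIndex i) j - meshWidth n j ∈ Icc (0 : ℝ) 1 := by
  have h := meshWidth_mul n j
  have h0 := meshWidth_pos n j
  have h1 : (((i j : ℕ) + 1 : ℕ) : ℝ) ≤ n j := by exact_mod_cast (i j).2
  show 0 ≤ (((i j : ℕ) + 1 : ℕ) : ℝ) * meshWidth n j - _ ∧
    (((i j : ℕ) + 1 : ℕ) : ℝ) * meshWidth n j - _ ≤ 1
  push_cast at h1 ⊢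
  have h3 : (0 : ℝ) ≤ (i j : ℕ) := by positivity
  exact ⟨by nlinarith, by nlinarith⟩

theorem gridExtend_gridRestrict {f g : (Fin d → ℝ) → ℝ}
    (hfg : ∀ x ∈ frontier (unitCube d), g x = f x) {k : Fin d → ℕ} (hk : ∀ l, k l ≤ n l + 1) :
    gridExtend g (gridRestrict n f) k = f (gridNode n k) := by
  simp only [gridExtend]
  split_ifs with h
  · simp only [gridRestrict]
    congr 2
    funext l
    simp only [gridIndex]
    have := (h l).1
    omega
  · push Not at h
    obtain ⟨l, hl⟩ := h
    refine hfg _ (mem_frontier_unitCube (gridNode_mem n hk) l ?_)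
    rcases Nat.eq_zero_or_pos (k l) with h0 | h0
    · left; simp [gridNode, h0]
    · right
      have h1 : k l = n l + 1 := le_antisymm (hk l) (hl h0)
      have := meshWidth_mul n l
      simp only [gridNode, h1]
      push_cast
      linarith

theorem diffusionTerm_gridRestrict (P : DiffusionProblem d) (j : Fin d) {t : ℝ}
    {f : (Fin d → ℝ) → ℝ} (hf : ∀ x ∈ frontier (unitCube d), P.β x t = f x) :
    P.diffusionTerm n j t (gridRestrict n f) = P.a j • secondDiff n j f := by
  funext i
  have hi : ∀ l, gridIndex i l ≤ n l := fun l => (i l).2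
  have hup : ∀ (m : ℕ), m ≤ n j + 1 → ∀ l, Function.update (gridIndex i) j m l ≤ n l + 1 := by
    intro m hm l
    by_cases hl : l = j
    · subst hl; simpa using hm
    · rw [Function.update_of_ne hl]; exact (hi l).trans (Nat.le_succ _)
  simp only [DiffusionProblem.diffusionTerm, Pi.smul_apply, smul_eq_mul, secondDiff]
  rw [gridExtend_gridRestrict n hf (hup _ (by have := hi j; omega)),
    gridExtend_gridRestrict n hf (hup _ (by have := hi j; omega)),
    gridExtend_gridRestrict n hf (fun l => (hi l).trans (Nat.le_succ _)), gridNode_update,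
    gridNode_update]
  have h1 : ((gridIndex i j + 1 : ℕ) : ℝ) * meshWidth n j =
      gridNode n (gridIndex i) j + meshWidth n j := by
    simp only [gridNode]; push_cast; ring
  have h2 : ((gridIndex i j - 1 : ℕ) : ℝ) * meshWidth n j =
      gridNode n (gridIndex i) j - meshWidth n j := by
    simp only [gridNode, gridIndex]
    rw [Nat.add_sub_cancel]; push_cast; ring
  rw [h1, h2, mul_div_assoc]

end GridNodes

theorem single_le {d : ℕ} (j : Fin d) {m r : ℕ} (h : m ≤ r) (l : Fin d) :
    (Pi.single j m : Fin d → ℕ) l ≤ r := by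
  by_cases hl : l = j
  · subst hl; simpa using h
  · simp [hl]

namespace SmoothSolution

variable {d p : ℕ} {P : DiffusionProblem d} {D : ℕ → (Fin d → ℕ) → (Fin d → ℝ) → ℝ → ℝ}

theorem hasDerivWithinAt_gridRestrict (hD : SmoothSolution P p D) (n : Fin d → ℕ) {k : ℕ}
    (hk : k < p + 1) {α : Fin d → ℕ} (hα : ∀ j, α j ≤ 4) {t : ℝ} (ht : t ∈ Icc 0 P.T) :
    HasDerivWithinAt (fun σ => gridRestrict n fun x => D k α x σ)
      (gridRestrict n fun x => D (k + 1) α x t) (Icc 0 P.T) t := by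
  rw [hasDerivWithinAt_pi]
  intro i
  exact hD.dt k hk α hα _ (gridNode_gridIndex_mem n i) t ht

theorem hasDerivWithinAt_secondDiff (hD : SmoothSolution P p D) (n : Fin d → ℕ) (j : Fin d) {k : ℕ}
    (hk : k < p + 1) {t : ℝ} (ht : t ∈ Icc 0 P.T) :
    HasDerivWithinAt (fun σ => secondDiff n j fun x => D k 0 x σ)
      (secondDiff n j fun x => D (k + 1) 0 x t) (Icc 0 P.T) t := by
  rw [hasDerivWithinAt_pi]
  intro i
  have h := gridNode_gridIndex_mem n i
  have hd := fun y hy => hD.dt k hk 0 (fun _ => by simp) y hy t ht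
  exact (((hd _ (update_mem_Icc h j (gridNode_add_mem n i j))).sub ((hd _ h).const_mul 2)).add
    (hd _ (update_mem_Icc h j (gridNode_sub_mem n i j)))).div_const _

theorem abs_secondDiff_sub_le (hD : SmoothSolution P p D) {B : ℝ}
    (hB : ∀ k ≤ p + 1, ∀ α : Fin d → ℕ, (∀ j, α j ≤ 4) → ∀ x ∈ Icc (0 : Fin d → ℝ) 1,
      ∀ t ∈ Icc 0 P.T, |D k α x t| ≤ B) (n : Fin d → ℕ) (j : Fin d) {k : ℕ} (hk : k ≤ p + 1)
    {t : ℝ} (ht : t ∈ Icc 0 P.T) (i : (l : Fin d) → Fin (n l)) :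
    |gridRestrict n (fun x => D k (Pi.single j 2) x t) i - secondDiff n j (fun x => D k 0 x t) i| ≤
      2 * B * meshWidth n j ^ 2 := by
  set x := gridNode n (gridIndex i) with hx
  have hxI : x ∈ Icc (0 : Fin d → ℝ) 1 := gridNode_gridIndex_mem n i
  have hchain : IsDerivChain 0 1 4
      (fun m ξ => D k (Pi.single j m) (Function.update x j ξ) t) := by
    intro m hm ξ hξ
    have := hD.dx k hk (Pi.single j m) (single_le j hm.le) j (by simpa using hm)
      (Function.update x j ξ) (update_mem_Icc hxI j hξ) t ht
    simpa only [Function.update_idem, Function.update_self, ← Pi.single_add] using this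
  have h := hchain.second_difference_sub_le (B := B)
    (fun ξ hξ => hB k hk _ (single_le j le_rfl) _ (update_mem_Icc hxI j hξ) t ht)
    (meshWidth_pos n j).le (x := x j) ⟨hxI.1 j, hxI.2 j⟩ (gridNode_add_mem n i j)
    (gridNode_sub_mem n i j)
  simp only [Function.update_eq_self, Pi.single_zero] at h
  have h0 := meshWidth_pos n j
  simp only [gridRestrict, secondDiff, ← hx]
  rw [abs_sub_comm]
  have h2 : 0 < meshWidth n j ^ 2 := by positivity
  rw [div_sub' h2.ne', abs_div, abs_of_pos h2, div_le_iff₀ h2]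
  refine h.trans (le_of_eq ?_)
  ring

theorem weightedNorm_sub_le (hD : SmoothSolution P p D) {B : ℝ} (hB0 : 0 ≤ B)
    (hB : ∀ k ≤ p + 1, ∀ α : Fin d → ℕ, (∀ j, α j ≤ 4) → ∀ x ∈ Icc (0 : Fin d → ℝ) 1,
      ∀ t ∈ Icc 0 P.T, |D k α x t| ≤ B) (n : Fin d → ℕ) (j : Fin d) {k : ℕ} (hk : k ≤ p + 1)
    {t : ℝ} (ht : t ∈ Icc 0 P.T) :
    weightedNorm (P.a j • gridRestrict n (fun x => D k (Pi.single j 2) x t)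
      - P.a j • secondDiff n j (fun x => D k 0 x t)) ≤
      2 * P.a j * B * maxMeshWidth n ^ 2 := by
  have h1 : meshWidth n j ≤ maxMeshWidth n :=
    le_ciSup (f := fun l => meshWidth n l) (Set.finite_range _).bddAbove j
  have h0 := meshWidth_pos n j
  have ha := P.a_pos j
  have h2 := pow_le_pow_left₀ h0.le h1 2
  refine weightedNorm_le n (by positivity) fun i => ?_
  simp only [Pi.sub_apply, Pi.smul_apply, smul_eq_mul]
  rw [← mul_sub, abs_mul, abs_of_pos ha]
  have h3 := hD.abs_secondDiff_sub_le hB n j hk ht i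
  have h4 : 0 ≤ 2 * P.a j * B := by positivity
  nlinarith [mul_le_mul_of_nonneg_left h3 ha.le, mul_le_mul_of_nonneg_left h2 h4]

theorem diffusionTerm_eq_secondDiff (hD : SmoothSolution P p D) (n : Fin d → ℕ) (j : Fin d) {t : ℝ}
    (ht : t ∈ Icc 0 P.T) : P.diffusionTerm n j t (gridRestrict n fun x => D 0 0 x t) =
      P.a j • secondDiff n j fun x => D 0 0 x t :=
  diffusionTerm_gridRestrict n P j fun x hx => hD.bc x hx t ht

/-- The boundary contribution to the central difference operator. -/
theorem diffusionTerm_zero (hD : SmoothSolution P p D) (n : Fin d → ℕ) (j : Fin d) {t : ℝ}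
    (ht : t ∈ Icc 0 P.T) : P.diffusionTerm n j t 0 =
      P.a j • (secondDiff n j fun x => D 0 0 x t)
        - dirLaplacian n (P.a j) j (gridRestrict n fun x => D 0 0 x t) := by
  rw [← hD.diffusionTerm_eq_secondDiff n j ht,
    diffusionTerm_eq n P j t (gridRestrict n _), add_sub_cancel_left]

/-- The boundary contribution is the second difference quotient of `u` minus the homogeneous
operator applied to `u`. Its time derivative is therefore obtained from that of `u`, and no
derivative of `β` has to be taken. -/
theorem hasDerivWithinAt_diffusionTerm (hD : SmoothSolution P p D) (n : Fin d → ℕ) (j : Fin d)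
    (v : GridFun n) {t : ℝ} (ht : t ∈ Icc 0 P.T) :
    HasDerivWithinAt (fun σ => P.diffusionTerm n j σ v)
      (P.a j • (secondDiff n j fun x => D 1 0 x t)
        - dirLaplacian n (P.a j) j (gridRestrict n fun x => D 1 0 x t)) (Icc 0 P.T) t := by
  have hU := hD.hasDerivWithinAt_gridRestrict n (k := 0) (by omega) (α := 0) (fun _ => by simp) ht
  have hX := hD.hasDerivWithinAt_secondDiff n j (k := 0) (by omega) ht
  have hL := (LinearMap.toContinuousLinearMap
    (dirLaplacian n (P.a j) j)).hasFDerivAt.comp_hasDerivWithinAt t hU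
  have h := ((hX.const_smul (P.a j)).sub hL).const_add (dirLaplacian n (P.a j) j v)
  refine h.congr (fun σ hσ => ?_) ?_
  · rw [diffusionTerm_eq, hD.diffusionTerm_zero n j hσ]; rfl
  · rw [diffusionTerm_eq, hD.diffusionTerm_zero n j ht]; rfl

theorem gridRestrict_r (hD : SmoothSolution P p D) (n : Fin d → ℕ) {t : ℝ} (ht : t ∈ Icc 0 P.T) :
    (gridRestrict n fun x => P.r x t) = (gridRestrict n fun x => D 1 0 x t)
      - ∑ j, P.a j • gridRestrict n fun x => D 0 (Pi.single j 2) x t := by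
  funext i
  simp only [Pi.sub_apply, Finset.sum_apply, Pi.smul_apply, smul_eq_mul, gridRestrict]
  exact hD.pde _ (gridNode_mem_unitCube n i) t ht

theorem hasDerivWithinAt_r (hD : SmoothSolution P p D) (hp : 1 ≤ p) (n : Fin d → ℕ) {t : ℝ}
    (ht : t ∈ Icc 0 P.T) :
    HasDerivWithinAt (fun σ => gridRestrict n fun x => P.r x σ)
      ((gridRestrict n fun x => D 2 0 x t)
      - ∑ j, P.a j • gridRestrict n fun x => D 1 (Pi.single j 2) x t) (Icc 0 P.T) t := by
  have h := (hD.hasDerivWithinAt_gridRestrict n (k := 1) (by omega) (α := 0)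
    (fun _ => by simp) ht).sub (HasDerivWithinAt.fun_sum (u := Finset.univ) fun j _ =>
      (hD.hasDerivWithinAt_gridRestrict n (k := 0) (by omega) (α := Pi.single j 2)
        (single_le j (by omega)) ht).const_smul (P.a j))
  exact h.congr (fun σ hσ => hD.gridRestrict_r n hσ) (hD.gridRestrict_r n ht)

/-- The boundary contribution does not change in time, so its derivative, as given by
`hasDerivWithinAt_diffusionTerm`, is zero. -/
theorem secondDiff_eq_of_timeIndependent (hD : SmoothSolution P p D) (hP : P.TimeIndependentBC)
    (n : Fin d → ℕ) (j : Fin d) {t : ℝ} (ht : t ∈ Icc 0 P.T) :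
    P.a j • (secondDiff n j fun x => D 1 0 x t) =
      dirLaplacian n (P.a j) j (gridRestrict n fun x => D 1 0 x t) := by
  have h1 := hD.hasDerivWithinAt_diffusionTerm n j 0 ht
  have h2 : HasDerivWithinAt (fun σ => P.diffusionTerm n j σ 0) 0 (Icc 0 P.T) t := by
    refine (hasDerivWithinAt_const t _ (P.diffusionTerm n j t 0)).congr (fun σ hσ => ?_) rfl
    have hg : ∀ k : Fin d → ℕ, (∀ l, k l ≤ n l + 1) →
        gridExtend (fun x => P.β x σ) (0 : GridFun n) k =
        gridExtend (fun x => P.β x t) (0 : GridFun n) k := by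
      intro k hk
      simp only [gridExtend]
      split_ifs with h
      · rfl
      · push Not at h
        obtain ⟨l, hl⟩ := h
        refine hP _ (mem_frontier_unitCube (gridNode_mem n hk) l ?_) σ hσ t ht
        rcases Nat.eq_zero_or_pos (k l) with h0 | h0
        · left; simp [gridNode, h0]
        · right
          have h1 : k l = n l + 1 := le_antisymm (hk l) (hl h0)
          have := meshWidth_mul n l
          simp only [gridNode, h1]
          push_cast
          linarith
    funext i
    have hi : ∀ l, gridIndex i l ≤ n l := fun l => (i l).2
    have hup : ∀ (m : ℕ), m ≤ n j + 1 → ∀ l, Function.update (gridIndex i) j m l ≤ n l + 1 := by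
      intro m hm l
      by_cases hl : l = j
      · subst hl; simpa using hm
      · rw [Function.update_of_ne hl]; exact (hi l).trans (Nat.le_succ _)
    simp only [DiffusionProblem.diffusionTerm]
    rw [hg _ (hup _ (by have := hi j; omega)), hg _ (hup _ (by have := hi j; omega)),
      hg _ (fun l => (hi l).trans (Nat.le_succ _))]
  exact sub_eq_zero.1 ((uniqueDiffOn_Icc P.T_pos t ht).eq_deriv _ h1 h2)

/-- One power of decay in each direction costs one more derivative in that direction, so
multi-indices up to 3 are covered by the available four. The second derivatives `∂_jj` are the case
needed. -/
theorem abs_sineCoeff_le (hD : SmoothSolution P p D) {B : ℝ}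
    (hB : ∀ k ≤ p + 1, ∀ α : Fin d → ℕ, (∀ j, α j ≤ 4) → ∀ x ∈ Icc (0 : Fin d → ℝ) 1,
      ∀ t ∈ Icc 0 P.T, |D k α x t| ≤ B) (n : Fin d → ℕ) {m : ℕ} (hm : m ≤ p + 1) {α : Fin d → ℕ}
    (hα : ∀ j, α j ≤ 3) {t : ℝ} (ht : t ∈ Icc 0 P.T) (k : (l : Fin d) → Fin (n l)) :
    |sineCoeff n (gridRestrict n fun x => D m α x t) k| ≤ (∏ l, 3 / ((k l : ℕ) + 1 : ℝ)) * B := by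
  have := abs_sineCoeff_gridRestrict_le n (D := fun γ x => D m (α + γ) x t) (B := B) ?_ ?_ k
  · simpa using this
  · intro γ hγ j hj x hx
    have h := hD.dx m hm (α + γ) (fun l => by
      have := hα l; have := hγ l; simp only [Pi.add_apply]; omega) j (by
      have := hα j; simp only [Pi.add_apply]; omega) x hx t ht
    rwa [add_assoc] at h
  · intro γ hγ x hx
    exact hB m hm _ (fun l => by
      have := hα l; have := hγ l; simp only [Pi.add_apply]; omega) x hx t ht

theorem abs_sineCoeff_le_of_timeIndependent (hD : SmoothSolution P p D)
    (hP : P.TimeIndependentBC) {B : ℝ}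
    (hB : ∀ k ≤ p + 1, ∀ α : Fin d → ℕ, (∀ j, α j ≤ 4) → ∀ x ∈ Icc (0 : Fin d → ℝ) 1,
      ∀ t ∈ Icc 0 P.T, |D k α x t| ≤ B) (n : Fin d → ℕ) {m : ℕ} (hm1 : 1 ≤ m) (hm : m ≤ p + 1)
    {t : ℝ} (ht : t ∈ Icc 0 P.T) (k : (l : Fin d) → Fin (n l)) :
    |sineCoeff n (gridRestrict n fun x => D m 0 x t) k| ≤
      (∏ l, 3 / ((k l : ℕ) + 1 : ℝ) ^ 3) * B := by
  refine abs_sineCoeff_gridRestrict_le_of_vanish n (D := fun γ x => D m γ x t) (B := B) ?_ ?_ ?_ k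
  · intro γ hγ j hj x hx
    exact hD.dx m hm γ (fun l => (hγ l).trans (by omega)) j (by omega) x hx t ht
  · intro γ hγ x hx
    exact hB m hm _ (fun l => (hγ l).trans (by omega)) x hx t ht
  · intro γ hγ j hj x hx hxj
    exact hD.vanish_of_timeIndependent hP hm1 hm γ (fun l => (hγ l).trans (by omega)) j hj hx hxj ht

end SmoothSolution

/-! ### One step in a sine mode -/

namespace AMFWMethod

variable {s d : ℕ} (M : AMFWMethod s)

/-- The partial products `∏_{l < j} (1 - θ x_l)`. -/
def partialAmpl (x : Fin d → ℝ) (j : Fin d) : ℝ :=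
  ∏ l ∈ Finset.univ with l < j, (1 - M.θ * x l)

theorem sum_mul_partialAmpl (x : Fin d → ℝ) :
    M.θ * ∑ j, x j * M.partialAmpl x j = 1 - M.ampl x := by
  rw [ampl, Finset.prod_one_sub_ordered, Finset.mul_sum, sub_sub_cancel]
  exact Finset.sum_congr rfl fun j _ => by rw [partialAmpl]; ring

/-- Multiplying the successive equations by partial products telescopes the factors. The
perturbation added in direction `j` has then been multiplied exactly by the factors of the
directions before `j`. -/
theorem ampl_mul_last {x γ : Fin d → ℝ} {q : Fin (d + 2) → ℝ} {e γ₀ : ℝ}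
    (h0 : q 1 = q 0 + e * γ₀)
    (h : ∀ j : Fin d, (1 - M.θ * x j) * q j.succ.succ = q j.succ.castSucc + e * γ j) :
    M.ampl x * q (Fin.last (d + 1)) = q 0 + e * (γ₀ + ∑ j, γ j * M.partialAmpl x j) := by
  -- The offset `m + 1` accounts for the two vectors that precede the directional solves: the
  -- explicit one and the one of the source term, which needs no inversion.
  have key : ∀ m, (hm : m ≤ d) → (∏ l ∈ Finset.univ.filter (fun l : Fin d => (l : ℕ) < m), (1 - M.θ * x l)) *
      q ⟨m + 1, by omega⟩ =
      q 0 + e * (γ₀ + ∑ j ∈ Finset.univ.filter (fun l : Fin d => (l : ℕ) < m), γ j * M.partialAmpl x j) := by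
    intro m
    induction m with
    | zero =>
      intro _
      simp only [not_lt_zero, Finset.filter_false, Finset.prod_empty, Finset.sum_empty, one_mul,
        add_zero]
      exact h0
    | succ m ih =>
      intro hm
      have ih' := ih (by omega)
      have hins : (Finset.univ.filter fun l : Fin d => (l : ℕ) < m + 1) =
          insert ⟨m, hm⟩ (Finset.univ.filter fun l : Fin d => (l : ℕ) < m) := by
        ext l
        simp only [Finset.mem_filter, Finset.mem_univ, true_and, Finset.mem_insert, Fin.ext_iff]
        omega
      have hnot : (⟨m, hm⟩ : Fin d) ∉ Finset.univ.filter fun l : Fin d => (l : ℕ) < m := by simp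
      have hm' := h ⟨m, hm⟩
      rw [hins, Finset.prod_insert hnot, Finset.sum_insert hnot]
      have hp : M.partialAmpl x ⟨m, hm⟩ = ∏ l ∈ Finset.univ.filter (fun l : Fin d => (l : ℕ) < m), (1 - M.θ * x l) := rfl
      have e1 : q (Fin.succ (Fin.succ ⟨m, hm⟩)) = q ⟨m + 1 + 1, by omega⟩ := rfl
      have e2 : q (Fin.castSucc (Fin.succ ⟨m, hm⟩)) = q ⟨m + 1, by omega⟩ := rfl
      rw [e1, e2] at hm'
      rw [hp]
      linear_combination (∏ l ∈ Finset.univ.filter (fun l : Fin d => (l : ℕ) < m), (1 - M.θ * x l)) * hm' + ih'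
  have := key d le_rfl
  have hu : (Finset.univ.filter fun l : Fin d => (l : ℕ) < d) = Finset.univ := by
    ext l; simp
  rw [hu] at this
  exact this

/-- Eliminating the directional substages turns the stage equations into a linear system with
`stageMatrix`. The part proportional to `v` produces the stability function, all data enter through
`stageFun`. -/
theorem scalar_step {lam γ : Fin d → ℝ} {τ v v' γ₀ : ℝ} {G : Fin s → ℝ}
    {q : Fin s → Fin (d + 2) → ℝ} (hamp : M.ampl (τ • lam) ≠ 0)
    (h0 : ∀ i, q i 0 = τ * (G i + ∑ k, lam k * (v + ∑ j, M.A i j * q j (Fin.last (d + 1))))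
      + ∑ j, M.L i j * q j (Fin.last (d + 1)))
    (h1 : ∀ i, q i 1 = q i 0 + M.θ * M.rho i * τ ^ 2 * γ₀)
    (h2 : ∀ i (j : Fin d), q i j.succ.succ - M.θ * τ * (lam j * q i j.succ.succ) =
      q i j.succ.castSucc + M.θ * M.rho i * τ ^ 2 * γ j)
    (hv : v' = v + ∑ i, M.b i * q i (Fin.last (d + 1))) :
    v' = M.stabilityFunction (τ • lam) * v + M.stageFun (τ • lam) (fun i => τ * G i
      + M.θ * M.rho i * τ ^ 2 * (γ₀ + ∑ j, γ j * M.partialAmpl (τ • lam) j)) := by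
  set x := τ • lam with hx
  have hz : ∑ j, x j = τ * ∑ k, lam k := by simp [hx, Finset.mul_sum]
  have hlast : ∀ i, M.ampl x * q i (Fin.last (d + 1)) = q i 0 +
      M.θ * M.rho i * τ ^ 2 * (γ₀ + ∑ j, γ j * M.partialAmpl x j) := fun i =>
    M.ampl_mul_last (h1 i) fun j => by
      rw [← h2 i j, hx]; simp only [Pi.smul_apply, smul_eq_mul]; ring
  have hmat : Matrix.mulVec (M.stageMatrix x) (fun i => q i (Fin.last (d + 1))) =
      (v * ∑ j, x j) • (fun _ => 1) + fun i => τ * G i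
      + M.θ * M.rho i * τ ^ 2 * (γ₀ + ∑ j, γ j * M.partialAmpl x j) := by
    funext i
    rw [stageMatrix_mulVec_apply, hlast i, h0 i, hz, ← Finset.sum_mul]
    simp only [Pi.add_apply, Pi.smul_apply, smul_eq_mul]
    ring
  have hb : ∑ i, M.b i * q i (Fin.last (d + 1)) = M.stageFun x
      (Matrix.mulVec (M.stageMatrix x) (fun i => q i (Fin.last (d + 1)))) := by
    rw [M.stageFun_mulVec x hamp]; rfl
  rw [hv, hb, hmat, map_add, map_smul, stabilityFunction_eq, smul_eq_mul]
  ring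

/-- The local error of the method in a sine mode. Here `u k` is the `k`-th time derivative of the
mode of the exact solution at the current time, `φ j` that of `a_j ∂_jj u_t`, and `δ`, `δ'` come
from the spatial discretization. -/
theorem local_error_eq {x φ δ' : Fin d → ℝ} {τ lam : ℝ} (hamp : M.ampl x ≠ 0)
    (hlam : ∑ j, x j = τ * lam) (hb : dotProduct M.b M.rho = 1) (N : ℕ) (u : ℕ → ℝ)
    (u₁ : ℝ) (U U' δ : Fin s → ℝ) (μ : Fin d → ℝ) (hμ : ∀ j, x j = τ * μ j) :
    u₁ - u 0 - M.stageFun x (fun i => τ * (U' i - lam * (U i - u 0) - δ i)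
      + M.θ * M.rho i * τ ^ 2 * (u 2 - ∑ j, φ j
        + ∑ j, (φ j - δ' j - μ j * u 1) * M.partialAmpl x j)) =
    (u₁ - ∑ k ∈ Finset.range (N + 2), τ ^ k / k.factorial * u k)
      + ∑ k ∈ Finset.range N, τ ^ (k + 2) * u (k + 2) * (1 / (k + 2).factorial
        - M.stageFun x (fun i => M.c i ^ (k + 1) / (k + 1).factorial)
        + (∑ j, x j) * M.stageFun x (fun i => M.c i ^ (k + 2) / (k + 2).factorial))
      - M.θ * τ ^ 2 * M.stageFun x M.rho * (u 2 + ∑ j, (M.partialAmpl x j - 1) * φ j)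
      - τ * M.stageFun x (fun i => U' i
        - ∑ k ∈ Finset.range (N + 1), (M.c i * τ) ^ k / k.factorial * u (k + 1))
      + (∑ j, x j) * M.stageFun x (fun i => U i
        - ∑ k ∈ Finset.range (N + 2), (M.c i * τ) ^ k / k.factorial * u k)
      + τ * M.stageFun x δ
      + M.θ * τ ^ 2 * M.stageFun x M.rho * ∑ j, M.partialAmpl x j * δ' j := by
  set z := ∑ j, x j with hz
  set r₁ : Fin s → ℝ := fun i => U' i
        - ∑ k ∈ Finset.range (N + 1), (M.c i * τ) ^ k / k.factorial * u (k + 1) with hr₁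
  set r₂ : Fin s → ℝ := fun i => U i
        - ∑ k ∈ Finset.range (N + 2), (M.c i * τ) ^ k / k.factorial * u k with hr₂
  set y : ℕ → Fin s → ℝ := fun k i => M.c i ^ k / k.factorial with hy
  set S := u 2 + ∑ j, (M.partialAmpl x j - 1) * φ j - ∑ j, M.partialAmpl x j * δ' j with hS
  have hsumμ : M.θ * τ * ∑ j, μ j * M.partialAmpl x j = 1 - M.ampl x := by
    rw [← sum_mul_partialAmpl, mul_assoc, Finset.mul_sum]
    congr 1
    exact Finset.sum_congr rfl fun j _ => by rw [hμ]; ring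
  -- The first derivative collects to `τ u'` times `stageMatrix` applied to `ρ`, whose stage
  -- functional is `b·ρ = 1`. It thus cancels the first-order Taylor term of the exact solution.
  have hvec : (fun i => τ * (U' i - lam * (U i - u 0) - δ i)
      + M.θ * M.rho i * τ ^ 2 * (u 2 - ∑ j, φ j
        + ∑ j, (φ j - δ' j - μ j * u 1) * M.partialAmpl x j)) =
      τ • r₁ - z • r₂ - τ • δ + (M.θ * τ ^ 2 * S) • M.rho
        + (τ * u 1) • Matrix.mulVec (M.stageMatrix x) M.rho
        + ∑ k ∈ Finset.range N, (τ ^ (k + 2) * u (k + 2)) • (y (k + 1) - z • y (k + 2)) := by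
    funext i
    have e1 : U' i = r₁ i + u 1
        + ∑ k ∈ Finset.range N, (M.c i * τ) ^ (k + 1) / (k + 1).factorial * u (k + 2) := by
      simp only [hr₁]
      rw [Finset.sum_range_succ']
      simp; ring
    have e2 : U i = r₂ i + u 0 + M.c i * τ * u 1
        + ∑ k ∈ Finset.range N, (M.c i * τ) ^ (k + 2) / (k + 2).factorial * u (k + 2) := by
      simp only [hr₂]
      rw [Finset.sum_range_succ', Finset.sum_range_succ']
      simp; ring
    have e3 : u 2 - ∑ j, φ j + ∑ j, (φ j - δ' j - μ j * u 1) * M.partialAmpl x j =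
        S - (∑ j, μ j * M.partialAmpl x j) * u 1 := by
      simp only [hS, sub_mul, Finset.sum_sub_distrib, one_mul, Finset.sum_mul]
      have a1 : ∑ j, φ j * M.partialAmpl x j = ∑ j, M.partialAmpl x j * φ j :=
        Finset.sum_congr rfl fun j _ => mul_comm _ _
      have a2 : ∑ j, δ' j * M.partialAmpl x j = ∑ j, M.partialAmpl x j * δ' j :=
        Finset.sum_congr rfl fun j _ => mul_comm _ _
      have a3 : ∑ j, μ j * u 1 * M.partialAmpl x j = ∑ j, μ j * M.partialAmpl x j * u 1 :=
        Finset.sum_congr rfl fun j _ => by ring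
      rw [a1, a2, a3]; ring
    have e4 : (∑ k ∈ Finset.range N, (τ ^ (k + 2) * u (k + 2)) • (y (k + 1) - z • y (k + 2))) i =
        τ * ∑ k ∈ Finset.range N, (M.c i * τ) ^ (k + 1) / (k + 1).factorial * u (k + 2)
        - z * ∑ k ∈ Finset.range N, (M.c i * τ) ^ (k + 2) / (k + 2).factorial * u (k + 2) := by
      simp only [Finset.sum_apply, Pi.smul_apply, Pi.sub_apply, smul_eq_mul, hy, Finset.mul_sum,
        ← Finset.sum_sub_distrib]
      exact Finset.sum_congr rfl fun k _ => by rw [mul_pow, mul_pow]; ring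
    simp only [Pi.add_apply, Pi.sub_apply, Pi.smul_apply, smul_eq_mul]
    rw [e4, e3, stageMatrix_mulVec_rho, e2, ← hz, hlam]
    nth_rewrite 1 [e1]
    linear_combination (-(M.rho i * τ * u 1)) * hsumμ
  have e5 : ∑ k ∈ Finset.range (N + 2), τ ^ k / k.factorial * u k =
      u 0 + τ * u 1 + ∑ k ∈ Finset.range N, τ ^ (k + 2) / (k + 2).factorial * u (k + 2) := by
    rw [Finset.sum_range_succ', Finset.sum_range_succ']
    simp; ring
  have e6 : ∑ k ∈ Finset.range N, τ ^ (k + 2) * u (k + 2) * (1 / (k + 2).factorial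
        - M.stageFun x (y (k + 1)) + z * M.stageFun x (y (k + 2))) =
      ∑ k ∈ Finset.range N, τ ^ (k + 2) / (k + 2).factorial * u (k + 2)
      - ∑ k ∈ Finset.range N, (τ ^ (k + 2) * u (k + 2)) *
        (M.stageFun x (y (k + 1)) - z * M.stageFun x (y (k + 2))) := by
    rw [← Finset.sum_sub_distrib]
    exact Finset.sum_congr rfl fun k _ => by ring
  rw [hvec, e5]
  simp only [map_add, map_sub, map_smul, map_sum, smul_eq_mul, M.stageFun_mulVec x hamp, hb]
  rw [e6, hS]
  ring

end AMFWMethod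

/-- The solution at step `N` of `e_{m+1} = R e_m + X_m`, `e_0 = 0`. -/
def accum (R : ℝ) (X : ℕ → ℝ) : ℕ → ℝ
  | 0 => 0
  | N + 1 => R * accum R X N + X N

theorem accum_add (R : ℝ) (X Y : ℕ → ℝ) (N : ℕ) :
    accum R (fun m => X m + Y m) N = accum R X N + accum R Y N := by
  induction N with
  | zero => simp [accum]
  | succ N ih => simp only [accum, ih]; ring

theorem accum_sum {ι : Type*} (S : Finset ι) (R : ℝ) (X : ι → ℕ → ℝ) (N : ℕ) :
    accum R (fun m => ∑ a ∈ S, X a m) N = ∑ a ∈ S, accum R (X a) N := by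
  induction N with
  | zero => simp [accum]
  | succ N ih => simp only [accum, ih, Finset.mul_sum, Finset.sum_add_distrib]

theorem accum_congr {R : ℝ} {X Y : ℕ → ℝ} {N : ℕ} (h : ∀ m < N, X m = Y m) :
    accum R X N = accum R Y N := by
  induction N with
  | zero => rfl
  | succ N ih =>
    simp only [accum]
    rw [ih fun m hm => h m (hm.trans (Nat.lt_succ_self N)), h N (Nat.lt_succ_self N)]

theorem eq_accum {R : ℝ} {e X : ℕ → ℝ} {N : ℕ} (h0 : e 0 = 0)
    (h : ∀ m < N, e (m + 1) = R * e m + X m) : e N = accum R X N := by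
  induction N with
  | zero => exact h0
  | succ N ih =>
    rw [h N (Nat.lt_succ_self N), ih fun m hm => h m (hm.trans (Nat.lt_succ_self N))]
    rfl

theorem abs_accum_le {R : ℝ} (hR : |R| ≤ 1) {X : ℕ → ℝ} {Y : ℕ → ℝ} {N : ℕ}
    (h : ∀ m < N, |X m| ≤ Y m) : |accum R X N| ≤ ∑ m ∈ Finset.range N, Y m := by
  induction N with
  | zero => simp [accum]
  | succ N ih =>
    rw [Finset.sum_range_succ]
    simp only [accum]
    refine (abs_add_le _ _).trans (add_le_add ?_ (h N (Nat.lt_succ_self N)))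
    rw [abs_mul]
    have := ih fun m hm => h m (hm.trans (Nat.lt_succ_self N))
    nlinarith [abs_nonneg (accum R X N), abs_nonneg R]

theorem accum_mul_left (R Q : ℝ) (y : ℕ → ℝ) (N : ℕ) :
    accum R (fun m => Q * y m) N = Q * accum R y N := by
  induction N with
  | zero => simp [accum]
  | succ N ih => simp only [accum, ih]; ring

/-- Summation by parts in time. -/
theorem abs_one_sub_mul_accum_le {R : ℝ} (hR : |R| ≤ 1) {y : ℕ → ℝ} {Y V : ℝ} {N : ℕ}
    (hY : ∀ m ≤ N, |y m| ≤ Y) (hV : ∀ m < N, |y (m + 1) - y m| ≤ V) :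
    |(1 - R) * accum R y N| ≤ 2 * Y + N * V := by
  -- The difference `(1 - R) accum - y` obeys the same recursion with source `-(y_{q+1} - y_q)`, so
  -- only the variation of `y` accumulates.
  have key : ∀ q ≤ N, |(1 - R) * accum R y q - y q| ≤ Y + q * V := by
    intro q
    induction q with
    | zero => intro _; simpa [accum] using hY 0 (Nat.zero_le _)
    | succ q ih =>
      intro hq
      have h1 := ih (by omega)
      have h2 := hV q (by omega)
      have h3 : (1 - R) * accum R y (q + 1) - y (q + 1) =
          R * ((1 - R) * accum R y q - y q) - (y (q + 1) - y q) := by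
        simp only [accum]; ring
      rw [h3]
      refine (abs_sub _ _).trans ?_
      rw [abs_mul]
      push_cast
      nlinarith [abs_nonneg ((1 - R) * accum R y q - y q), abs_nonneg R]
  have h1 := key N le_rfl
  have h2 := hY N le_rfl
  have h3 := abs_add_le ((1 - R) * accum R y N - y N) (y N)
  rw [sub_add_cancel] at h3
  linarith

/-- The modes of the discretization errors `a_j (∂_jj - δ_jj) ∂_t^m u`. -/
def truncationCoeff {d : ℕ} (P : DiffusionProblem d)
    (D : ℕ → (Fin d → ℕ) → (Fin d → ℝ) → ℝ → ℝ) (n : Fin d → ℕ) (m : ℕ) (j : Fin d) (t : ℝ) :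
    GridFun n :=
  sineCoeff n (P.a j • gridRestrict n (fun x => D m (Pi.single j 2) x t)
      - P.a j • secondDiff n j (fun x => D m 0 x t))

/-- The modes of the derivatives of the solution. -/
def derivCoeff {d : ℕ} (D : ℕ → (Fin d → ℕ) → (Fin d → ℝ) → ℝ → ℝ) (n : Fin d → ℕ) (m : ℕ)
    (α : Fin d → ℕ) (t : ℝ) : GridFun n :=
  sineCoeff n (gridRestrict n fun x => D m α x t)

namespace SmoothSolution

variable {d s p : ℕ} {P : DiffusionProblem d} {D : ℕ → (Fin d → ℕ) → (Fin d → ℝ) → ℝ → ℝ}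

/-- The differential equation replaces the source, and the boundary identity replaces the Dirichlet
values, by derivatives of `u` and discretization errors. Everything is then expressed in modes of
`u`, and the step can be compared with the exact solution. -/
theorem sineCoeff_step (hD : SmoothSolution P p D) (hp : 1 ≤ p) (M : AMFWMethod s)
    (n : Fin d → ℕ) {τ t : ℝ} {v v' : GridFun n} (k : (l : Fin d) → Fin (n l))
    (hamp : M.ampl (fun j => τ * dirEigenvalue n (P.a j) j k) ≠ 0) (ht : t ∈ Icc 0 P.T)
    (hc : ∀ i, t + M.c i * τ ∈ Icc 0 P.T)
    (hstep : M.AMFWStep (Icc 0 P.T) (P.splitting n) t τ v v') :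
    derivCoeff D n 0 0 (t + τ) k - sineCoeff n v' k =
      M.stabilityFunction (fun j => τ * dirEigenvalue n (P.a j) j k)
        * (derivCoeff D n 0 0 t k - sineCoeff n v k)
      + (derivCoeff D n 0 0 (t + τ) k - derivCoeff D n 0 0 t k
        - M.stageFun (fun j => τ * dirEigenvalue n (P.a j) j k)
          (fun i => τ * (derivCoeff D n 1 0 (t + M.c i * τ) k
              - (∑ j, dirEigenvalue n (P.a j) j k)
                * (derivCoeff D n 0 0 (t + M.c i * τ) k - derivCoeff D n 0 0 t k)
              - ∑ j, truncationCoeff P D n 0 j (t + M.c i * τ) k)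
            + M.θ * M.rho i * τ ^ 2 * (derivCoeff D n 2 0 t k
              - ∑ j, P.a j * derivCoeff D n 1 (Pi.single j 2) t k
              + ∑ j, (P.a j * derivCoeff D n 1 (Pi.single j 2) t k - truncationCoeff P D n 1 j t k
                - dirEigenvalue n (P.a j) j k * derivCoeff D n 1 0 t k)
                * M.partialAmpl (fun j => τ * dirEigenvalue n (P.a j) j k) j))) := by
  obtain ⟨Q, hQ0, hQ, hv'⟩ := hstep
  set μ : Fin d → ℝ := fun j => dirEigenvalue n (P.a j) j k with hμ
  have hx : (fun j => τ * dirEigenvalue n (P.a j) j k) = τ • μ := rfl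
  rw [hx] at hamp ⊢
  have htrunc : ∀ m j t, P.a j * sineCoeff n (secondDiff n j fun x => D m 0 x t) k =
      P.a j * derivCoeff D n m (Pi.single j 2) t k - truncationCoeff P D n m j t k := by
    intro m j t
    simp only [truncationCoeff, derivCoeff, map_sub, map_smul, Pi.sub_apply, Pi.smul_apply,
      smul_eq_mul]
    ring
  have hr : ∀ t ∈ Icc 0 P.T, sineCoeff n (gridRestrict n fun x => P.r x t) k =
      derivCoeff D n 1 0 t k - ∑ j, P.a j * derivCoeff D n 0 (Pi.single j 2) t k := by
    intro t ht
    rw [hD.gridRestrict_r n ht]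
    simp only [map_sub, map_sum, map_smul, Pi.sub_apply, Finset.sum_apply, Pi.smul_apply,
      smul_eq_mul]
    rfl
  have hF : ∀ t ∈ Icc 0 P.T, ∀ j V, sineCoeff n (P.diffusionTerm n j t V) k =
      μ j * sineCoeff n V k + (P.a j * derivCoeff D n 0 (Pi.single j 2) t k
        - truncationCoeff P D n 0 j t k - μ j * derivCoeff D n 0 0 t k) := by
    intro t ht j V
    rw [diffusionTerm_eq, hD.diffusionTerm_zero n j ht]
    simp only [map_add, map_sub, map_smul, Pi.add_apply, Pi.sub_apply, Pi.smul_apply, smul_eq_mul,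
      sineCoeff_dirLaplacian, htrunc]
    rfl
  have hstep := M.scalar_step (lam := μ)
    (γ := fun j => P.a j * derivCoeff D n 1 (Pi.single j 2) t k - truncationCoeff P D n 1 j t k
                - μ j * derivCoeff D n 1 0 t k) (τ := τ) (v := sineCoeff n v k)
    (v' := sineCoeff n v' k)
    (γ₀ := derivCoeff D n 2 0 t k - ∑ j, P.a j * derivCoeff D n 1 (Pi.single j 2) t k)
    (G := fun i => derivCoeff D n 1 0 (t + M.c i * τ) k
      - (∑ j, μ j) * derivCoeff D n 0 0 (t + M.c i * τ) k
      - ∑ j, truncationCoeff P D n 0 j (t + M.c i * τ) k)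
    (q := fun i a => sineCoeff n (Q i a) k) hamp ?_ ?_ ?_ ?_
  · rw [hstep, AMFWMethod.stabilityFunction_eq]
    have hz : ∑ j, (τ • μ) j = τ * ∑ j, μ j := by simp [Finset.mul_sum]
    rw [hz]
    -- Subtracting the exact value at the current time uses `R = 1 + z · stageFun 1`: the multiple
    -- of the vector of ones is precisely what separates `R u` from `u`.
    have hvec : ∀ Y : Fin s → ℝ, (fun i => τ * (derivCoeff D n 1 0 (t + M.c i * τ) k
              - (∑ j, μ j) * (derivCoeff D n 0 0 (t + M.c i * τ) k - derivCoeff D n 0 0 t k)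
              - ∑ j, truncationCoeff P D n 0 j (t + M.c i * τ) k) + Y i) =
        (fun i => τ * (derivCoeff D n 1 0 (t + M.c i * τ) k
          - (∑ j, μ j) * derivCoeff D n 0 0 (t + M.c i * τ) k
          - ∑ j, truncationCoeff P D n 0 j (t + M.c i * τ) k) + Y i)
        + (τ * (∑ j, μ j) * derivCoeff D n 0 0 t k) • fun _ => 1 := by
      intro Y
      funext i
      simp only [Pi.add_apply, Pi.smul_apply, smul_eq_mul]
      ring
    rw [hvec, map_add, map_smul, smul_eq_mul]
    ring
  · intro i
    have h1 := congrFun (congrArg (sineCoeff n) (hQ0 i)) k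
    rw [Fin.sum_univ_succ] at h1
    simp only [DiffusionProblem.splitting, Fin.cases_zero, Fin.cases_succ, map_add, map_smul,
      map_sum, Pi.add_apply, Pi.smul_apply, Finset.sum_apply, smul_eq_mul] at h1
    rw [hr _ (hc i)] at h1
    simp only [hF _ (hc i), map_add, map_sum, map_smul, Pi.add_apply, Pi.smul_apply,
      Finset.sum_apply, smul_eq_mul] at h1
    rw [h1]
    simp only [Finset.sum_add_distrib, Finset.sum_sub_distrib, ← Finset.sum_mul]
    ring
  · intro i
    have h1 := congrFun (congrArg (sineCoeff n) (hQ i 0)) k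
    have hf : P.splitting n 0 t = fun _ => gridRestrict n fun x => P.r x t := rfl
    have hd : derivWithin (fun σ => P.splitting n 0 σ v) (Icc 0 P.T) t = _ :=
      (hD.hasDerivWithinAt_r hp n ht).derivWithin (uniqueDiffOn_Icc P.T_pos t ht)
    rw [hd, hf, fderiv_const_apply] at h1
    simp only [_root_.zero_apply, smul_zero, sub_zero, map_add, map_sub, map_smul,
      map_sum, Pi.add_apply, Pi.sub_apply, Pi.smul_apply, Finset.sum_apply, smul_eq_mul] at h1
    exact h1
  · intro i j
    have h1 := congrFun (congrArg (sineCoeff n) (hQ i j.succ)) k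
    have hf : HasFDerivAt (P.splitting n j.succ t)
        (LinearMap.toContinuousLinearMap (dirLaplacian n (P.a j) j)) v := by
      have : P.splitting n j.succ t =
          fun V => LinearMap.toContinuousLinearMap (dirLaplacian n (P.a j) j) V
            + P.diffusionTerm n j t 0 := by
        funext V
        exact diffusionTerm_eq n P j t V
      rw [this]
      exact (ContinuousLinearMap.hasFDerivAt _).add_const _
    have hd : derivWithin (fun σ => P.splitting n j.succ σ v) (Icc 0 P.T) t = _ :=
      (hD.hasDerivWithinAt_diffusionTerm n j v ht).derivWithin (uniqueDiffOn_Icc P.T_pos t ht)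
    rw [hd, hf.fderiv] at h1
    simp only [LinearMap.coe_toContinuousLinearMap', map_add, map_sub, map_smul,
      Pi.add_apply, Pi.sub_apply, Pi.smul_apply, smul_eq_mul, sineCoeff_dirLaplacian,
      htrunc] at h1
    exact h1
  · have h1 := congrFun (congrArg (sineCoeff n) hv') k
    simpa only [map_add, map_sum, map_smul, Pi.add_apply, Finset.sum_apply, Pi.smul_apply,
      smul_eq_mul] using h1

end SmoothSolution

/-! ### The error in a sine mode -/

namespace AMFWMethod

variable {s d : ℕ} (M : AMFWMethod s)

theorem partialAmpl_mem (hθ : 0 < M.θ) {x : Fin d → ℝ} (hx : ∀ j, x j < 0) (j : Fin d) :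
    1 ≤ M.partialAmpl x j ∧ M.partialAmpl x j ≤ M.ampl x := by
  have h : ∀ S : Finset (Fin d), 1 ≤ ∏ l ∈ S, (1 - M.θ * x l) := by
    intro S
    have h1 := one_add_sum_le_prod S (fun l => M.θ * -x l) fun l _ => by nlinarith [hx l]
    have h2 : 0 ≤ ∑ l ∈ S, M.θ * -x l := Finset.sum_nonneg fun l _ => by nlinarith [hx l]
    have h3 : ∏ l ∈ S, (1 - M.θ * x l) = ∏ l ∈ S, (1 + M.θ * -x l) :=
      Finset.prod_congr rfl fun l _ => by ring
    linarith
  refine ⟨h _, ?_⟩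
  rw [ampl, ← Finset.prod_filter_mul_prod_filter_not Finset.univ (fun l => l < j)]
  exact le_mul_of_one_le_right (le_trans zero_le_one (h _)) (h _)

theorem prod_sub_one_le {ι : Type*} (S : Finset ι) (y : ι → ℝ) (hy : ∀ i ∈ S, 0 ≤ y i) :
    ∏ i ∈ S, (1 + y i) - 1 ≤ (∑ i ∈ S, y i) * ∏ i ∈ S, (1 + y i) := by
  classical
  induction S using Finset.induction_on with
  | empty => simp
  | insert a S ha ih =>
    rw [Finset.sum_insert ha, Finset.prod_insert ha]
    have h1 := ih fun i hi => hy i (Finset.mem_insert_of_mem hi)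
    have h2 := hy a (Finset.mem_insert_self _ _)
    have h3 : 0 ≤ ∑ i ∈ S, y i :=
      Finset.sum_nonneg fun i hi => hy i (Finset.mem_insert_of_mem hi)
    have h4 : 0 ≤ ∏ i ∈ S, (1 + y i) :=
      Finset.prod_nonneg fun i hi => by have := hy i (Finset.mem_insert_of_mem hi); linarith
    nlinarith [mul_nonneg h3 h4, mul_nonneg h2 h4, mul_nonneg (mul_nonneg h2 h3) h4,
      mul_nonneg (mul_nonneg h2 h2) h4]

/-- The part of the local error in a mode that has to be summed by parts in time. -/
def mainSource (x φ : Fin d → ℝ) (τ : ℝ) (N : ℕ) (u : ℕ → ℝ) : ℝ :=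
  ∑ k ∈ Finset.range N, τ ^ (k + 2) * u (k + 2) * (1 / (k + 2).factorial
        - M.stageFun x (fun i => M.c i ^ (k + 1) / (k + 1).factorial)
        + (∑ j, x j) * M.stageFun x (fun i => M.c i ^ (k + 2) / (k + 2).factorial))
      - M.θ * τ ^ 2 * M.stageFun x M.rho * (u 2 + ∑ j, (M.partialAmpl x j - 1) * φ j)

end AMFWMethod

/-- The arguments of the symbols in the mode `k` for the step size `τ`. -/
def modeArg {d : ℕ} (P : DiffusionProblem d) (n : Fin d → ℕ) (τ : ℝ) (k : (l : Fin d) → Fin (n l)) :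
    Fin d → ℝ := fun j => τ * dirEigenvalue n (P.a j) j k

theorem modeArg_neg {d : ℕ} (P : DiffusionProblem d) (n : Fin d → ℕ) {τ : ℝ} (hτ : 0 < τ)
    (k : (l : Fin d) → Fin (n l)) (j : Fin d) : modeArg P n τ k j < 0 :=
  mul_neg_of_pos_of_neg hτ (dirEigenvalue_neg n (P.a_pos j) j k)

/-- The weight `∏ 1 / k_l` of a mode. -/
def modeWeight {d : ℕ} {n : Fin d → ℕ} (k : (l : Fin d) → Fin (n l)) : ℝ :=
  ∏ l, 1 / ((k l : ℕ) + 1 : ℝ)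

theorem modeWeight_pos {d : ℕ} {n : Fin d → ℕ} (k : (l : Fin d) → Fin (n l)) : 0 < modeWeight k :=
  Finset.prod_pos fun _ _ => by positivity

theorem prod_three_div {d : ℕ} {n : Fin d → ℕ} (k : (l : Fin d) → Fin (n l)) :
    ∏ l, 3 / ((k l : ℕ) + 1 : ℝ) = 3 ^ d * modeWeight k := by
  rw [modeWeight, ← Fin.prod_const, ← Finset.prod_mul_distrib]
  exact Finset.prod_congr rfl fun l _ => by ring

namespace SmoothSolution

variable {d s p : ℕ} {P : DiffusionProblem d} {D : ℕ → (Fin d → ℕ) → (Fin d → ℝ) → ℝ → ℝ}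

theorem hasDerivWithinAt_derivCoeff (hD : SmoothSolution P p D) (n : Fin d → ℕ) {m : ℕ}
    (hm : m < p + 1) {α : Fin d → ℕ} (hα : ∀ j, α j ≤ 4) {t : ℝ} (ht : t ∈ Icc 0 P.T)
    (k : (l : Fin d) → Fin (n l)) :
    HasDerivWithinAt (fun σ => derivCoeff D n m α σ k) (derivCoeff D n (m + 1) α t k)
      (Icc 0 P.T) t := by
  have h := (LinearMap.toContinuousLinearMap (sineCoeff n)).hasFDerivAt.comp_hasDerivWithinAt t
    (hD.hasDerivWithinAt_gridRestrict n hm hα ht)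
  exact (hasDerivWithinAt_pi.1 h) k

theorem isDerivChain_derivCoeff (hD : SmoothSolution P p D) (n : Fin d → ℕ)
    (k : (l : Fin d) → Fin (n l)) :
    IsDerivChain 0 P.T (p + 1) (fun m t => derivCoeff D n m 0 t k) := fun _ hm _ ht =>
  hD.hasDerivWithinAt_derivCoeff n hm (fun _ => by simp) ht k

/-- Because `|R| ≤ 1`, Taylor remainders and discretization errors may simply be added over at most
`T/τ` steps. Only the main source is kept under the recursion, since adding it up in this way would
cost a power of `τ`. The expansion length `N₀` is 0, 1 or `p - 1` in the applications. -/
theorem exists_mode_error_le (hD : SmoothSolution P p D) (hp : 1 ≤ p) (M : AMFWMethod s)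
    (hθ : 0 < M.θ) (hb : dotProduct M.b M.rho = 1) (N₀ : ℕ) (hN₀ : N₀ + 1 ≤ p) :
    ∃ C > 0, ∀ (n : Fin d → ℕ) (τ : ℝ), 0 < τ → ∀ (N : ℕ) (V : ℕ → GridFun n),
      P.IsAMFWSolution M n τ N V → ∀ k : (l : Fin d) → Fin (n l),
      |M.stabilityFunction (modeArg P n τ k)| ≤ 1 →
      |derivCoeff D n 0 0 (N * τ) k - sineCoeff n (V N) k| ≤
        |accum (M.stabilityFunction (modeArg P n τ k)) (fun m => M.mainSource (modeArg P n τ k)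
          (fun j => P.a j * derivCoeff D n 1 (Pi.single j 2) (m * τ) k) τ N₀
          (fun q => derivCoeff D n q 0 (m * τ) k)) N|
        + C * τ ^ (N₀ + 1) * modeWeight k
        + C * ∑ m ∈ Finset.range N, τ * (∑ i, ∑ j, |truncationCoeff P D n 0 j (m * τ + M.c i * τ) k|
          + τ * |M.stageFun (modeArg P n τ k) M.rho *
            ∑ j, M.partialAmpl (modeArg P n τ k) j * truncationCoeff P D n 1 j (m * τ) k|) := by
  obtain ⟨B, hB0, hB⟩ := hD.exists_bound
  obtain ⟨C, hC0, hC⟩ := M.exists_stageFun_le (d := d) hθ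
  have hT := P.T_pos
  set cm : ℝ := ∑ i, |M.c i| with hcm
  have hcm0 : 0 ≤ cm := Finset.sum_nonneg fun _ _ => abs_nonneg _
  set C₁ : ℝ := P.T * (3 ^ d * B) * (1 + C * cm ^ (N₀ + 1) + C * cm ^ (N₀ + 2)) with hC₁
  refine ⟨C₁ + C + M.θ, by positivity, fun n τ hτ N V hV k hR => ?_⟩
  set x := modeArg P n τ k with hx
  have hxneg : ∀ j, x j < 0 := modeArg_neg P n hτ k
  have hamp := (M.ampl_pos hθ hxneg).ne'
  set R := M.stabilityFunction x with hRdef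
  set u : ℕ → ℝ → ℝ := fun q t => derivCoeff D n q 0 t k with hu
  set K : ℝ := 3 ^ d * modeWeight k * B with hK
  have hK0 : 0 ≤ K := by have := modeWeight_pos k; positivity
  have hub : ∀ q ≤ p + 1, ∀ t ∈ Icc 0 P.T, |u q t| ≤ K := by
    intro q hq t ht
    rw [hK, ← prod_three_div]
    exact hD.abs_sineCoeff_le hB n hq (fun _ => by simp) ht k
  have htm : ∀ m ≤ N, (m : ℝ) * τ ∈ Icc 0 P.T := by
    intro m hm
    refine ⟨by positivity, le_trans ?_ hV.final⟩
    have : (m : ℝ) ≤ N := by exact_mod_cast hm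
    nlinarith
  set main : ℕ → ℝ := fun m => M.mainSource x
          (fun j => P.a j * derivCoeff D n 1 (Pi.single j 2) (m * τ) k) τ N₀
          (fun q => derivCoeff D n q 0 (m * τ) k) with hmain
  set r₁ : ℕ → Fin s → ℝ := fun m i => u 1 (m * τ + M.c i * τ)
        - ∑ q ∈ Finset.range (N₀ + 1), (M.c i * τ) ^ q / q.factorial * u (q + 1) (m * τ) with hr₁
  set r₂ : ℕ → Fin s → ℝ := fun m i => u 0 (m * τ + M.c i * τ)
        - ∑ q ∈ Finset.range (N₀ + 2), (M.c i * τ) ^ q / q.factorial * u q (m * τ) with hr₂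
  set rem : ℕ → ℝ := fun m => (u 0 (m * τ + τ)
      - ∑ q ∈ Finset.range (N₀ + 2), τ ^ q / q.factorial * u q (m * τ))
      - τ * M.stageFun x (r₁ m) + (∑ j, x j) * M.stageFun x (r₂ m) with hrem
  set δ : ℕ → Fin s → ℝ := fun m i => ∑ j, truncationCoeff P D n 0 j (m * τ + M.c i * τ) k with hδ
  set trunc : ℕ → ℝ := fun m => τ * M.stageFun x (δ m)
      + M.θ * τ ^ 2 * M.stageFun x M.rho *
        ∑ j, M.partialAmpl x j * truncationCoeff P D n 1 j (m * τ) k with htrunc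
  -- The initial error vanishes, so the mode of the error is exactly the accumulated local error.
  have hrec : u 0 (N * τ) - sineCoeff n (V N) k =
      accum R (fun m => main m + (rem m + trunc m)) N := by
    refine eq_accum (e := fun m => u 0 (m * τ) - sineCoeff n (V m) k) ?_ fun m hm => ?_
    · simp only [hu, derivCoeff, Nat.cast_zero, zero_mul]
      rw [hV.init, sub_eq_zero]
      refine congrFun (congrArg (sineCoeff n) (funext fun i => ?_)) k
      exact (hD.ic _ (gridNode_mem_unitCube n i)).symm
    · have h1 := hD.sineCoeff_step hp M n k hamp (htm m hm.le) (hV.nodes m hm) (hV.step m hm)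
      have h2 := M.local_error_eq (x := x)
        (φ := fun j => P.a j * derivCoeff D n 1 (Pi.single j 2) (m * τ) k)
        (δ' := fun j => truncationCoeff P D n 1 j (m * τ) k) (τ := τ)
        (lam := ∑ j, dirEigenvalue n (P.a j) j k) hamp (by rw [Finset.mul_sum]; rfl) hb N₀
        (fun q => u q (m * τ)) (u 0 (m * τ + τ)) (fun i => u 0 (m * τ + M.c i * τ))
        (fun i => u 1 (m * τ + M.c i * τ)) (δ m) (fun j => dirEigenvalue n (P.a j) j k)
        (fun j => rfl)
      have h3 : ((m + 1 : ℕ) : ℝ) * τ = m * τ + τ := by push_cast; ring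
      simp only [h3]
      refine h1.trans ?_
      congr 1
      refine h2.trans ?_
      simp only [hmain, hrem, htrunc, AMFWMethod.mainSource, hr₁, hr₂, hu]
      ring
  have hchain := hD.isDerivChain_derivCoeff n k
  have hremb : ∀ m < N, |rem m| ≤
      τ * (K * (1 + C * cm ^ (N₀ + 1) + C * cm ^ (N₀ + 2)) * τ ^ (N₀ + 1)) := by
    intro m hm
    have ht := htm m hm.le
    have ht1 : (m : ℝ) * τ + τ ∈ Icc 0 P.T := by
      have := htm (m + 1) hm
      push_cast at this
      rwa [add_mul, one_mul] at this
    have hcb : ∀ i, |M.c i| ≤ cm := fun i =>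
      Finset.single_le_sum (f := fun i => |M.c i|) (fun _ _ => abs_nonneg _) (Finset.mem_univ i)
    have h0 := (hchain.mono (by omega : N₀ + 2 ≤ p + 1)).taylor (fun t ht => hub (N₀ + 2) (by omega) t ht)
      ht ht1
    rw [add_sub_cancel_left, abs_of_pos hτ] at h0
    have h1 : ∀ i, |r₁ m i| ≤ K * (cm * τ) ^ (N₀ + 1) := by
      intro i
      have h := (IsDerivChain.shift (m := 1) (hchain.mono (by omega : N₀ + 1 + 1 ≤ p + 1))).taylor
        (fun t ht => hub (N₀ + 1 + 1) (by omega) t ht) ht (hV.nodes m hm i)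
      rw [add_sub_cancel_left] at h
      refine h.trans (mul_le_mul_of_nonneg_left (pow_le_pow_left₀ (abs_nonneg _) ?_ _) hK0)
      rw [abs_mul, abs_of_pos hτ]
      exact mul_le_mul_of_nonneg_right (hcb i) hτ.le
    have h2 : ∀ i, |r₂ m i| ≤ K * (cm * τ) ^ (N₀ + 2) := by
      intro i
      have h := (hchain.mono (by omega : N₀ + 2 ≤ p + 1)).taylor
        (fun t ht => hub (N₀ + 2) (by omega) t ht) ht (hV.nodes m hm i)
      rw [add_sub_cancel_left] at h
      refine h.trans (mul_le_mul_of_nonneg_left (pow_le_pow_left₀ (abs_nonneg _) ?_ _) hK0)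
      rw [abs_mul, abs_of_pos hτ]
      exact mul_le_mul_of_nonneg_right (hcb i) hτ.le
    have h3 := (hC x hxneg (r₁ m) _ (by positivity) h1).2.1
    have h4 := (hC x hxneg (r₂ m) _ (by positivity) h2).2.2
    have h5 : |τ * M.stageFun x (r₁ m)| ≤ τ * (C * (K * (cm * τ) ^ (N₀ + 1))) := by
      rw [abs_mul, abs_of_pos hτ]
      exact mul_le_mul_of_nonneg_left h3 hτ.le
    refine (abs_add_le _ _).trans ((add_le_add ((abs_sub _ _).trans (add_le_add h0 h5)) h4).trans
      (le_of_eq ?_))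
    rw [mul_pow, mul_pow]
    ring
  have htruncb : ∀ m < N, |trunc m| ≤ (C + M.θ) * (τ *
      (∑ i, ∑ j, |truncationCoeff P D n 0 j (m * τ + M.c i * τ) k|
          + τ * |M.stageFun x M.rho *
            ∑ j, M.partialAmpl x j * truncationCoeff P D n 1 j (m * τ) k|)) := by
    intro m hm
    set A := ∑ i, ∑ j, |truncationCoeff P D n 0 j (m * τ + M.c i * τ) k| with hA
    have hA0 : 0 ≤ A := Finset.sum_nonneg fun _ _ => Finset.sum_nonneg fun _ _ => abs_nonneg _
    have h1 : ∀ i, |δ m i| ≤ A := fun i =>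
      (Finset.abs_sum_le_sum_abs _ _).trans (Finset.single_le_sum
        (f := fun i => ∑ j, |truncationCoeff P D n 0 j (m * τ + M.c i * τ) k|)
        (fun _ _ => Finset.sum_nonneg fun _ _ => abs_nonneg _) (Finset.mem_univ i))
    have h2 := (hC x hxneg (δ m) _ hA0 h1).2.1
    refine (abs_add_le _ _).trans ?_
    rw [abs_mul, abs_of_pos hτ, mul_assoc (M.θ * τ ^ 2), abs_mul (M.θ * τ ^ 2),
      abs_of_pos (by positivity : 0 < M.θ * τ ^ 2)]
    set E := |M.stageFun x M.rho * ∑ j, M.partialAmpl x j * truncationCoeff P D n 1 j (m * τ) k|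
    have hE : 0 ≤ E := abs_nonneg _
    have e1 : τ * |M.stageFun x (δ m)| ≤ τ * (C * A) := mul_le_mul_of_nonneg_left h2 hτ.le
    have e2 : 0 ≤ M.θ * (τ * A) := by positivity
    have e3 : 0 ≤ C * (τ * (τ * E)) := by positivity
    nlinarith
  rw [show derivCoeff D n 0 0 (N * τ) k = u 0 (N * τ) from rfl, hrec, accum_add, accum_add]
  have hr := abs_accum_le hR hremb
  have ht := abs_accum_le hR htruncb
  rw [Finset.sum_const, Finset.card_range, nsmul_eq_mul] at hr
  rw [← Finset.mul_sum] at ht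
  set Z := ∑ m ∈ Finset.range N, τ * (∑ i, ∑ j, |truncationCoeff P D n 0 j (m * τ + M.c i * τ) k|
          + τ * |M.stageFun x M.rho *
            ∑ j, M.partialAmpl x j * truncationCoeff P D n 1 j (m * τ) k|) with hZ
  have hZ0 : 0 ≤ Z := Finset.sum_nonneg fun m _ => mul_nonneg hτ.le (add_nonneg
    (Finset.sum_nonneg fun _ _ => Finset.sum_nonneg fun _ _ => abs_nonneg _) (by positivity))
  have hr' : |accum R rem N| ≤ (C₁ + C + M.θ) * τ ^ (N₀ + 1) * modeWeight k := by
    have hw := modeWeight_pos k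
    have h1 : (N : ℝ) * (τ * (K * (1 + C * cm ^ (N₀ + 1) + C * cm ^ (N₀ + 2)) * τ ^ (N₀ + 1))) ≤
        P.T * (K * (1 + C * cm ^ (N₀ + 1) + C * cm ^ (N₀ + 2)) * τ ^ (N₀ + 1)) := by
      rw [← mul_assoc]
      exact mul_le_mul_of_nonneg_right hV.final (by positivity)
    have h2 : P.T * (K * (1 + C * cm ^ (N₀ + 1) + C * cm ^ (N₀ + 2)) * τ ^ (N₀ + 1)) =
        C₁ * (τ ^ (N₀ + 1) * modeWeight k) := by rw [hC₁, hK]; ring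
    have h3 : 0 ≤ (C + M.θ) * (τ ^ (N₀ + 1) * modeWeight k) := by positivity
    calc |accum R rem N| ≤ C₁ * (τ ^ (N₀ + 1) * modeWeight k) := by linarith
      _ ≤ C₁ * (τ ^ (N₀ + 1) * modeWeight k) + (C + M.θ) * (τ ^ (N₀ + 1) * modeWeight k) := by
        linarith
      _ = _ := by ring
  have ht' : |accum R trunc N| ≤ (C₁ + C + M.θ) * Z := by
    have : 0 ≤ C₁ * Z := by positivity
    linarith
  refine (abs_add_le _ _).trans ?_
  have := abs_add_le (accum R rem N) (accum R trunc N)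
  linarith

end SmoothSolution

/-! ### Bounds for the main part of the error in a mode -/

namespace AMFWMethod

variable {s d : ℕ} (M : AMFWMethod s)

/-- The stage functional of `ρ` is `O(1/Π)`, while a partial product is at most `Π` and exceeds 1 by
at most `θ w Π`. -/
theorem exists_stageFun_rho_mul_partialAmpl_le (hθ : 0 < M.θ) :
    ∃ C > 0, ∀ x : Fin d → ℝ, (∀ j, x j < 0) → ∀ j,
      |M.stageFun x M.rho * (M.partialAmpl x j - 1)| ≤ C * min 1 (∑ j, -x j) ∧
      |M.stageFun x M.rho * M.partialAmpl x j| ≤ C := by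
  obtain ⟨C, hC, h⟩ := M.exists_stageFun_le (d := d) hθ
  set K := C * ∑ i, |M.rho i| with hK
  have hK0 : 0 ≤ K := mul_nonneg hC.le (Finset.sum_nonneg fun _ _ => abs_nonneg _)
  refine ⟨K * (1 + M.θ) + 1, by positivity, fun x hx j => ?_⟩
  have h1 := (h x hx M.rho _ (Finset.sum_nonneg fun _ _ => abs_nonneg _)
    (fun i => Finset.single_le_sum (f := fun i => |M.rho i|) (fun _ _ => abs_nonneg _)
      (Finset.mem_univ i))).1
  rw [← hK] at h1
  obtain ⟨h2, h3⟩ := M.partialAmpl_mem hθ hx j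
  have hw : 0 ≤ ∑ j, -x j := Finset.sum_nonneg fun j _ => by linarith [hx j]
  have h4 : M.partialAmpl x j - 1 ≤ M.θ * (∑ j, -x j) * M.ampl x := by
    have e1 : M.partialAmpl x j = ∏ l ∈ Finset.univ with l < j, (1 + M.θ * -x l) :=
      Finset.prod_congr rfl fun l _ => by ring
    have e2 := prod_sub_one_le (Finset.univ.filter (· < j)) (fun l => M.θ * -x l)
      fun l _ => by nlinarith [hx l]
    have e3 : ∑ l ∈ Finset.univ with l < j, M.θ * -x l ≤ M.θ * ∑ j, -x j := by
      rw [Finset.mul_sum]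
      exact Finset.sum_le_sum_of_subset_of_nonneg (Finset.filter_subset _ _)
        fun l _ _ => by nlinarith [hx l]
    rw [← e1] at e2
    exact e2.trans (mul_le_mul e3 h3 (by linarith) (by positivity))
  have hS := abs_nonneg (M.stageFun x M.rho)
  rw [abs_mul, abs_mul, abs_of_nonneg (by linarith : 0 ≤ M.partialAmpl x j - 1),
    abs_of_nonneg (by linarith : 0 ≤ M.partialAmpl x j)]
  have h5 : 0 ≤ K * M.θ := by positivity
  constructor
  · rcases le_total 1 (∑ j, -x j) with hc | hc
    · rw [min_eq_left hc]
      nlinarith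
    · rw [min_eq_right hc]
      have : |M.stageFun x M.rho| * (M.partialAmpl x j - 1) ≤ M.θ * (∑ j, -x j) * K := by
        calc _ ≤ |M.stageFun x M.rho| * (M.θ * (∑ j, -x j) * M.ampl x) :=
              mul_le_mul_of_nonneg_left h4 hS
          _ = M.θ * (∑ j, -x j) * (M.ampl x * |M.stageFun x M.rho|) := by ring
          _ ≤ _ := mul_le_mul_of_nonneg_left h1 (by positivity)
      nlinarith [mul_nonneg hK0 hw]
  · nlinarith

/-- The symbol of index two contains the term `-θ · stageFun ρ` of the time-derivative correction,
so it absorbs the separate multiple of `u 2`. At least one Taylor term is needed for this, hence `N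
+ 1`. -/
theorem mainSource_eq (x φ : Fin d → ℝ) (τ : ℝ) (N : ℕ) (u : ℕ → ℝ) :
    M.mainSource x φ τ (N + 1) u =
      ∑ k ∈ Finset.range (N + 1), τ ^ (k + 2) * u (k + 2) * M.taylorSymbol (k + 2) x
        - M.θ * τ ^ 2 * M.stageFun x M.rho * ∑ j, (M.partialAmpl x j - 1) * φ j := by
  have h : ∀ k, M.taylorSymbol (k + 2) x = 1 / (k + 2).factorial
        - M.stageFun x (fun i => M.c i ^ (k + 1) / (k + 1).factorial)
        + (∑ j, x j) * M.stageFun x (fun i => M.c i ^ (k + 2) / (k + 2).factorial)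
        - if k = 0 then M.θ * M.stageFun x M.rho else 0 := by
    intro k
    have h1 : (fun i => M.c i ^ (k + 1) / ((k + 1).factorial : ℝ)
        + if k = 0 then M.θ * M.rho i else 0) =
        (fun i => M.c i ^ (k + 1) / ((k + 1).factorial : ℝ)) +
          (if k = 0 then M.θ else 0) • M.rho := by
      funext i
      by_cases hk : k = 0 <;> simp [hk]
    simp only [taylorSymbol, show k + 2 - 1 = k + 1 by omega, show (k + 2 = 2) = (k = 0) by simp, show (k + 2 = 1) = False by simp, if_false, add_zero]
    rw [h1, map_add, map_smul]
    by_cases hk : k = 0 <;> simp [hk] <;> ring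
  have hsum : ∑ k ∈ Finset.range (N + 1), τ ^ (k + 2) * u (k + 2) *
      (if k = 0 then M.θ * M.stageFun x M.rho else 0) =
      τ ^ 2 * u 2 * (M.θ * M.stageFun x M.rho) := by
    rw [Finset.sum_range_succ']
    simp
  have hsub : ∀ k, τ ^ (k + 2) * u (k + 2) * M.taylorSymbol (k + 2) x =
      τ ^ (k + 2) * u (k + 2) * (1 / (k + 2).factorial
        - M.stageFun x (fun i => M.c i ^ (k + 1) / (k + 1).factorial)
        + (∑ j, x j) * M.stageFun x (fun i => M.c i ^ (k + 2) / (k + 2).factorial))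
      - τ ^ (k + 2) * u (k + 2) * (if k = 0 then M.θ * M.stageFun x M.rho else 0) := fun k => by
    rw [h, mul_sub]
  rw [Finset.sum_congr rfl fun k _ => hsub k, Finset.sum_sub_distrib, hsum, mainSource]
  ring

/-- The quantitative use of the upper stability bound: `1 - R` is at least `C w / Π`, which is the
divisor in the summation by parts. -/
theorem ampl_mul_one_sub_ge {C : ℝ} {x : Fin d → ℝ} (hθ : 0 < M.θ) (hx : ∀ j, x j < 0)
    (h : M.stabilityFunction x ≤ 1 + C * ((∑ j, x j) / ∏ j, (1 - M.θ * x j))) :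
    C * ∑ j, -x j ≤ M.ampl x * (1 - M.stabilityFunction x) := by
  have hA := M.ampl_pos hθ hx
  change _ ≤ 1 + C * ((∑ j, x j) / M.ampl x) at h
  have h1 : M.ampl x * (1 + C * ((∑ j, x j) / M.ampl x)) = M.ampl x + C * ∑ j, x j := by
    field_simp
  rw [Finset.sum_neg_distrib]
  nlinarith [mul_le_mul_of_nonneg_left h hA.le]

end AMFWMethod

namespace SmoothSolution

variable {d s p : ℕ} {P : DiffusionProblem d} {D : ℕ → (Fin d → ℕ) → (Fin d → ℝ) → ℝ → ℝ}

/-- The first bound counts steps, the second one sums by parts, where `N` increments of size `K τ`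
add up to at most `T K`. The second is better when `1 - R` is not small. -/
theorem abs_accum_derivCoeff_le (hD : SmoothSolution P p D) (n : Fin d → ℕ) {q : ℕ}
    (hq : q < p + 1) {α : Fin d → ℕ} (hα : ∀ j, α j ≤ 4) (k : (l : Fin d) → Fin (n l)) {K : ℝ}
    (h0 : ∀ t ∈ Icc 0 P.T, |derivCoeff D n q α t k| ≤ K)
    (h1 : ∀ t ∈ Icc 0 P.T, |derivCoeff D n (q + 1) α t k| ≤ K) {τ R : ℝ} (hτ : 0 < τ) {N : ℕ}
    (hN : N * τ ≤ P.T) (hR : |R| ≤ 1) :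
    |accum R (fun m => derivCoeff D n q α (m * τ) k) N| ≤ N * K ∧
    (1 - R) * |accum R (fun m => derivCoeff D n q α (m * τ) k) N| ≤ (2 + P.T) * K := by
  have htm : ∀ m ≤ N, (m : ℝ) * τ ∈ Icc 0 P.T := fun m hm =>
    ⟨by positivity, le_trans (mul_le_mul_of_nonneg_right (by exact_mod_cast hm) hτ.le) hN⟩
  have hK : 0 ≤ K := (abs_nonneg _).trans (h0 0 ⟨le_rfl, P.T_pos.le⟩)
  constructor
  · refine (abs_accum_le hR fun m hm => h0 _ (htm m hm.le)).trans ?_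
    simp
  · have hchain : IsDerivChain 0 P.T 1 (fun m t => derivCoeff D n (q + m) α t k) := by
      intro i hi t ht
      obtain rfl : i = 0 := by omega
      exact hD.hasDerivWithinAt_derivCoeff n hq hα ht k
    have h := abs_one_sub_mul_accum_le hR (y := fun m => derivCoeff D n q α (m * τ) k) (Y := K)
      (V := K * τ) (N := N) (fun m hm => h0 _ (htm m hm)) fun m hm => by
        have := hchain.abs_sub_le h1 (htm m hm.le) (htm (m + 1) hm)
        refine this.trans (le_of_eq ?_)
        push_cast
        rw [show ((m : ℝ) + 1) * τ - m * τ = τ by ring, abs_of_pos hτ]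
    rw [abs_mul, abs_of_nonneg (by linarith [le_abs_self R])] at h
    refine h.trans ?_
    nlinarith [mul_le_mul_of_nonneg_right hN hK]

end SmoothSolution

/-- Both bounds of the accumulated sum are kept: division by `1 - R ≥ C₀ w / A` gives the one with
`A / w`, which is useless in modes where `A` is large, and there the number of steps takes over. -/
theorem min_mul_le_min {w A C₀ R a K T N : ℝ} (hw : 0 < w) (hC₀ : 0 < C₀)
    (h : C₀ * w ≤ A * (1 - R)) (ha : 0 ≤ a) (hK : 0 ≤ K) (hA : 0 ≤ A) (hN : 0 ≤ N)
    (hT : 0 ≤ T) (h1 : a ≤ N * K) (h2 : (1 - R) * a ≤ (2 + T) * K) :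
    min 1 w * a ≤ (1 + (2 + T) / C₀) * K * min N (min 1 w * A / w) := by
  have hm : 0 < min 1 w := lt_min one_pos hw
  have hq : 0 ≤ (2 + T) / C₀ := by positivity
  rw [mul_min_of_nonneg _ _ (by positivity)]
  refine le_min ?_ ?_
  · have h3 : min 1 w * a ≤ 1 * a := mul_le_mul_of_nonneg_right (min_le_left _ _) ha
    have h4 : 0 ≤ (2 + T) / C₀ * (N * K) := by positivity
    linarith
  · have h3 : w * a ≤ (2 + T) / C₀ * K * A := by
      have e1 : C₀ * (w * a) ≤ (2 + T) * K * A := by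
        nlinarith [mul_le_mul_of_nonneg_right h ha, mul_le_mul_of_nonneg_left h2 hA]
      have e2 : (2 + T) / C₀ * K * A = (2 + T) * K * A / C₀ := by ring
      rw [e2, le_div_iff₀ hC₀]
      linarith
    have h4 : a ≤ (1 + (2 + T) / C₀) * K * (A / w) := by
      rw [mul_div_assoc', le_div_iff₀ hw]
      have : 0 ≤ K * A := by positivity
      nlinarith
    calc min 1 w * a ≤ min 1 w * ((1 + (2 + T) / C₀) * K * (A / w)) :=
          mul_le_mul_of_nonneg_left h4 hm.le
      _ = _ := by ring

theorem sum_neg_modeArg_pos {d : ℕ} (hd : 1 ≤ d) (P : DiffusionProblem d) (n : Fin d → ℕ) {τ : ℝ}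
    (hτ : 0 < τ) (k : (l : Fin d) → Fin (n l)) : 0 < ∑ j, -modeArg P n τ k j := by
  have : NeZero d := ⟨by omega⟩
  exact Finset.sum_pos (fun j _ => neg_pos.2 (modeArg_neg P n hτ k j)) Finset.univ_nonempty

namespace SmoothSolution

variable {d s p : ℕ} {P : DiffusionProblem d} {D : ℕ → (Fin d → ℕ) → (Fin d → ℝ) → ℝ → ℝ}

/-- Here no cancellation is needed: the source is `O(τ²)` and there are at most `T/τ` steps. -/
theorem exists_accum_mainSource_zero_le (hD : SmoothSolution P p D) (hp : 1 ≤ p)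
    (M : AMFWMethod s) (hθ : 0 < M.θ) :
    ∃ C > 0, ∀ (n : Fin d → ℕ) (τ : ℝ), 0 < τ → ∀ N : ℕ, N * τ ≤ P.T →
      ∀ (k : (l : Fin d) → Fin (n l)) (R : ℝ), |R| ≤ 1 →
      |accum R (fun m => M.mainSource (modeArg P n τ k)
          (fun j => P.a j * derivCoeff D n 1 (Pi.single j 2) (m * τ) k) τ 0
          (fun q => derivCoeff D n q 0 (m * τ) k)) N| ≤ C * τ * modeWeight k := by
  obtain ⟨B, hB0, hB⟩ := hD.exists_bound
  obtain ⟨C, hC0, hC⟩ := M.exists_stageFun_le (d := d) hθ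
  obtain ⟨C', hC0', hC'⟩ := M.exists_stageFun_rho_mul_partialAmpl_le (d := d) hθ
  have hT := P.T_pos
  set S := ∑ i, |M.rho i|
  have hS : 0 ≤ S := Finset.sum_nonneg fun _ _ => abs_nonneg _
  set a := ∑ j, P.a j
  have ha : 0 ≤ a := Finset.sum_nonneg fun j _ => (P.a_pos j).le
  refine ⟨P.T * M.θ * (C * S + C' * a) * (3 ^ d * B) + 1, by positivity,
    fun n τ hτ N hN k R hR => ?_⟩
  set x := modeArg P n τ k with hx
  have hxneg : ∀ j, x j < 0 := modeArg_neg P n hτ k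
  have hw := modeWeight_pos k
  set K : ℝ := 3 ^ d * modeWeight k * B with hK
  have hK0 : 0 ≤ K := by positivity
  have hbd : ∀ q ≤ 2, ∀ α : Fin d → ℕ, (∀ j, α j ≤ 3) → ∀ t ∈ Icc 0 P.T,
      |derivCoeff D n q α t k| ≤ K := by
    intro q hq α hα t ht
    rw [hK, ← prod_three_div]
    exact hD.abs_sineCoeff_le hB n (by omega) hα ht k
  have hmain : ∀ m < N, |M.mainSource x
          (fun j => P.a j * derivCoeff D n 1 (Pi.single j 2) (m * τ) k) τ 0
          (fun q => derivCoeff D n q 0 (m * τ) k)| ≤ M.θ * τ ^ 2 * ((C * S + C' * a) * K) := by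
    intro m hm
    have ht : (m : ℝ) * τ ∈ Icc 0 P.T := ⟨by positivity,
      le_trans (mul_le_mul_of_nonneg_right (by exact_mod_cast hm.le) hτ.le) hN⟩
    rw [AMFWMethod.mainSource, Finset.sum_range_zero, zero_sub, abs_neg, mul_assoc, abs_mul,
      abs_of_pos (by positivity : 0 < M.θ * τ ^ 2)]
    refine mul_le_mul_of_nonneg_left ?_ (by positivity)
    rw [mul_add, Finset.mul_sum, add_mul]
    refine (abs_add_le _ _).trans (add_le_add ?_ ?_)
    · rw [abs_mul]
      exact mul_le_mul (hC x hxneg M.rho S hS fun i => Finset.single_le_sum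
        (f := fun i => |M.rho i|) (fun _ _ => abs_nonneg _) (Finset.mem_univ i)).2.1
        (hbd 2 le_rfl 0 (fun _ => by simp) _ ht) (abs_nonneg _) (by positivity)
    · refine (Finset.abs_sum_le_sum_abs _ _).trans ?_
      rw [mul_assoc, Finset.sum_mul, Finset.mul_sum]
      refine Finset.sum_le_sum fun j _ => ?_
      rw [← mul_assoc, abs_mul, abs_mul (P.a j), abs_of_pos (P.a_pos j)]
      have h1 : |M.stageFun x M.rho * (M.partialAmpl x j - 1)| ≤ C' :=
        ((hC' x hxneg j).1).trans (mul_le_of_le_one_right hC0'.le (min_le_left _ _))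
      exact mul_le_mul h1 (mul_le_mul_of_nonneg_left
        (hbd 1 (by omega) _ (single_le j (by omega)) _ ht) (P.a_pos j).le)
        (mul_nonneg (P.a_pos j).le (abs_nonneg _)) hC0'.le
  have h := abs_accum_le hR hmain
  rw [Finset.sum_const, Finset.card_range, nsmul_eq_mul] at h
  refine h.trans ?_
  have h1 : (N : ℝ) * τ * (M.θ * τ * ((C * S + C' * a) * K)) ≤
      P.T * (M.θ * τ * ((C * S + C' * a) * K)) := mul_le_mul_of_nonneg_right hN (by positivity)
  have h2 : P.T * (M.θ * τ * ((C * S + C' * a) * K)) =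
      P.T * M.θ * (C * S + C' * a) * (3 ^ d * B) * (τ * modeWeight k) := by rw [hK]; ring
  have h3 : 0 < τ * modeWeight k := by positivity
  nlinarith

/-- Both the symbol of index two and the splitting term carry a factor `min 1 w`, which compensates
the division by `w` for small arguments. -/
theorem exists_accum_mainSource_one_le (hD : SmoothSolution P p D) (hd : 1 ≤ d) (hp : 2 ≤ p)
    (M : AMFWMethod s) (hθ : 0 < M.θ) (hord : M.HasRosenbrockOrder 2) {C₀ : ℝ} (hC₀ : 0 < C₀) :
    ∃ C > 0, ∀ (n : Fin d → ℕ) (τ : ℝ), 0 < τ → ∀ N : ℕ, N * τ ≤ P.T →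
      ∀ (k : (l : Fin d) → Fin (n l)) (R : ℝ), |R| ≤ 1 →
      C₀ * ∑ j, -modeArg P n τ k j ≤ M.ampl (modeArg P n τ k) * (1 - R) →
      |accum R (fun m => M.mainSource (modeArg P n τ k)
          (fun j => P.a j * derivCoeff D n 1 (Pi.single j 2) (m * τ) k) τ 1
          (fun q => derivCoeff D n q 0 (m * τ) k)) N| ≤ C * τ ^ 2 * (modeWeight k *
        min (N : ℝ) (min 1 (∑ j, -modeArg P n τ k j) * M.ampl (modeArg P n τ k) /
          ∑ j, -modeArg P n τ k j)) := by
  obtain ⟨B, hB0, hB⟩ := hD.exists_bound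
  obtain ⟨C, hC0, hC⟩ := AMFWMethod.exists_taylorSymbol_le (d := d) hd hθ hord (k := 2)
    (by omega) (by omega)
  obtain ⟨C', hC0', hC'⟩ := M.exists_stageFun_rho_mul_partialAmpl_le (d := d) hθ
  have hT := P.T_pos
  set a := ∑ j, P.a j with ha_def
  have ha : 0 ≤ a := Finset.sum_nonneg fun j _ => (P.a_pos j).le
  refine ⟨(C + M.θ * C' * a) * ((1 + (2 + P.T) / C₀) * (3 ^ d * B)), by positivity,
    fun n τ hτ N hN k R hR h1R => ?_⟩
  set x := modeArg P n τ k with hx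
  have hxneg : ∀ j, x j < 0 := modeArg_neg P n hτ k
  have hA := (M.ampl_pos hθ hxneg).le
  have hmw := modeWeight_pos k
  have hw : 0 < ∑ j, -x j := sum_neg_modeArg_pos hd P n hτ k
  set w := ∑ j, -x j with hw_def
  set K : ℝ := 3 ^ d * modeWeight k * B with hK
  have hK0 : 0 ≤ K := by positivity
  have hbd : ∀ q ≤ 3, ∀ α : Fin d → ℕ, (∀ j, α j ≤ 3) → ∀ t ∈ Icc 0 P.T,
      |derivCoeff D n q α t k| ≤ K := by
    intro q hq α hα t ht
    rw [hK, ← prod_three_div]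
    exact hD.abs_sineCoeff_le hB n (by omega) hα ht k
  have hacc : ∀ q ≤ 2, ∀ α : Fin d → ℕ, (∀ j, α j ≤ 3) →
      min 1 w * |accum R (fun m => derivCoeff D n q α (m * τ) k) N| ≤
        (1 + (2 + P.T) / C₀) * K * min (N : ℝ) (min 1 w * M.ampl x / w) := by
    intro q hq α hα
    have h := hD.abs_accum_derivCoeff_le n (q := q) (by omega) (α := α)
      (fun j => (hα j).trans (by omega)) k (hbd q (by omega) α hα) (hbd (q + 1) (by omega) α hα)
      hτ hN hR
    exact min_mul_le_min hw hC₀ h1R (abs_nonneg _) hK0 hA (Nat.cast_nonneg _)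
      hT.le h.1 h.2
  set Z := (1 + (2 + P.T) / C₀) * K * min (N : ℝ) (min 1 w * M.ampl x / w) with hZ
  have hsrc : ∀ m < N, M.mainSource x
          (fun j => P.a j * derivCoeff D n 1 (Pi.single j 2) (m * τ) k) τ 1
          (fun q => derivCoeff D n q 0 (m * τ) k) =
      (τ ^ 2 * M.taylorSymbol 2 x) * derivCoeff D n 2 0 (m * τ) k
      + ∑ j, (-(M.θ * τ ^ 2 * P.a j) * (M.stageFun x M.rho * (M.partialAmpl x j - 1)))
        * derivCoeff D n 1 (Pi.single j 2) (m * τ) k := by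
    intro m _
    rw [AMFWMethod.mainSource_eq, Finset.sum_range_succ, Finset.sum_range_zero, Finset.mul_sum,
      sub_eq_add_neg, ← Finset.sum_neg_distrib]
    congr 1
    · ring
    · exact Finset.sum_congr rfl fun j _ => by ring
  rw [accum_congr hsrc, accum_add, accum_sum, accum_mul_left]
  simp only [accum_mul_left]
  have h1 : |τ ^ 2 * M.taylorSymbol 2 x * accum R (fun m => derivCoeff D n 2 0 (m * τ) k) N| ≤
      τ ^ 2 * C * Z := by
    rw [abs_mul, abs_mul, abs_of_pos (by positivity : 0 < τ ^ 2)]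
    have e1 := hC x hxneg
    rw [show 2 + 1 - 2 = 1 by omega, pow_one] at e1
    calc _ ≤ τ ^ 2 * (C * min 1 w) * |accum R (fun m => derivCoeff D n 2 0 (m * τ) k) N| :=
          mul_le_mul_of_nonneg_right (mul_le_mul_of_nonneg_left e1 (by positivity)) (abs_nonneg _)
      _ = τ ^ 2 * C * (min 1 w * |accum R (fun m => derivCoeff D n 2 0 (m * τ) k) N|) := by ring
      _ ≤ _ := mul_le_mul_of_nonneg_left (hacc 2 le_rfl 0 fun _ => by simp) (by positivity)
  have h2 : |∑ j, (-(M.θ * τ ^ 2 * P.a j) * (M.stageFun x M.rho * (M.partialAmpl x j - 1)))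
        * accum R (fun m => derivCoeff D n 1 (Pi.single j 2) (m * τ) k) N| ≤
      τ ^ 2 * (M.θ * C' * a) * Z := by
    refine (Finset.abs_sum_le_sum_abs _ _).trans ?_
    rw [ha_def, Finset.mul_sum, Finset.mul_sum, Finset.sum_mul]
    refine Finset.sum_le_sum fun j _ => ?_
    have hj := P.a_pos j
    rw [abs_mul, abs_mul, abs_neg, abs_of_pos (by positivity : 0 < M.θ * τ ^ 2 * P.a j)]
    calc _ ≤ M.θ * τ ^ 2 * P.a j * (C' * min 1 w) *
            |accum R (fun m => derivCoeff D n 1 (Pi.single j 2) (m * τ) k) N| :=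
          mul_le_mul_of_nonneg_right (mul_le_mul_of_nonneg_left (hC' x hxneg j).1 (by positivity))
            (abs_nonneg _)
      _ = τ ^ 2 * (M.θ * C' * P.a j) * (min 1 w *
            |accum R (fun m => derivCoeff D n 1 (Pi.single j 2) (m * τ) k) N|) := by ring
      _ ≤ _ := mul_le_mul_of_nonneg_left (hacc 1 (by omega) _ (single_le j (by omega)))
            (by positivity)
  refine (abs_add_le _ _).trans ((add_le_add h1 h2).trans (le_of_eq ?_))
  rw [hZ, hK]
  ring

end SmoothSolution

/-! ### Counting powers of the step size and of the wave numbers. -/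

theorem rpow_le_mul_rpow {τ T a b : ℝ} (hτ : 0 < τ) (hT : τ ≤ T) (hab : a ≤ b) :
    τ ^ b ≤ T ^ (b - a) * τ ^ a := by
  have h : τ ^ b = τ ^ (b - a) * τ ^ a := by rw [← Real.rpow_add hτ]; ring_nf
  rw [h]
  exact mul_le_mul_of_nonneg_right (Real.rpow_le_rpow hτ.le hT (by linarith))
    (Real.rpow_nonneg hτ.le _)

theorem le_prod_of_one_le {ι : Type*} [Fintype ι] {κ : ι → ℝ} (hκ : ∀ j, 1 ≤ κ j) (j : ι) :
    κ j ≤ ∏ l, κ l := by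
  classical
  rw [← Finset.mul_prod_erase _ _ (Finset.mem_univ j)]
  exact le_mul_of_one_le_right (zero_le_one.trans (hκ j))
    (Finset.one_le_prod fun i _ => hκ i)

theorem prod_le_prod_univ_of_one_le {ι : Type*} [Fintype ι] {κ : ι → ℝ} (hκ : ∀ j, 1 ≤ κ j)
    (S : Finset ι) : ∏ l ∈ S, κ l ≤ ∏ l, κ l := by
  classical
  rw [← Finset.prod_mul_prod_compl S]
  exact le_mul_of_one_le_right (Finset.prod_nonneg fun i _ => zero_le_one.trans (hκ i))
    (Finset.one_le_prod fun i _ => hκ i)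

/-- Each `y_j` is worth one `τ` and two powers of `κ_j`. The product over `S` uses every index at
most once and so costs only `Q²` for `Q = ∏ κ_j`, whatever the size of `S`; the power of the sum
costs `Q^(2e)`. The three conditions say that the powers of `τ` suffice and those of `Q` do not
exceed `2 + 2σ`. -/
theorem exists_pow_mul_prod_mul_rpow_le {d : ℕ} {θ c T e σ : ℝ} (hθ : 0 < θ) (hc : 0 < c)
    (hT : 0 < T) (S : Finset (Fin d)) (k : ℕ) (he : 0 ≤ e) (h1 : 3 + σ ≤ k + S.card + e)
    (h2 : S.Nonempty → e ≤ σ) (h3 : e ≤ 1 + σ) :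
    ∃ C > 0, ∀ (τ : ℝ) (y κ : Fin d → ℝ), 0 < τ → τ ≤ T → (∀ j, 0 ≤ y j) →
      (∀ j, y j ≤ c * τ * κ j ^ 2) → (∀ j, 1 ≤ κ j) →
      τ ^ k * (∏ j ∈ S, θ * y j) * (∑ j, y j) ^ e ≤ C * τ ^ (3 + σ) * (∏ j, κ j) ^ (2 + 2 * σ) := by
  refine ⟨(θ * c) ^ S.card * (d * c) ^ e * T ^ (k + S.card + e - (3 + σ)) + 1, by positivity,
    fun τ y κ hτ hτT hy hyκ hκ => ?_⟩
  set Q := ∏ j, κ j with hQ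
  have hQ1 : 1 ≤ Q := Finset.one_le_prod fun i _ => hκ i
  have hQ0 : 0 < Q := by linarith
  have a1 : ∏ j ∈ S, θ * y j ≤ (θ * c) ^ S.card * τ ^ S.card * ∏ j ∈ S, κ j ^ 2 := by
    rw [← mul_pow, ← Finset.prod_const, ← Finset.prod_mul_distrib]
    refine Finset.prod_le_prod (fun j _ => mul_nonneg hθ.le (hy j)) fun j _ => ?_
    calc θ * y j ≤ θ * (c * τ * κ j ^ 2) := mul_le_mul_of_nonneg_left (hyκ j) hθ.le
      _ = _ := by ring
  have a2 : ∑ j, y j ≤ d * c * τ * Q ^ 2 := by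
    have : ∑ j, y j ≤ ∑ _j : Fin d, c * τ * Q ^ 2 := Finset.sum_le_sum fun j _ =>
      (hyκ j).trans (mul_le_mul_of_nonneg_left (pow_le_pow_left₀ (zero_le_one.trans (hκ j))
        (le_prod_of_one_le hκ j) 2) (by positivity))
    refine this.trans (le_of_eq ?_)
    rw [Finset.sum_const, Finset.card_univ, Fintype.card_fin, nsmul_eq_mul]
    ring
  have a3 : (∑ j, y j) ^ e ≤ (d * c) ^ e * τ ^ e * Q ^ (2 * e) := by
    refine (Real.rpow_le_rpow (Finset.sum_nonneg fun j _ => hy j) a2 he).trans (le_of_eq ?_)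
    rw [Real.mul_rpow (by positivity) (by positivity), Real.mul_rpow (by positivity) hτ.le,
      ← Real.rpow_natCast Q, ← Real.rpow_mul hQ0.le]
    norm_num
  have a4 : (∏ j ∈ S, κ j ^ 2) * Q ^ (2 * e) ≤ Q ^ (2 + 2 * σ) := by
    rcases S.eq_empty_or_nonempty with rfl | hS
    · rw [Finset.prod_empty, one_mul]
      exact Real.rpow_le_rpow_of_exponent_le hQ1 (by linarith)
    · have b1 : ∏ j ∈ S, κ j ^ 2 ≤ Q ^ (2 : ℝ) := by
        rw [Finset.prod_pow, Real.rpow_two]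
        exact pow_le_pow_left₀ (Finset.prod_nonneg fun i _ => zero_le_one.trans (hκ i))
          (prod_le_prod_univ_of_one_le hκ S) 2
      calc _ ≤ Q ^ (2 : ℝ) * Q ^ (2 * e) :=
            mul_le_mul_of_nonneg_right b1 (Real.rpow_nonneg hQ0.le _)
        _ = Q ^ (2 + 2 * e) := (Real.rpow_add hQ0 _ _).symm
        _ ≤ _ := Real.rpow_le_rpow_of_exponent_le hQ1 (by linarith [h2 hS])
  have a5 : τ ^ k * τ ^ S.card * τ ^ e ≤ T ^ (k + S.card + e - (3 + σ)) * τ ^ (3 + σ) := by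
    rw [← Real.rpow_natCast, ← Real.rpow_natCast, ← Real.rpow_add hτ, ← Real.rpow_add hτ]
    exact rpow_le_mul_rpow hτ hτT h1
  have hκS : 0 ≤ ∏ j ∈ S, κ j ^ 2 := Finset.prod_nonneg fun j _ => sq_nonneg _
  have hde : 0 ≤ ((d : ℝ) * c) ^ e := Real.rpow_nonneg (by positivity) _
  have hyS : 0 ≤ ∏ j ∈ S, θ * y j := Finset.prod_nonneg fun j _ => mul_nonneg hθ.le (hy j)
  calc τ ^ k * (∏ j ∈ S, θ * y j) * (∑ j, y j) ^ e
      ≤ τ ^ k * ((θ * c) ^ S.card * τ ^ S.card * ∏ j ∈ S, κ j ^ 2) *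
        ((d * c) ^ e * τ ^ e * Q ^ (2 * e)) :=
        mul_le_mul (mul_le_mul_of_nonneg_left a1 (by positivity)) a3
          (Real.rpow_nonneg (Finset.sum_nonneg fun j _ => hy j) _) (by positivity)
    _ = ((θ * c) ^ S.card * (d * c) ^ e) * (τ ^ k * τ ^ S.card * τ ^ e) *
        ((∏ j ∈ S, κ j ^ 2) * Q ^ (2 * e)) := by ring
    _ ≤ ((θ * c) ^ S.card * (d * c) ^ e) * (T ^ (k + S.card + e - (3 + σ)) * τ ^ (3 + σ)) *
        Q ^ (2 + 2 * σ) :=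
        mul_le_mul (mul_le_mul_of_nonneg_left a5 (by positivity)) a4 (by positivity) (by positivity)
    _ ≤ _ := by
        have : 0 ≤ τ ^ (3 + σ) * Q ^ (2 + 2 * σ) := by positivity
        nlinarith

theorem exists_sum_le_of_forall {ι α : Type*} (S : Finset ι) (p : α → Prop) (f : ι → α → ℝ)
    (g : α → ℝ) (hg : ∀ a, p a → 0 ≤ g a)
    (h : ∀ i ∈ S, ∃ C > 0, ∀ a, p a → f i a ≤ C * g a) :
    ∃ C > 0, ∀ a, p a → ∑ i ∈ S, f i a ≤ C * g a := by
  choose! C hC hf using h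
  refine ⟨∑ i ∈ S, C i + 1, add_pos_of_nonneg_of_pos
    (Finset.sum_nonneg fun i hi => (hC i hi).le) one_pos, fun a ha => ?_⟩
  have : ∑ i ∈ S, f i a ≤ (∑ i ∈ S, C i) * g a := by
    rw [Finset.sum_mul]
    exact Finset.sum_le_sum fun i hi => hf i hi a ha
  nlinarith [hg a ha]

/-- Expanding over subsets, the constant and linear terms are those of cardinality at most 1.
Applied to the factorization defect of the splitting. -/
theorem prod_one_add_sub_le {ι : Type*} [Fintype ι] [DecidableEq ι] (y : ι → ℝ)
    (hy : ∀ i, 0 ≤ y i) :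
    ∏ i, (1 + y i) - 1 - ∑ i, y i ≤
      ∑ S ∈ (Finset.univ : Finset ι).powerset with 2 ≤ S.card, ∏ i ∈ S, y i := by
  rw [Finset.prod_one_add, ← Finset.sum_filter_add_sum_filter_not _ (fun S => 2 ≤ S.card)]
  have h1 : ∑ S ∈ (Finset.univ : Finset ι).powerset with ¬ 2 ≤ S.card, ∏ i ∈ S, y i ≤
      ∑ S ∈ insert ∅ (Finset.univ.image fun i : ι => ({i} : Finset ι)), ∏ i ∈ S, y i := by
    refine Finset.sum_le_sum_of_subset_of_nonneg (fun S hS => ?_)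
      fun S _ _ => Finset.prod_nonneg fun i _ => hy i
    rw [Finset.mem_filter] at hS
    rw [Finset.mem_insert]
    rcases S.eq_empty_or_nonempty with h | h
    · exact Or.inl h
    · have : S.card = 1 := by have := h.card_pos; omega
      obtain ⟨a, rfl⟩ := Finset.card_eq_one.1 this
      exact Or.inr (Finset.mem_image_of_mem _ (Finset.mem_univ a))
  rw [Finset.sum_insert (by simp), Finset.sum_image (fun a _ b _ h => Finset.singleton_injective h)] at h1
  simp only [Finset.prod_empty, Finset.prod_singleton] at h1
  linarith

theorem div_mul_rpow_le {w e : ℝ} {m : ℕ} (hw : 0 < w) (he : 0 ≤ e) (hem : e + 1 ≤ m) :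
    min 1 (w ^ m) / w ≤ w ^ e := by
  rw [div_le_iff₀ hw]
  refine (AMFWMethod.min_one_pow_le_rpow hw.le (by linarith) hem).trans (le_of_eq ?_)
  rw [Real.rpow_add hw, Real.rpow_one]

/-- The factors that arise from the error terms of order at least two. -/
theorem exists_pow_mul_min_mul_prod_le {d p : ℕ} {θ c T σ : ℝ} (hθ : 0 < θ) (hc : 0 < c)
    (hT : 0 < T) (hσ : 0 ≤ σ) (hσp : 3 + σ ≤ p) {k : ℕ} (hk : 2 ≤ k) (hkp : k ≤ p) :
    ∃ C > 0, ∀ (τ : ℝ) (y κ : Fin d → ℝ), 0 < τ → τ ≤ T → (∀ j, 0 ≤ y j) →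
      (∀ j, y j ≤ c * τ * κ j ^ 2) → (∀ j, 1 ≤ κ j) → 0 < ∑ j, y j →
      τ ^ k * (min 1 ((∑ j, y j) ^ (p + 1 - k)) / (∑ j, y j) * ∏ j, (1 + θ * y j)) ≤
        C * τ ^ (3 + σ) * (∏ j, κ j) ^ (2 + 2 * σ) := by
  obtain ⟨C, hC, h⟩ := exists_sum_le_of_forall (Finset.univ : Finset (Fin d)).powerset
    (fun a : ℝ × (Fin d → ℝ) × (Fin d → ℝ) => 0 < a.1 ∧ a.1 ≤ T ∧ (∀ j, 0 ≤ a.2.1 j) ∧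
      (∀ j, a.2.1 j ≤ c * a.1 * a.2.2 j ^ 2) ∧ (∀ j, 1 ≤ a.2.2 j))
    -- The exponent of the sum is the least one that raises the total order in `τ`, already `k +
    -- |S|`, to `3 + σ`.
    (fun S a => a.1 ^ k * (∏ j ∈ S, θ * a.2.1 j) *
      (∑ j, a.2.1 j) ^ (max 0 (3 + σ - k - S.card)))
    (fun a => a.1 ^ (3 + σ) * (∏ j, a.2.2 j) ^ (2 + 2 * σ))
    (fun a ha => by
      have : 0 ≤ ∏ j, a.2.2 j := Finset.prod_nonneg fun j _ => zero_le_one.trans (ha.2.2.2.2 j)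
      have := ha.1
      positivity)
    (fun S _ => by
      have hk' : (2 : ℝ) ≤ k := by exact_mod_cast hk
      obtain ⟨C, hC, h⟩ := exists_pow_mul_prod_mul_rpow_le (e := max 0 (3 + σ - k - S.card))
        (σ := σ) hθ hc hT S k (le_max_left _ _)
        (by linarith [le_max_right 0 (3 + σ - k - S.card)])
        (fun hS => by
          have : (1 : ℝ) ≤ S.card := by exact_mod_cast hS.card_pos
          exact max_le hσ (by linarith))
        (max_le (by linarith) (by linarith [(Nat.cast_nonneg S.card : (0 : ℝ) ≤ S.card)]))
      refine ⟨C, hC, fun a ha => ?_⟩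
      rw [← mul_assoc]
      exact h a.1 a.2.1 a.2.2 ha.1 ha.2.1 ha.2.2.1 ha.2.2.2.1 ha.2.2.2.2)
  refine ⟨C, hC, fun τ y κ hτ hτT hy hyκ hκ hw => ?_⟩
  have := h (τ, y, κ) ⟨hτ, hτT, hy, hyκ, hκ⟩
  rw [← mul_assoc] at this
  refine le_trans ?_ this
  rw [Finset.prod_one_add, Finset.mul_sum, Finset.mul_sum]
  refine Finset.sum_le_sum fun S _ => ?_
  have hS : 0 ≤ ∏ j ∈ S, θ * y j := Finset.prod_nonneg fun j _ => mul_nonneg hθ.le (hy j)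
  have hk' : ((p + 1 - k : ℕ) : ℝ) = p + 1 - k := by
    rw [Nat.cast_sub (by omega)]; push_cast; ring
  have hkp' : (k : ℝ) ≤ p := by exact_mod_cast hkp
  have h1 := div_mul_rpow_le (m := p + 1 - k) hw (le_max_left 0 (3 + σ - k - S.card)) (by
    rw [hk', max_add, zero_add]
    exact max_le (by linarith) (by linarith [(Nat.cast_nonneg S.card : (0 : ℝ) ≤ S.card)]))
  calc _ ≤ τ ^ k * ((∑ j, y j) ^ (max 0 (3 + σ - k - S.card)) * ∏ j ∈ S, θ * y j) :=
        mul_le_mul_of_nonneg_left (mul_le_mul_of_nonneg_right h1 hS) (by positivity)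
    _ = _ := by ring

/-- The factors that arise from the error term of order one. -/
theorem exists_mul_min_mul_sum_le {d p : ℕ} {θ c T σ : ℝ} (hθ : 0 < θ) (hc : 0 < c)
    (hT : 0 < T) (hσ : 0 ≤ σ) (hσp : 3 + σ ≤ p) :
    ∃ C > 0, ∀ (τ : ℝ) (y κ : Fin d → ℝ), 0 < τ → τ ≤ T → (∀ j, 0 ≤ y j) →
      (∀ j, y j ≤ c * τ * κ j ^ 2) → (∀ j, 1 ≤ κ j) → 0 < ∑ j, y j →
      τ * (min 1 ((∑ j, y j) ^ (p - 2)) / (∑ j, y j) *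
        ∑ S ∈ (Finset.univ : Finset (Fin d)).powerset with 2 ≤ S.card, ∏ i ∈ S, θ * y i) ≤
        C * τ ^ (3 + σ) * (∏ j, κ j) ^ (2 + 2 * σ) := by
  obtain ⟨C, hC, h⟩ := exists_sum_le_of_forall
    ((Finset.univ : Finset (Fin d)).powerset.filter fun S => 2 ≤ S.card)
    (fun a : ℝ × (Fin d → ℝ) × (Fin d → ℝ) => 0 < a.1 ∧ a.1 ≤ T ∧ (∀ j, 0 ≤ a.2.1 j) ∧
      (∀ j, a.2.1 j ≤ c * a.1 * a.2.2 j ^ 2) ∧ (∀ j, 1 ≤ a.2.2 j))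
    -- One explicit power of `τ` and at least two from `S`: the power `σ` of the sum supplies the
    -- rest.
    (fun S a => a.1 ^ 1 * (∏ j ∈ S, θ * a.2.1 j) * (∑ j, a.2.1 j) ^ σ)
    (fun a => a.1 ^ (3 + σ) * (∏ j, a.2.2 j) ^ (2 + 2 * σ))
    (fun a ha => by
      have : 0 ≤ ∏ j, a.2.2 j := Finset.prod_nonneg fun j _ => zero_le_one.trans (ha.2.2.2.2 j)
      have := ha.1
      positivity)
    (fun S hS => by
      have hS' : (2 : ℝ) ≤ S.card := by exact_mod_cast (Finset.mem_filter.1 hS).2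
      obtain ⟨C, hC, h⟩ := exists_pow_mul_prod_mul_rpow_le (e := σ) (σ := σ) hθ hc hT S 1 hσ
        (by push_cast; linarith) (fun _ => le_rfl) (by linarith)
      refine ⟨C, hC, fun a ha => ?_⟩
      rw [← mul_assoc]
      exact h a.1 a.2.1 a.2.2 ha.1 ha.2.1 ha.2.2.1 ha.2.2.2.1 ha.2.2.2.2)
  refine ⟨C, hC, fun τ y κ hτ hτT hy hyκ hκ hw => ?_⟩
  have := h (τ, y, κ) ⟨hτ, hτT, hy, hyκ, hκ⟩
  rw [← mul_assoc] at this
  refine le_trans ?_ this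
  rw [Finset.mul_sum, Finset.mul_sum]
  refine Finset.sum_le_sum fun S _ => ?_
  have hS : 0 ≤ ∏ j ∈ S, θ * y j := Finset.prod_nonneg fun j _ => mul_nonneg hθ.le (hy j)
  have hp : 2 ≤ p := by
    have : (2 : ℝ) ≤ p := by linarith
    exact_mod_cast this
  have h1 := div_mul_rpow_le (m := p - 2) hw hσ (by
    rw [Nat.cast_sub hp]; push_cast; linarith)
  calc _ ≤ τ * ((∑ j, y j) ^ σ * ∏ j ∈ S, θ * y j) :=
        mul_le_mul_of_nonneg_left (mul_le_mul_of_nonneg_right h1 hS) hτ.le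
    _ = _ := by ring

namespace AMFWMethod

variable {s d p : ℕ} {M : AMFWMethod s}

/-- The defect is bounded by the products over at least two directions, the remaining factor by
`exists_stageFun_rho_le`. With fewer than two directions the sum is empty and the symbol vanishes.
-/
theorem exists_taylorSymbol_one_le (hθ : 0 < M.θ) (h : M.HasRosenbrockOrder p)
    (hp : 2 ≤ p) :
    ∃ C > 0, ∀ x : Fin d → ℝ, (∀ j, x j < 0) →
      M.ampl x * |M.taylorSymbol 1 x| ≤ C * (min 1 ((∑ j, -x j) ^ (p - 2)) *
        ∑ S ∈ (Finset.univ : Finset (Fin d)).powerset with 2 ≤ S.card, ∏ i ∈ S, M.θ * -x i) := by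
  have key : ∀ x : Fin d → ℝ, (∀ j, x j < 0) →
      |M.taylorSymbol 1 x| ≤ (∑ S ∈ (Finset.univ : Finset (Fin d)).powerset with 2 ≤ S.card,
        ∏ i ∈ S, M.θ * -x i) * |M.stageFun x M.rho| := by
    intro x hx
    have h0 : ∀ i, 0 ≤ M.θ * -x i := fun i => by nlinarith [hx i]
    have h1 := prod_one_add_sub_le (fun i => M.θ * -x i) h0
    have h2 := one_add_sum_le_prod Finset.univ (fun i => M.θ * -x i) fun i _ => h0 i
    rw [taylorSymbol_one _ _ (M.ampl_pos hθ hx).ne', h.dotProduct_rho (by omega), sub_self,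
      zero_add, abs_mul]
    refine mul_le_mul_of_nonneg_right ?_ (abs_nonneg _)
    rw [← M.ampl_eq_prod] at h1 h2
    rw [← Finset.mul_sum, Finset.sum_neg_distrib] at h1 h2
    rw [abs_of_nonneg (by linarith)]
    linarith
  have hsum0 : ∀ x : Fin d → ℝ, (∀ j, x j < 0) →
      0 ≤ ∑ S ∈ (Finset.univ : Finset (Fin d)).powerset with 2 ≤ S.card, ∏ i ∈ S, M.θ * -x i :=
    fun x hx => Finset.sum_nonneg fun S _ => Finset.prod_nonneg fun i _ => by nlinarith [hx i]
  rcases le_or_gt 2 d with hd | hd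
  · obtain ⟨C, hC, hC'⟩ := exists_stageFun_rho_le (d := d) hd hθ h hp
    refine ⟨C, hC, fun x hx => ?_⟩
    have h1 := mul_le_mul_of_nonneg_left (hC' x hx) (hsum0 x hx)
    have h2 := mul_le_mul_of_nonneg_left (key x hx) (M.ampl_pos hθ hx).le
    linarith
  · refine ⟨1, one_pos, fun x hx => ?_⟩
    have hempty : (Finset.univ : Finset (Fin d)).powerset.filter (fun S => 2 ≤ S.card) = ∅ := by
      refine Finset.filter_eq_empty_iff.2 fun S _ => ?_
      have := S.card_le_univ
      rw [Fintype.card_fin] at this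
      omega
    have h1 := key x hx
    rw [hempty, Finset.sum_empty, zero_mul] at h1
    rw [hempty, Finset.sum_empty, mul_zero, mul_zero, le_antisymm h1 (abs_nonneg _), mul_zero]

end AMFWMethod

theorem neg_modeArg_le {d : ℕ} (P : DiffusionProblem d) (n : Fin d → ℕ) {τ : ℝ}
    (hτ : 0 < τ) (k : (l : Fin d) → Fin (n l)) (j : Fin d) :
    -modeArg P n τ k j ≤ (10 * ∑ i, P.a i) * τ * ((k j : ℕ) + 1 : ℝ) ^ 2 := by
  have h1 := neg_dirEigenvalue_le n (P.a_pos j) j k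
  have h2 : P.a j ≤ ∑ i, P.a i :=
    Finset.single_le_sum (f := P.a) (fun i _ => (P.a_pos i).le) (Finset.mem_univ j)
  have h3 : -modeArg P n τ k j = τ * -dirEigenvalue n (P.a j) j k := by rw [modeArg]; ring
  rw [h3]
  have h4 : P.a j * (10 * ((k j : ℕ) + 1 : ℝ) ^ 2) ≤
      (∑ i, P.a i) * (10 * ((k j : ℕ) + 1 : ℝ) ^ 2) :=
    mul_le_mul_of_nonneg_right h2 (by positivity)
  calc _ ≤ τ * (P.a j * 10 * ((k j : ℕ) + 1 : ℝ) ^ 2) := mul_le_mul_of_nonneg_left h1 hτ.le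
    _ ≤ τ * ((∑ i, P.a i) * (10 * ((k j : ℕ) + 1 : ℝ) ^ 2)) :=
      mul_le_mul_of_nonneg_left (by linarith) hτ.le
    _ = _ := by ring

theorem sum_a_pos {d : ℕ} (hd : 1 ≤ d) (P : DiffusionProblem d) : 0 < ∑ i, P.a i := by
  have : NeZero d := ⟨by omega⟩
  exact Finset.sum_pos (fun j _ => P.a_pos j) Finset.univ_nonempty

theorem prod_three_div_pow {d : ℕ} {n : Fin d → ℕ} (k : (l : Fin d) → Fin (n l)) :
    ∏ l, 3 / ((k l : ℕ) + 1 : ℝ) ^ 3 = 3 ^ d * ((∏ l, ((k l : ℕ) + 1 : ℝ)) ^ 3)⁻¹ := by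
  rw [← Finset.prod_pow, ← Finset.prod_inv_distrib, ← Fin.prod_const, ← Finset.prod_mul_distrib]
  exact Finset.prod_congr rfl fun l _ => by ring

namespace SmoothSolution

variable {d s p : ℕ} {P : DiffusionProblem d} {D : ℕ → (Fin d → ℕ) → (Fin d → ℝ) → ℝ → ℝ}

theorem a_mul_derivCoeff_of_timeIndependent (hD : SmoothSolution P p D)
    (hP : P.TimeIndependentBC) (n : Fin d → ℕ) (j : Fin d) {t : ℝ} (ht : t ∈ Icc 0 P.T)
    (k : (l : Fin d) → Fin (n l)) :
    P.a j * derivCoeff D n 1 (Pi.single j 2) t k =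
      dirEigenvalue n (P.a j) j k * derivCoeff D n 1 0 t k + truncationCoeff P D n 1 j t k := by
  rw [truncationCoeff, hD.secondDiff_eq_of_timeIndependent hP n j ht, map_sub, map_smul,
    Pi.sub_apply, sineCoeff_dirLaplacian, Pi.smul_apply, smul_eq_mul, derivCoeff, derivCoeff]
  ring

/-- The modes of `a_j ∂_jj u_t` are eigenvalue multiples of those of `u_t`, up to discretization
errors. Since `θ ∑ x_j · partialAmpl x j = 1 - Π`, the splitting term then collapses to the symbol
of index one times `τ u_t`. -/
theorem mainSource_eq_of_timeIndependent (hD : SmoothSolution P p D) (hP : P.TimeIndependentBC)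
    {M : AMFWMethod s} (hθ : 0 < M.θ) (hb : dotProduct M.b M.rho = 1) (n : Fin d → ℕ) (N : ℕ)
    {τ t : ℝ} (hτ : 0 < τ) (ht : t ∈ Icc 0 P.T) (k : (l : Fin d) → Fin (n l)) :
    M.mainSource (modeArg P n τ k) (fun j => P.a j * derivCoeff D n 1 (Pi.single j 2) t k) τ (N + 1)
        (fun q => derivCoeff D n q 0 t k) =
      ∑ q ∈ Finset.range (N + 2),
        (τ ^ (q + 1) * M.taylorSymbol (q + 1) (modeArg P n τ k)) * derivCoeff D n (q + 1) 0 t k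
      - M.θ * τ ^ 2 * ∑ j, M.stageFun (modeArg P n τ k) M.rho *
        (M.partialAmpl (modeArg P n τ k) j - 1) * truncationCoeff P D n 1 j t k := by
  set x := modeArg P n τ k with hx
  have hxneg : ∀ j, x j < 0 := modeArg_neg P n hτ k
  have h1 := M.sum_mul_partialAmpl x
  have h2 : τ * ∑ j, (M.partialAmpl x j - 1) * (P.a j * derivCoeff D n 1 (Pi.single j 2) t k) =
      (∑ j, x j * M.partialAmpl x j - ∑ j, x j) * derivCoeff D n 1 0 t k
      + τ * ∑ j, (M.partialAmpl x j - 1) * truncationCoeff P D n 1 j t k := by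
    rw [← Finset.sum_sub_distrib, Finset.sum_mul, Finset.mul_sum, Finset.mul_sum,
      ← Finset.sum_add_distrib]
    refine Finset.sum_congr rfl fun j _ => ?_
    rw [hD.a_mul_derivCoeff_of_timeIndependent hP n j ht, hx, modeArg]
    ring
  have h3 : ∑ j, M.stageFun x M.rho * (M.partialAmpl x j - 1) * truncationCoeff P D n 1 j t k =
      M.stageFun x M.rho * ∑ j, (M.partialAmpl x j - 1) * truncationCoeff P D n 1 j t k := by
    rw [Finset.mul_sum]
    exact Finset.sum_congr rfl fun j _ => by ring
  rw [M.mainSource_eq, h3, Finset.sum_range_succ' _ (N + 1),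
    M.taylorSymbol_one x (M.ampl_pos hθ hxneg).ne', hb]
  have h4 : ∑ q ∈ Finset.range (N + 1), τ ^ (q + 2) * derivCoeff D n (q + 2) 0 t k *
        M.taylorSymbol (q + 2) x =
      ∑ q ∈ Finset.range (N + 1), τ ^ (q + 1 + 1) * M.taylorSymbol (q + 1 + 1) x *
        derivCoeff D n (q + 1 + 1) 0 t k := Finset.sum_congr rfl fun q _ => by ring
  rw [h4]
  simp only [zero_add, pow_one]
  linear_combination (-(M.θ * τ * M.stageFun x M.rho)) * h2
    - τ * M.stageFun x M.rho * derivCoeff D n 1 0 t k * h1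

/-- Summation by parts costs `Π / w`, and the power counting bounds `τ^k Π |symbol| / w` by `τ^(3+σ)
Q^(2+2σ)`. The time derivatives contribute `Q^(-3)`, since they vanish on the boundary, so
`Q^(-1+2σ)` remains. -/
theorem exists_accum_mainSource_le_of_timeIndependent (hD : SmoothSolution P p D)
    (hP : P.TimeIndependentBC) (hd : 1 ≤ d) {M : AMFWMethod s} (hθ : 0 < M.θ)
    (hord : M.HasRosenbrockOrder p) {σ : ℝ} (hσ : 0 ≤ σ) (hσp : 3 + σ ≤ p) {C₀ : ℝ}
    (hC₀ : 0 < C₀) :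
    ∃ C > 0, ∀ (n : Fin d → ℕ) (τ : ℝ), 0 < τ → τ ≤ P.T → ∀ N : ℕ, N * τ ≤ P.T →
      ∀ (k : (l : Fin d) → Fin (n l)) (R : ℝ), |R| ≤ 1 →
      C₀ * ∑ j, -modeArg P n τ k j ≤ M.ampl (modeArg P n τ k) * (1 - R) →
      |accum R (fun m => M.mainSource (modeArg P n τ k)
          (fun j => P.a j * derivCoeff D n 1 (Pi.single j 2) (m * τ) k) τ (p - 1)
          (fun q => derivCoeff D n q 0 (m * τ) k)) N| ≤
        C * τ ^ (3 + σ) * (∏ l, ((k l : ℕ) + 1 : ℝ)) ^ (-1 + 2 * σ)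
        + C * ∑ m ∈ Finset.range N, τ * (τ * ∑ j, |truncationCoeff P D n 1 j (m * τ) k|) := by
  have hp : 3 ≤ p := by
    have : (3 : ℝ) ≤ p := by linarith
    exact_mod_cast this
  obtain ⟨B, hB0, hB⟩ := hD.exists_bound
  have hT := P.T_pos
  obtain ⟨C', hC0', hC'⟩ := M.exists_stageFun_rho_mul_partialAmpl_le (d := d) hθ
  have ha := sum_a_pos hd P
  have hc : 0 < 10 * ∑ i, P.a i := by positivity
  -- a common bound for all symbols
  have hsym : ∀ q ∈ Finset.range p, ∃ C > 0, ∀ v : (n : Fin d → ℕ) × ((l : Fin d) → Fin (n l)) × ℝ,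
      (0 < v.2.2 ∧ v.2.2 ≤ P.T) →
      v.2.2 ^ (q + 1) * (M.ampl (modeArg P v.1 v.2.2 v.2.1) *
        |M.taylorSymbol (q + 1) (modeArg P v.1 v.2.2 v.2.1)| /
          ∑ j, -modeArg P v.1 v.2.2 v.2.1 j) ≤
      C * (v.2.2 ^ (3 + σ) * (∏ l, ((v.2.1 l : ℕ) + 1 : ℝ)) ^ (2 + 2 * σ)) := by
    intro q hq
    rw [Finset.mem_range] at hq
    rcases Nat.eq_zero_or_pos q with rfl | hq0
    · obtain ⟨C₁, hC₁, h₁⟩ := AMFWMethod.exists_taylorSymbol_one_le (d := d) hθ hord (by omega)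
      obtain ⟨C₂, hC₂, h₂⟩ := exists_mul_min_mul_sum_le (d := d) (p := p) hθ hc hT hσ hσp
      refine ⟨C₁ * C₂, by positivity, ?_⟩
      rintro ⟨n, k, τ⟩ ⟨hτ, hτT⟩
      dsimp only
      have hxneg := modeArg_neg P n hτ k
      have hw := sum_neg_modeArg_pos hd P n hτ k
      have e1 := h₁ _ hxneg
      have e2 := h₂ τ (fun j => -modeArg P n τ k j) (fun l => (k l : ℕ) + 1) hτ hτT
        (fun j => by linarith [hxneg j]) (neg_modeArg_le P n hτ k)
        (fun j => by linarith [(Nat.cast_nonneg (k j : ℕ) : (0 : ℝ) ≤ (k j : ℕ))]) hw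
      have e3 := mul_le_mul_of_nonneg_left (div_le_div_of_nonneg_right e1 hw.le) hτ.le
      rw [zero_add, pow_one]
      refine e3.trans ?_
      have e4 := mul_le_mul_of_nonneg_left e2 hC₁.le
      refine le_trans (le_of_eq ?_) (e4.trans (le_of_eq ?_)) <;> ring
    · obtain ⟨C₁, hC₁, h₁⟩ := AMFWMethod.exists_taylorSymbol_le (d := d) hd hθ hord (k := q + 1)
        (by omega) (by omega)
      obtain ⟨C₂, hC₂, h₂⟩ := exists_pow_mul_min_mul_prod_le (d := d) (p := p) (k := q + 1)
        hθ hc hT hσ hσp (by omega) (by omega)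
      refine ⟨C₁ * C₂, by positivity, ?_⟩
      rintro ⟨n, k, τ⟩ ⟨hτ, hτT⟩
      dsimp only
      have hxneg := modeArg_neg P n hτ k
      have hw := sum_neg_modeArg_pos hd P n hτ k
      have e1 := mul_le_mul_of_nonneg_left (h₁ _ hxneg) (M.ampl_pos hθ hxneg).le
      have e2 := h₂ τ (fun j => -modeArg P n τ k j) (fun l => (k l : ℕ) + 1) hτ hτT
        (fun j => by linarith [hxneg j]) (neg_modeArg_le P n hτ k)
        (fun j => by linarith [(Nat.cast_nonneg (k j : ℕ) : (0 : ℝ) ≤ (k j : ℕ))]) hw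
      have e3 := mul_le_mul_of_nonneg_left (div_le_div_of_nonneg_right e1 hw.le)
        (pow_nonneg hτ.le (q + 1))
      refine e3.trans ?_
      have e4 := mul_le_mul_of_nonneg_left e2 hC₁.le
      rw [← M.ampl_eq_prod] at e4
      refine le_trans (le_of_eq ?_) (e4.trans (le_of_eq ?_)) <;> ring
  obtain ⟨C₁, hC₁, h₁⟩ := exists_sum_le_of_forall _ _ _ _ (by
    rintro ⟨n, k, τ⟩ ⟨hτ, hτT⟩
    dsimp only at hτ ⊢
    positivity) hsym
  refine ⟨C₁ * ((2 + P.T) / C₀ * (3 ^ d * B)) + M.θ * C', by positivity,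
    fun n τ hτ hτT N hN k R hR h1R => ?_⟩
  have h₁' := h₁ ⟨n, k, τ⟩ ⟨hτ, hτT⟩
  dsimp only at h₁'
  set x := modeArg P n τ k with hx
  have hxneg : ∀ j, x j < 0 := modeArg_neg P n hτ k
  have hA := M.ampl_pos hθ hxneg
  have hw : 0 < ∑ j, -x j := sum_neg_modeArg_pos hd P n hτ k
  set w := ∑ j, -x j with hw_def
  set Q := ∏ l, ((k l : ℕ) + 1 : ℝ) with hQ
  have hQ0 : 0 < Q := Finset.prod_pos fun l _ => by positivity
  set K : ℝ := 3 ^ d * (Q ^ 3)⁻¹ * B with hK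
  have hK0 : 0 ≤ K := by positivity
  have hbd : ∀ q, 1 ≤ q → q ≤ p + 1 → ∀ t ∈ Icc 0 P.T, |derivCoeff D n q 0 t k| ≤ K := by
    intro q hq1 hq t ht
    rw [hK, hQ, ← prod_three_div_pow]
    exact hD.abs_sineCoeff_le_of_timeIndependent hP hB n hq1 hq ht k
  have htm : ∀ m < N, (m : ℝ) * τ ∈ Icc 0 P.T := fun m hm => ⟨by positivity,
      le_trans (mul_le_mul_of_nonneg_right (by exact_mod_cast hm.le) hτ.le) hN⟩
  obtain ⟨r, rfl⟩ : ∃ r, p = r + 2 := ⟨p - 2, by omega⟩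
  have hsrc := accum_congr (R := R) (N := N) fun m hm =>
    hD.mainSource_eq_of_timeIndependent hP hθ (hord.dotProduct_rho (by omega)) n r hτ (htm m hm) k
  rw [show r + 2 - 1 = r + 1 by omega, hsrc]
  simp only [sub_eq_add_neg]
  rw [accum_add, accum_sum]
  simp only [accum_mul_left, ← hx]
  have hfirst : |∑ q ∈ Finset.range (r + 2), τ ^ (q + 1) * M.taylorSymbol (q + 1) x *
      accum R (fun m => derivCoeff D n (q + 1) 0 (m * τ) k) N| ≤
      C₁ * ((2 + P.T) / C₀ * (3 ^ d * B)) * (τ ^ (3 + σ) * Q ^ (-1 + 2 * σ)) := by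
    have e1 : ∀ q ∈ Finset.range (r + 2), |τ ^ (q + 1) * M.taylorSymbol (q + 1) x *
        accum R (fun m => derivCoeff D n (q + 1) 0 (m * τ) k) N| ≤
        (2 + P.T) / C₀ * K * (τ ^ (q + 1) * (M.ampl x * |M.taylorSymbol (q + 1) x| / w)) := by
      intro q hq
      rw [Finset.mem_range] at hq
      have f1 := (hD.abs_accum_derivCoeff_le n (q := q + 1) (by omega) (α := 0)
        (fun j => by simp) k (hbd (q + 1) (by omega) (by omega))
        (hbd (q + 1 + 1) (by omega) (by omega)) hτ hN hR).2
      set acc := |accum R (fun m => derivCoeff D n (q + 1) 0 (m * τ) k) N|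
      have hacc : 0 ≤ acc := abs_nonneg _
      have f2 : acc ≤ (2 + P.T) / C₀ * K * (M.ampl x / w) := by
        have : (2 + P.T) / C₀ * K * (M.ampl x / w) = M.ampl x * ((2 + P.T) * K) / (C₀ * w) := by
          field_simp
        rw [this, le_div_iff₀ (by positivity)]
        nlinarith [mul_le_mul_of_nonneg_right h1R hacc, mul_le_mul_of_nonneg_left f1 hA.le]
      rw [abs_mul, abs_mul, abs_of_pos (by positivity : 0 < τ ^ (q + 1))]
      refine (mul_le_mul_of_nonneg_left f2 (by positivity)).trans (le_of_eq ?_)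
      ring
    refine (Finset.abs_sum_le_sum_abs _ _).trans ((Finset.sum_le_sum e1).trans ?_)
    rw [← Finset.mul_sum]
    refine (mul_le_mul_of_nonneg_left h₁' (by positivity)).trans (le_of_eq ?_)
    have e2 : Q ^ (-1 + 2 * σ) = (Q ^ 3)⁻¹ * Q ^ (2 + 2 * σ) := by
      rw [← Real.rpow_natCast, ← Real.rpow_neg hQ0.le, ← Real.rpow_add hQ0]
      congr 1
      push_cast
      ring
    rw [hK, e2]
    ring
  have hsecond := abs_accum_le hR (N := N)
    (X := fun m => -(M.θ * τ ^ 2 * ∑ j, M.stageFun x M.rho * (M.partialAmpl x j - 1)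
      * truncationCoeff P D n 1 j (m * τ) k))
    (Y := fun m => M.θ * C' * (τ * (τ * ∑ j, |truncationCoeff P D n 1 j (m * τ) k|))) (by
      intro m _
      rw [abs_neg, abs_mul, abs_of_pos (by positivity : 0 < M.θ * τ ^ 2)]
      have e1 : |∑ j, M.stageFun x M.rho * (M.partialAmpl x j - 1)
          * truncationCoeff P D n 1 j (m * τ) k| ≤
          C' * ∑ j, |truncationCoeff P D n 1 j (m * τ) k| := by
        refine (Finset.abs_sum_le_sum_abs _ _).trans ?_
        rw [Finset.mul_sum]
        refine Finset.sum_le_sum fun j _ => ?_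
        rw [abs_mul]
        exact mul_le_mul_of_nonneg_right (((hC' x hxneg j).1).trans
          (mul_le_of_le_one_right hC0'.le (min_le_left _ _))) (abs_nonneg _)
      refine (mul_le_mul_of_nonneg_left e1 (by positivity)).trans (le_of_eq ?_)
      ring)
  rw [← Finset.mul_sum] at hsecond
  set Z := ∑ m ∈ Finset.range N, τ * (τ * ∑ j, |truncationCoeff P D n 1 j (m * τ) k|)
  have hZ : 0 ≤ Z := Finset.sum_nonneg fun m _ => mul_nonneg hτ.le (mul_nonneg hτ.le
    (Finset.sum_nonneg fun j _ => abs_nonneg _))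
  refine (abs_add_le _ _).trans ((add_le_add hfirst hsecond).trans ?_)
  have f1 : 0 ≤ M.θ * C' * (τ ^ (3 + σ) * Q ^ (-1 + 2 * σ)) := by positivity
  have f2 : 0 ≤ C₁ * ((2 + P.T) / C₀ * (3 ^ d * B)) * Z := by positivity
  linarith

end SmoothSolution

/-! ### Sums over the modes -/

theorem sum_prod_le {d : ℕ} {n : Fin d → ℕ} (f : Fin d → ℕ → ℝ) (F : Fin d → ℝ)
    (hf : ∀ l i, 0 ≤ f l i) (hF : ∀ l N, ∑ i ∈ Finset.range N, f l i ≤ F l) :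
    ∑ k : (l : Fin d) → Fin (n l), ∏ l, f l (k l) ≤ ∏ l, F l := by
  rw [← Fintype.prod_sum (fun l (i : Fin (n l)) => f l i)]
  refine Finset.prod_le_prod (fun l _ => Finset.sum_nonneg fun i _ => hf l i) fun l _ => ?_
  rw [Fin.sum_univ_eq_sum_range (f l)]
  exact hF l _

theorem exists_sum_prod_rpow_le (d : ℕ) {r : ℝ} (hr : 1 < r) :
    ∃ C > 0, ∀ n : Fin d → ℕ,
      ∑ k : (l : Fin d) → Fin (n l), (∏ l, ((k l : ℕ) + 1 : ℝ)) ^ (-r) ≤ C := by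
  have hs : Summable fun i : ℕ => ((i : ℝ) + 1) ^ (-r) := by
    have := (summable_nat_add_iff 1).2 (Real.summable_nat_rpow.2 (by linarith : -r < -1))
    simpa using this
  set C := ∑' i : ℕ, ((i : ℝ) + 1) ^ (-r)
  have hC : 0 ≤ C := tsum_nonneg fun i => by positivity
  refine ⟨C ^ d + 1, by positivity, fun n => ?_⟩
  have h := sum_prod_le (n := n) (fun _ i => ((i : ℝ) + 1) ^ (-r)) (fun _ => C)
    (fun _ i => by positivity) fun _ N => hs.sum_le_tsum _ fun i _ => by positivity
  rw [Finset.prod_const, Finset.card_univ, Fintype.card_fin] at h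
  have h2 : ∀ k : (l : Fin d) → Fin (n l), (∏ l, ((k l : ℕ) + 1 : ℝ)) ^ (-r) =
      ∏ l, ((k l : ℕ) + 1 : ℝ) ^ (-r) := fun k =>
    (Real.finsetProd_rpow _ _ (fun l _ => by positivity) _).symm
  simp only [h2]
  linarith

theorem modeWeight_sq {d : ℕ} {n : Fin d → ℕ} (k : (l : Fin d) → Fin (n l)) :
    modeWeight k ^ 2 = (∏ l, ((k l : ℕ) + 1 : ℝ)) ^ (-2 : ℝ) := by
  have h : 0 ≤ ∏ l, ((k l : ℕ) + 1 : ℝ) := Finset.prod_nonneg fun l _ => by positivity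
  rw [modeWeight, Real.rpow_neg h, Real.rpow_two, ← inv_pow, ← Finset.prod_inv_distrib]
  simp only [one_div]

theorem sum_tail_le (i n : ℕ) :
    ∑ k ∈ Finset.range n, (1 / ((k : ℝ) + 1)) ^ 2 * (if i ≤ k then (1 : ℝ) else 0) ≤
      2 / ((i : ℝ) + 1) := by
  -- Telescoping with `1/(x+1)² ≤ 1/x - 1/(x+1)`; the factor 2 makes room for the first term of the
  -- tail.
  have key : ∀ m : ℕ, ∑ k ∈ Finset.range (i + 1 + m),
      (1 / ((k : ℝ) + 1)) ^ 2 * (if i ≤ k then (1 : ℝ) else 0) ≤ 2 / (i + 1) - 1 / ((i : ℝ) + 1 + m) := by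
    intro m
    have hi : (0 : ℝ) ≤ i := Nat.cast_nonneg i
    induction m with
    | zero =>
      rw [add_zero, Finset.sum_range_succ, Finset.sum_eq_zero, if_pos le_rfl]
      · have : (1 : ℝ) / (i + 1) ≤ 1 := by rw [div_le_one (by positivity)]; linarith
        have h0 : (0 : ℝ) ≤ 1 / (i + 1) := by positivity
        have h2 : (2 : ℝ) / (i + 1) = 1 / (i + 1) + 1 / (i + 1) := by ring
        rw [h2, Nat.cast_zero, add_zero]
        nlinarith
      · intro k hk
        rw [if_neg (by have := Finset.mem_range.1 hk; omega), mul_zero]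
    | succ m ih =>
      rw [← add_assoc, Finset.sum_range_succ, if_pos (by omega), mul_one]
      push_cast
      set x : ℝ := (i : ℝ) + 1 + m with hx
      have hx0 : 0 < x := by positivity
      have h1 : (1 / (x + 1)) ^ 2 ≤ 1 / x - 1 / (x + 1) := by
        rw [div_pow, one_pow, div_sub_div _ _ hx0.ne' (by positivity), div_le_div_iff₀ (by positivity)
          (by positivity)]
        nlinarith
      have h2 : (i : ℝ) + 1 + (m + 1) = x + 1 := by rw [hx]; ring
      rw [h2]
      linarith
  have h1 : ∑ k ∈ Finset.range n, (1 / ((k : ℝ) + 1)) ^ 2 * (if i ≤ k then (1 : ℝ) else 0) ≤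
      ∑ k ∈ Finset.range (i + 1 + n), (1 / ((k : ℝ) + 1)) ^ 2 * (if i ≤ k then (1 : ℝ) else 0) :=
    Finset.sum_le_sum_of_subset_of_nonneg
      (Finset.range_subset_range.2 (by omega)) fun k _ _ => by positivity
  have h2 := key n
  have h3 : (0 : ℝ) ≤ 1 / ((i : ℝ) + 1 + n) := by positivity
  linarith

theorem pow_four_le_sum (m : ℕ) : (m : ℝ) ^ 4 ≤ 4 * ∑ i ∈ Finset.range m, ((i : ℝ) + 1) ^ 3 := by
  induction m with
  | zero => simp
  | succ m ih =>
    have h0 : (0 : ℝ) ≤ m := Nat.cast_nonneg m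
    have h2 : 4 * ∑ i ∈ Finset.range m, ((i : ℝ) + 1) ^ 3 = ((m : ℝ) * (m + 1)) ^ 2 := by
      clear ih h0
      induction m with
      | zero => simp
      | succ m ih => rw [Finset.sum_range_succ, mul_add, ih]; push_cast; ring
    rw [Finset.sum_range_succ, mul_add, h2]
    push_cast
    nlinarith [pow_nonneg h0 2, pow_nonneg h0 3]

/-- A layer-cake bound for the square of `min N (min κ₁ κ₂ ^ 2 / N)`. -/
theorem min_sq_le_sum {N κ₁ κ₂ : ℕ} (hN : 1 ≤ N) {G : ℝ} (hG : 0 ≤ G) :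
    min (N : ℝ) (G * (min κ₁ κ₂ : ℕ) ^ 2 / N) ^ 2 ≤ (1 + G) ^ 2 * (4 / N ^ 2 *
      ∑ i ∈ Finset.range N, ((i : ℝ) + 1) ^ 3 *
        ((if i + 1 ≤ κ₁ then 1 else 0) * (if i + 1 ≤ κ₂ then 1 else 0))) := by
  have hN0 : (0 : ℝ) < N := by exact_mod_cast hN
  set m := min (min κ₁ κ₂) N with hm
  have h1 : min (N : ℝ) (G * (min κ₁ κ₂ : ℕ) ^ 2 / N) ≤ (1 + G) * ((m : ℝ) ^ 2 / N) := by
    rcases le_total (min κ₁ κ₂) N with h | h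
    · rw [hm, min_eq_left h]
      refine (min_le_right _ _).trans ?_
      rw [mul_div_assoc]
      exact mul_le_mul_of_nonneg_right (by linarith) (by positivity)
    · rw [hm, min_eq_right h]
      refine (min_le_left _ _).trans ?_
      have : (N : ℝ) ^ 2 / N = N := by field_simp
      rw [this]
      nlinarith
  have h2 : ∑ i ∈ Finset.range m, ((i : ℝ) + 1) ^ 3 ≤ ∑ i ∈ Finset.range N, ((i : ℝ) + 1) ^ 3 *
        ((if i + 1 ≤ κ₁ then 1 else 0) * (if i + 1 ≤ κ₂ then 1 else 0)) := by
    refine le_trans (le_of_eq ?_) (Finset.sum_le_sum_of_subset_of_nonneg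
      (Finset.range_subset_range.2 (min_le_right (min κ₁ κ₂) N)) fun i _ _ => by positivity)
    refine Finset.sum_congr rfl fun i hi => ?_
    have := Finset.mem_range.1 hi
    rw [if_pos (by omega), if_pos (by omega)]
    ring
  have h3 := pow_four_le_sum m
  calc _ ≤ ((1 + G) * ((m : ℝ) ^ 2 / N)) ^ 2 := pow_le_pow_left₀ (by positivity) h1 2
    _ = (1 + G) ^ 2 * (1 / N ^ 2 * (m : ℝ) ^ 4) := by ring
    _ ≤ (1 + G) ^ 2 * (1 / N ^ 2 * (4 * ∑ i ∈ Finset.range N, ((i : ℝ) + 1) ^ 3 *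
        ((if i + 1 ≤ κ₁ then 1 else 0) * (if i + 1 ≤ κ₂ then 1 else 0)))) :=
        mul_le_mul_of_nonneg_left (mul_le_mul_of_nonneg_left (h3.trans (by linarith))
          (by positivity)) (by positivity)
    _ = _ := by ring

/-- In the layer-cake sum, the modes with both wave numbers at least `i + 1` have total squared
weight at most `2^d / (i+1)²`. Against `(i+1)³` this leaves `∑ (i+1) ≤ N²`, which the prefactor
`1/N²` cancels, so there is no logarithmic loss. -/
theorem sum_modeWeight_sq_min_le {d : ℕ} {n : Fin d → ℕ} {a b : Fin d} (hab : a ≠ b) {N : ℕ}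
    (hN : 1 ≤ N) {G : ℝ} (hG : 0 ≤ G) :
    ∑ k : (l : Fin d) → Fin (n l), modeWeight k ^ 2 *
      min (N : ℝ) (G * (min ((k a : ℕ) + 1) ((k b : ℕ) + 1) : ℕ) ^ 2 / N) ^ 2 ≤
      (1 + G) ^ 2 * (4 * 2 ^ d) := by
  have hN0 : (0 : ℝ) < N := by exact_mod_cast hN
  have hlayer : ∀ i : ℕ, ∑ k : (l : Fin d) → Fin (n l), modeWeight k ^ 2 *
      ((if i + 1 ≤ (k a : ℕ) + 1 then (1 : ℝ) else 0) * (if i + 1 ≤ (k b : ℕ) + 1 then 1 else 0)) ≤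
      2 ^ d * (1 / ((i : ℝ) + 1)) ^ 2 := by
    intro i
    have h := sum_prod_le (n := n)
      (fun l m => (1 / ((m : ℝ) + 1)) ^ 2 *
        (if l ∈ ({a, b} : Finset (Fin d)) then (if i ≤ m then 1 else 0) else 1))
      (fun l => 2 * (if l ∈ ({a, b} : Finset (Fin d)) then 1 / ((i : ℝ) + 1) else 1))
      (fun l m => by positivity) (fun l m => by
        by_cases hl : l ∈ ({a, b} : Finset (Fin d))
        · simp only [hl, if_true]
          exact (sum_tail_le i m).trans (le_of_eq (by ring))
        · simp only [hl, if_false]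
          have := sum_tail_le 0 m
          simpa using this)
    have e1 : ∀ g : Fin d → ℝ, ∏ l, (if l ∈ ({a, b} : Finset (Fin d)) then g l else 1) =
        g a * g b := by
      intro g
      rw [Finset.prod_ite_mem, Finset.univ_inter, Finset.prod_pair hab]
    simp only [Finset.prod_mul_distrib, Finset.prod_const, Finset.card_univ,
      Fintype.card_fin] at h
    rw [e1 fun _ => 1 / ((i : ℝ) + 1), ← pow_two] at h
    refine le_trans (le_of_eq (Finset.sum_congr rfl fun k _ => ?_)) h
    rw [e1 fun l => if i ≤ (k l : ℕ) then 1 else 0, modeWeight, Finset.prod_pow]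
    simp only [add_le_add_iff_right]
  calc _ ≤ ∑ k : (l : Fin d) → Fin (n l), modeWeight k ^ 2 * ((1 + G) ^ 2 * (4 / N ^ 2 *
      ∑ i ∈ Finset.range N, ((i : ℝ) + 1) ^ 3 *
        ((if i + 1 ≤ (k a : ℕ) + 1 then 1 else 0) * (if i + 1 ≤ (k b : ℕ) + 1 then 1 else 0)))) :=
        Finset.sum_le_sum fun k _ => mul_le_mul_of_nonneg_left (min_sq_le_sum hN hG) (sq_nonneg _)
    _ = (1 + G) ^ 2 * (4 / N ^ 2 * ∑ i ∈ Finset.range N, ((i : ℝ) + 1) ^ 3 *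
        ∑ k : (l : Fin d) → Fin (n l), modeWeight k ^ 2 *
      ((if i + 1 ≤ (k a : ℕ) + 1 then (1 : ℝ) else 0) *
        (if i + 1 ≤ (k b : ℕ) + 1 then 1 else 0))) := by
        simp only [Finset.mul_sum]
        rw [Finset.sum_comm]
        exact Finset.sum_congr rfl fun i _ => Finset.sum_congr rfl fun k _ => by ring
    _ ≤ (1 + G) ^ 2 * (4 / N ^ 2 * ∑ _i ∈ Finset.range N, 2 ^ d * (N : ℝ)) := by
        refine mul_le_mul_of_nonneg_left (mul_le_mul_of_nonneg_left (Finset.sum_le_sum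
          fun i hi => ?_) (by positivity)) (by positivity)
        refine (mul_le_mul_of_nonneg_left (hlayer i) (by positivity)).trans ?_
        have : ((i : ℝ) + 1) ^ 3 * (2 ^ d * (1 / ((i : ℝ) + 1)) ^ 2) = 2 ^ d * (i + 1) := by
          field_simp
        rw [this]
        have : (i : ℝ) + 1 ≤ N := by exact_mod_cast Finset.mem_range.1 hi
        exact mul_le_mul_of_nonneg_left this (by positivity)
    _ = _ := by
        rw [Finset.sum_const, Finset.card_range, nsmul_eq_mul]
        field_simp

/-- Interpolation between the bounds `g ≤ W/w` and `g ≤ N`. The first, with `W ≤ (θ w)^m`, gives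
`g^m ≤ θ^m W^(m-1)`; multiplying by powers of the second gives a bound by `Q^(2(m-1)/m²)`. This
exponent is `4/9` for `m = 3` and smaller afterwards, whereas `m = 2` would give the inadmissible
`1/2`. -/
theorem le_mul_rpow_of_mul_le {m : ℕ} (hm : 3 ≤ m) {θ b B N g w W Q : ℝ} (hθ : 0 < θ) (hb : 0 ≤ b)
    (hg : 0 ≤ g) (hw : 0 < w) (hW : 0 < W) (hQ : 1 ≤ Q) (hgN : g ≤ N) (hgw : g * w ≤ W)
    (hWw : W ≤ (θ * w) ^ m) (hWQ : W ≤ b ^ m * Q ^ 2) (hB : N * b ≤ B) :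
    g ≤ (1 + θ ^ m * (B ^ m) ^ (m - 1)) * Q ^ (4 / 9 : ℝ) := by
  have hN : 0 ≤ N := hg.trans hgN
  have hB0 : 0 ≤ B := (mul_nonneg hN hb).trans hB
  have hQ0 : 0 < Q := by linarith
  obtain ⟨r, rfl⟩ : ∃ r, m = r + 1 := ⟨m - 1, by omega⟩
  rw [Nat.add_sub_cancel]
  have h1 : g ^ (r + 1) ≤ θ ^ (r + 1) * W ^ r := by
    have e1 : g ^ (r + 1) * W ≤ θ ^ (r + 1) * W ^ r * W := by
      calc g ^ (r + 1) * W ≤ g ^ (r + 1) * (θ * w) ^ (r + 1) :=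
            mul_le_mul_of_nonneg_left hWw (by positivity)
        _ = θ ^ (r + 1) * (g * w) ^ (r + 1) := by rw [mul_pow, mul_pow]; ring
        _ ≤ θ ^ (r + 1) * W ^ (r + 1) :=
            mul_le_mul_of_nonneg_left (pow_le_pow_left₀ (by positivity) hgw _) (by positivity)
        _ = _ := by ring
    exact le_of_mul_le_mul_right e1 hW
  have h2 : g ^ ((r + 1) ^ 2) ≤ θ ^ (r + 1) * (B ^ (r + 1)) ^ r * Q ^ (2 * r) := by
    calc g ^ ((r + 1) ^ 2) = g ^ (r + 1) * (g ^ (r + 1)) ^ r := by rw [← pow_succ', ← pow_mul]; ring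
      _ ≤ (θ ^ (r + 1) * W ^ r) * (N ^ (r + 1)) ^ r :=
          mul_le_mul h1 (pow_le_pow_left₀ (by positivity) (pow_le_pow_left₀ hg hgN _) _)
            (by positivity) (by positivity)
      _ = θ ^ (r + 1) * (N ^ (r + 1) * W) ^ r := by rw [mul_pow]; ring
      _ ≤ θ ^ (r + 1) * (B ^ (r + 1) * Q ^ 2) ^ r := by
          refine mul_le_mul_of_nonneg_left (pow_le_pow_left₀ (by positivity) ?_ _) (by positivity)
          calc N ^ (r + 1) * W ≤ N ^ (r + 1) * (b ^ (r + 1) * Q ^ 2) :=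
                mul_le_mul_of_nonneg_left hWQ (by positivity)
            _ = (N * b) ^ (r + 1) * Q ^ 2 := by rw [mul_pow]; ring
            _ ≤ _ := mul_le_mul_of_nonneg_right (pow_le_pow_left₀ (by positivity) hB _)
                (by positivity)
      _ = _ := by rw [mul_pow]; ring
  set K := θ ^ (r + 1) * (B ^ (r + 1)) ^ r with hK
  have hK0 : 0 ≤ K := by positivity
  have h3 : g ^ ((r + 1) ^ 2) ≤ ((1 + K) * Q ^ (4 / 9 : ℝ)) ^ ((r + 1) ^ 2) := by
    refine h2.trans ?_
    rw [mul_pow]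
    refine mul_le_mul ?_ ?_ (by positivity) (by positivity)
    · exact (by linarith : K ≤ 1 + K).trans (le_self_pow₀ (by linarith) (by positivity))
    · rw [← Real.rpow_natCast, ← Real.rpow_natCast, ← Real.rpow_mul hQ0.le]
      refine Real.rpow_le_rpow_of_exponent_le hQ ?_
      have hr : (2 : ℝ) ≤ r := by exact_mod_cast (by omega : 2 ≤ r)
      push_cast
      nlinarith
  exact (pow_le_pow_iff_left₀ hg (by positivity) (by positivity)).1 h3

theorem min_sum_le {ι : Type*} (S : Finset ι) (t : ι → ℝ) (ht : ∀ i, 0 ≤ t i) {N : ℝ} (hN : 0 ≤ N) :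
    min N (∑ i ∈ S, t i) ≤ ∑ i ∈ S, min N (t i) := by
  classical
  induction S using Finset.induction_on with
  | empty => simp
  | insert a S ha ih =>
    rw [Finset.sum_insert ha, Finset.sum_insert ha]
    refine le_trans ?_ (add_le_add le_rfl ih)
    have h1 := ht a
    have h2 : 0 ≤ ∑ i ∈ S, t i := Finset.sum_nonneg fun i _ => ht i
    rcases le_total N (t a) with h3 | h3 <;> rcases le_total N (∑ i ∈ S, t i) with h4 | h4 <;>
      simp only [min_eq_left h3, min_eq_right h3, min_eq_left h4, min_eq_right h4]
    · exact (min_le_left _ _).trans (by linarith)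
    · exact (min_le_left _ _).trans (by linarith)
    · exact (min_le_left _ _).trans (by linarith)
    · exact min_le_right _ _

/-- The squares are at most a multiple of `(∏ k_l)^(-(2-2e))`, and the series in each direction
converges because `2 - 2e > 1`. -/
theorem exists_sum_sq_le_of_le_rpow (d : ℕ) {G e : ℝ} (he : e < 1 / 2) :
    ∃ C > 0, ∀ (n : Fin d → ℕ) (g : ((l : Fin d) → Fin (n l)) → ℝ),
      (∀ k, 0 ≤ g k) → (∀ k, g k ≤ G * (∏ l, ((k l : ℕ) + 1 : ℝ)) ^ e) →
      ∑ k, (modeWeight k * g k) ^ 2 ≤ C := by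
  obtain ⟨C, hC, h⟩ := exists_sum_prod_rpow_le d (r := 2 - 2 * e) (by linarith)
  refine ⟨G ^ 2 * C + 1, by positivity, fun n g hg hg' => ?_⟩
  have h1 : ∀ k : (l : Fin d) → Fin (n l), (modeWeight k * g k) ^ 2 ≤
      G ^ 2 * (∏ l, ((k l : ℕ) + 1 : ℝ)) ^ (-(2 - 2 * e)) := by
    intro k
    have hQ : 0 < ∏ l, ((k l : ℕ) + 1 : ℝ) := Finset.prod_pos fun l _ => by positivity
    rw [mul_pow, modeWeight_sq]
    refine (mul_le_mul_of_nonneg_left (pow_le_pow_left₀ (hg k) (hg' k) 2)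
      (Real.rpow_nonneg hQ.le _)).trans (le_of_eq ?_)
    rw [mul_pow, ← Real.rpow_natCast ((∏ l, ((k l : ℕ) + 1 : ℝ)) ^ e), ← Real.rpow_mul hQ.le,
      mul_left_comm, ← Real.rpow_add hQ]
    congr 2
    push_cast
    ring
  refine (Finset.sum_le_sum fun k _ => h1 k).trans ?_
  rw [← Finset.mul_sum]
  nlinarith [mul_le_mul_of_nonneg_left (h n) (sq_nonneg G)]

/-- For at most one direction in `S` the quotient is bounded. For two, `y_a y_b / w ≤ min y_a y_b`,
which is at most a multiple of `min(k_a, k_b)² / N` because `τ ≤ T/N`; this is the borderline case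
for the layer-cake sum. For three or more, interpolation with the bound `N` gives the admissible
exponent `4/9`. -/
theorem exists_sum_sq_modeWeight_mul_min_prod_le {d : ℕ} (hd : 1 ≤ d) (P : DiffusionProblem d)
    {θ : ℝ} (hθ : 0 < θ) (S : Finset (Fin d)) :
    ∃ C > 0, ∀ (n : Fin d → ℕ) (τ : ℝ) (N : ℕ), 0 < τ → 1 ≤ N → N * τ ≤ P.T →
      ∑ k : (l : Fin d) → Fin (n l), (modeWeight k * min (N : ℝ)
        (min 1 (∑ j, -modeArg P n τ k j) * (∏ j ∈ S, θ * -modeArg P n τ k j) /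
          ∑ j, -modeArg P n τ k j)) ^ 2 ≤ C := by
  have hT := P.T_pos
  have ha := sum_a_pos hd P
  set c := 10 * ∑ i, P.a i with hc
  have hc0 : 0 < c := by positivity
  have hpos : ∀ (n : Fin d → ℕ) (τ : ℝ), 0 < τ → ∀ (k : (l : Fin d) → Fin (n l)) j,
      0 < θ * -modeArg P n τ k j := fun n τ hτ k j => mul_pos hθ (neg_pos.2 (modeArg_neg P n hτ k j))
  have hle : ∀ (n : Fin d → ℕ) (τ : ℝ), 0 < τ → ∀ (k : (l : Fin d) → Fin (n l)) j,
      -modeArg P n τ k j ≤ ∑ j, -modeArg P n τ k j := fun n τ hτ k j =>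
    Finset.single_le_sum (f := fun j => -modeArg P n τ k j)
      (fun i _ => (neg_pos.2 (modeArg_neg P n hτ k i)).le) (Finset.mem_univ j)
  have hg0 : ∀ (n : Fin d → ℕ) (τ : ℝ) (N : ℕ), 0 < τ → ∀ (k : (l : Fin d) → Fin (n l)),
      0 ≤ min (N : ℝ) (min 1 (∑ j, -modeArg P n τ k j) * (∏ j ∈ S, θ * -modeArg P n τ k j) /
          ∑ j, -modeArg P n τ k j) := fun n τ N hτ k => by
    have hw := sum_neg_modeArg_pos hd P n hτ k
    have hm : 0 < min 1 (∑ j, -modeArg P n τ k j) := lt_min one_pos hw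
    have := Finset.prod_pos fun j (_ : j ∈ S) => hpos n τ hτ k j
    exact le_min (Nat.cast_nonneg N) (by positivity)
  have hcases : S.card = 0 ∨ S.card = 1 ∨ S.card = 2 ∨ 3 ≤ S.card := by omega
  rcases hcases with hS | hS | hS | hS
  · obtain ⟨C, hC, h⟩ := exists_sum_sq_le_of_le_rpow d (G := 1) (e := 0) (by norm_num)
    refine ⟨C, hC, fun n τ N hτ hN hNT => h n _ (hg0 n τ N hτ) fun k => ?_⟩
    have hw := sum_neg_modeArg_pos hd P n hτ k
    rw [Finset.card_eq_zero.1 hS, Finset.prod_empty, Real.rpow_zero, mul_one, mul_one]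
    exact (min_le_right _ _).trans ((div_le_one hw).2 (min_le_right _ _))
  · obtain ⟨a, rfl⟩ := Finset.card_eq_one.1 hS
    obtain ⟨C, hC, h⟩ := exists_sum_sq_le_of_le_rpow d (G := θ) (e := 0) (by norm_num)
    refine ⟨C, hC, fun n τ N hτ hN hNT => h n _ (hg0 n τ N hτ) fun k => ?_⟩
    have hw := sum_neg_modeArg_pos hd P n hτ k
    rw [Finset.prod_singleton, Real.rpow_zero, mul_one]
    refine (min_le_right _ _).trans ((div_le_iff₀ hw).2 ?_)
    have h1 := hpos n τ hτ k a
    have h2 := hle n τ hτ k a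
    calc _ ≤ 1 * (θ * -modeArg P n τ k a) := mul_le_mul_of_nonneg_right (min_le_left _ _) h1.le
      _ ≤ _ := by nlinarith
  · obtain ⟨a, b, hab, rfl⟩ := Finset.card_eq_two.1 hS
    set G := θ ^ 2 * c * P.T with hG
    have hG0 : 0 ≤ G := by positivity
    refine ⟨(1 + G) ^ 2 * (4 * 2 ^ d), by positivity, fun n τ N hτ hN hNT => ?_⟩
    have hN0 : (0 : ℝ) < N := by exact_mod_cast hN
    refine le_trans (Finset.sum_le_sum fun k _ => ?_) (sum_modeWeight_sq_min_le hab hN hG0)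
    rw [mul_pow]
    refine mul_le_mul_of_nonneg_left (pow_le_pow_left₀ (hg0 n τ N hτ k)
      (min_le_min le_rfl ?_) 2) (sq_nonneg _)
    have hw := sum_neg_modeArg_pos hd P n hτ k
    rw [Finset.prod_pair hab]
    set w := ∑ j, -modeArg P n τ k j
    set ya := -modeArg P n τ k a with hya
    set yb := -modeArg P n τ k b with hyb
    have hya0 : 0 < ya := neg_pos.2 (modeArg_neg P n hτ k a)
    have hyb0 : 0 < yb := neg_pos.2 (modeArg_neg P n hτ k b)
    have hyaw : ya ≤ w := hle n τ hτ k a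
    have hybw : yb ≤ w := hle n τ hτ k b
    have hya1 : ya ≤ c * τ * ((k a : ℕ) + 1 : ℝ) ^ 2 := neg_modeArg_le P n hτ k a
    have hyb1 : yb ≤ c * τ * ((k b : ℕ) + 1 : ℝ) ^ 2 := neg_modeArg_le P n hτ k b
    have h1 : min 1 w * (θ * ya * (θ * yb)) / w ≤ θ ^ 2 * min ya yb := by
      rw [div_le_iff₀ hw]
      have e1 : ya * yb ≤ min ya yb * w := by
        rcases le_total ya yb with h | h
        · rw [min_eq_left h]; exact mul_le_mul_of_nonneg_left hybw hya0.le
        · rw [min_eq_right h]; nlinarith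
      calc _ ≤ 1 * (θ * ya * (θ * yb)) :=
            mul_le_mul_of_nonneg_right (min_le_left _ _) (by positivity)
        _ = θ ^ 2 * (ya * yb) := by ring
        _ ≤ θ ^ 2 * (min ya yb * w) := mul_le_mul_of_nonneg_left e1 (by positivity)
        _ = _ := by ring
    have h2 : min ya yb ≤ c * τ * ((min ((k a : ℕ) + 1) ((k b : ℕ) + 1) : ℕ) : ℝ) ^ 2 := by
      rcases le_total ((k a : ℕ) + 1) ((k b : ℕ) + 1) with h | h
      · rw [min_eq_left h]; push_cast; exact (min_le_left _ _).trans hya1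
      · rw [min_eq_right h]; push_cast; exact (min_le_right _ _).trans hyb1
    refine h1.trans ((mul_le_mul_of_nonneg_left h2 (by positivity)).trans ?_)
    rw [le_div_iff₀ hN0, hG]
    have h3 : 0 ≤ θ ^ 2 * c * ((min ((k a : ℕ) + 1) ((k b : ℕ) + 1) : ℕ) : ℝ) ^ 2 := by positivity
    nlinarith [mul_le_mul_of_nonneg_left hNT h3]
  · obtain ⟨C, hC, h⟩ := exists_sum_sq_le_of_le_rpow d
      (G := 1 + θ ^ S.card * ((θ * c * P.T) ^ S.card) ^ (S.card - 1)) (e := 4 / 9) (by norm_num)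
    refine ⟨C, hC, fun n τ N hτ hN hNT => h n _ (hg0 n τ N hτ) fun k => ?_⟩
    have hw := sum_neg_modeArg_pos hd P n hτ k
    have hκ : ∀ l, 1 ≤ ((k l : ℕ) + 1 : ℝ) := fun l => by
      linarith [(Nat.cast_nonneg (k l : ℕ) : (0 : ℝ) ≤ (k l : ℕ))]
    have hW := Finset.prod_pos fun j (_ : j ∈ S) => hpos n τ hτ k j
    refine le_mul_rpow_of_mul_le hS (b := θ * c * τ) (W := ∏ j ∈ S, θ * -modeArg P n τ k j) hθ
      (by positivity) (hg0 n τ N hτ k) hw hW (Finset.one_le_prod fun l _ => hκ l)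
      (min_le_left _ _) ?_ ?_ ?_ ?_
    · refine (mul_le_mul_of_nonneg_right (min_le_right _ _) hw.le).trans ?_
      rw [div_mul_cancel₀ _ hw.ne']
      exact mul_le_of_le_one_left hW.le (min_le_left _ _)
    · rw [← Finset.prod_const]
      exact Finset.prod_le_prod (fun j _ => (hpos n τ hτ k j).le) fun j _ =>
        mul_le_mul_of_nonneg_left (hle n τ hτ k j) hθ.le
    · have e1 : ∏ j ∈ S, θ * -modeArg P n τ k j ≤
          ∏ j ∈ S, (θ * c * τ) * ((k j : ℕ) + 1 : ℝ) ^ 2 :=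
        Finset.prod_le_prod (fun j _ => (hpos n τ hτ k j).le) fun j _ => by
          have := mul_le_mul_of_nonneg_left (neg_modeArg_le P n hτ k j) hθ.le
          linarith
      have e2 : ∏ j ∈ S, (θ * c * τ) * ((k j : ℕ) + 1 : ℝ) ^ 2 =
          (θ * c * τ) ^ S.card * (∏ j ∈ S, ((k j : ℕ) + 1 : ℝ)) ^ 2 := by
        rw [Finset.prod_mul_distrib, Finset.prod_const, Finset.prod_pow]
      rw [e2] at e1
      refine e1.trans (mul_le_mul_of_nonneg_left (pow_le_pow_left₀
        (Finset.prod_nonneg fun l _ => zero_le_one.trans (hκ l))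
        (prod_le_prod_univ_of_one_le hκ S) 2) (by positivity))
    · calc (N : ℝ) * (θ * c * τ) = θ * c * (N * τ) := by ring
        _ ≤ _ := mul_le_mul_of_nonneg_left hNT (by positivity)

/-- `Π` is expanded over subsets of directions, the minimum with `N` is subadditive, and the
Cauchy–Schwarz inequality over the `2^d` subsets costs only a constant. -/
theorem exists_sum_sq_modeWeight_mul_min_le {d s : ℕ} (hd : 1 ≤ d) (P : DiffusionProblem d)
    (M : AMFWMethod s) (hθ : 0 < M.θ) :
    ∃ C > 0, ∀ (n : Fin d → ℕ) (τ : ℝ) (N : ℕ), 0 < τ → 1 ≤ N → N * τ ≤ P.T →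
      ∑ k : (l : Fin d) → Fin (n l), (modeWeight k * min (N : ℝ)
        (min 1 (∑ j, -modeArg P n τ k j) * M.ampl (modeArg P n τ k) /
          ∑ j, -modeArg P n τ k j)) ^ 2 ≤ C := by
  obtain ⟨C, hC, h⟩ := exists_sum_le_of_forall (Finset.univ : Finset (Fin d)).powerset
    (fun v : (Fin d → ℕ) × ℝ × ℕ => 0 < v.2.1 ∧ 1 ≤ v.2.2 ∧ v.2.2 * v.2.1 ≤ P.T)
    (fun S v => ∑ k : (l : Fin d) → Fin (v.1 l), (modeWeight k * min (v.2.2 : ℝ)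
        (min 1 (∑ j, -modeArg P v.1 v.2.1 k j) * (∏ j ∈ S, M.θ * -modeArg P v.1 v.2.1 k j) /
          ∑ j, -modeArg P v.1 v.2.1 k j)) ^ 2) (fun _ => 1) (fun _ _ => zero_le_one)
    (fun S _ => by
      obtain ⟨C, hC, h⟩ := exists_sum_sq_modeWeight_mul_min_prod_le hd P hθ S
      exact ⟨C, hC, fun v hv => by rw [mul_one]; exact h v.1 v.2.1 v.2.2 hv.1 hv.2.1 hv.2.2⟩)
  refine ⟨2 ^ d * C, by positivity, fun n τ N hτ hN hNT => ?_⟩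
  have h' := h ⟨n, τ, N⟩ ⟨hτ, hN, hNT⟩
  dsimp only at h'
  rw [Finset.sum_comm, mul_one] at h'
  refine le_trans ?_ (mul_le_mul_of_nonneg_left h' (by positivity))
  rw [Finset.mul_sum]
  refine Finset.sum_le_sum fun k _ => ?_
  have hw := sum_neg_modeArg_pos hd P n hτ k
  have hm : 0 < min 1 (∑ j, -modeArg P n τ k j) := lt_min one_pos hw
  have hxneg := modeArg_neg P n hτ k
  have h1 := min_sum_le (Finset.univ : Finset (Fin d)).powerset
    (fun S => min 1 (∑ j, -modeArg P n τ k j) * (∏ j ∈ S, M.θ * -modeArg P n τ k j) /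
          ∑ j, -modeArg P n τ k j)
    (fun S => div_nonneg (mul_nonneg hm.le (Finset.prod_nonneg fun j _ =>
      mul_nonneg hθ.le (by linarith [hxneg j]))) hw.le) (Nat.cast_nonneg N : (0 : ℝ) ≤ N)
  rw [← Finset.sum_div, ← Finset.mul_sum, ← Finset.prod_one_add, ← M.ampl_eq_prod] at h1
  have hA := (M.ampl_pos hθ hxneg).le
  have hmw := (modeWeight_pos k).le
  have h2 := mul_le_mul_of_nonneg_left h1 hmw
  rw [Finset.mul_sum] at h2
  refine (pow_le_pow_left₀ (mul_nonneg hmw (le_min (Nat.cast_nonneg N)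
    (by positivity))) h2 2).trans ?_
  have h3 := sq_sum_le_card_mul_sum_sq (s := (Finset.univ : Finset (Fin d)).powerset)
    (f := fun S => modeWeight k * min (N : ℝ)
        (min 1 (∑ j, -modeArg P n τ k j) * (∏ j ∈ S, M.θ * -modeArg P n τ k j) /
          ∑ j, -modeArg P n τ k j))
  rw [Finset.card_powerset, Finset.card_univ, Fintype.card_fin] at h3
  push_cast at h3
  exact h3

/-! ### The global error -/

theorem sum_sq_sum_le {ι κ : Type*} [Fintype κ] (S : Finset ι) (f : ι → κ → ℝ) {B : ℝ}
    (h : ∀ i ∈ S, ∑ k, f i k ^ 2 ≤ B ^ 2) :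
    ∑ k, (∑ i ∈ S, f i k) ^ 2 ≤ (S.card * B) ^ 2 := by
  calc ∑ k, (∑ i ∈ S, f i k) ^ 2 ≤ ∑ k, (S.card : ℝ) * ∑ i ∈ S, f i k ^ 2 :=
        Finset.sum_le_sum fun k _ => sq_sum_le_card_mul_sum_sq
    _ = S.card * ∑ i ∈ S, ∑ k, f i k ^ 2 := by rw [← Finset.mul_sum, Finset.sum_comm]
    _ ≤ S.card * ∑ _i ∈ S, B ^ 2 :=
        mul_le_mul_of_nonneg_left (Finset.sum_le_sum h) (Nat.cast_nonneg _)
    _ = _ := by rw [Finset.sum_const, nsmul_eq_mul]; ring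

theorem sum_sq_add_le {κ : Type*} [Fintype κ] {f g : κ → ℝ} {A B : ℝ} (hA : 0 ≤ A) (hB : 0 ≤ B)
    (hf : ∑ k, f k ^ 2 ≤ A ^ 2) (hg : ∑ k, g k ^ 2 ≤ B ^ 2) :
    ∑ k, (f k + g k) ^ 2 ≤ (2 * (A + B)) ^ 2 := by
  have h : ∑ k, (f k + g k) ^ 2 ≤ 2 * ∑ k, f k ^ 2 + 2 * ∑ k, g k ^ 2 := by
    rw [Finset.mul_sum, Finset.mul_sum, ← Finset.sum_add_distrib]
    exact Finset.sum_le_sum fun k _ => by nlinarith [sq_nonneg (f k - g k)]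
  nlinarith [mul_nonneg hA hB, sq_nonneg A, sq_nonneg B]

/-- The accumulated modes of the discretization errors in space. -/
def truncationSum {d s : ℕ} (P : DiffusionProblem d) (M : AMFWMethod s)
    (D : ℕ → (Fin d → ℕ) → (Fin d → ℝ) → ℝ → ℝ) (n : Fin d → ℕ) (τ : ℝ) (N : ℕ) : GridFun n :=
  fun k => ∑ m ∈ Finset.range N,
    τ * (∑ i, ∑ j, |truncationCoeff P D n 0 j (m * τ + M.c i * τ) k|
      + ∑ j, |truncationCoeff P D n 1 j (m * τ) k|)

theorem truncationSum_nonneg {d s : ℕ} (P : DiffusionProblem d) (M : AMFWMethod s)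
    (D : ℕ → (Fin d → ℕ) → (Fin d → ℝ) → ℝ → ℝ) (n : Fin d → ℕ) {τ : ℝ} (hτ : 0 ≤ τ) (N : ℕ)
    (k : (l : Fin d) → Fin (n l)) : 0 ≤ truncationSum P M D n τ N k :=
  Finset.sum_nonneg fun _ _ => mul_nonneg hτ (add_nonneg
    (Finset.sum_nonneg fun _ _ => Finset.sum_nonneg fun _ _ => abs_nonneg _)
    (Finset.sum_nonneg fun _ _ => abs_nonneg _))

namespace SmoothSolution

variable {d s p : ℕ} {P : DiffusionProblem d} {D : ℕ → (Fin d → ℕ) → (Fin d → ℝ) → ℝ → ℝ}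

theorem exists_sum_sq_truncationSum_le (hD : SmoothSolution P p D) (M : AMFWMethod s) :
    ∃ C > 0, ∀ (n : Fin d → ℕ) (τ : ℝ), 0 < τ → ∀ (N : ℕ) (V : ℕ → GridFun n),
      P.IsAMFWSolution M n τ N V →
      ∑ k, truncationSum P M D n τ N k ^ 2 ≤ (C * maxMeshWidth n ^ 2) ^ 2 := by
  obtain ⟨B, hB0, hB⟩ := hD.exists_bound
  have hT := P.T_pos
  set a := ∑ j, P.a j with ha
  have ha0 : 0 ≤ a := Finset.sum_nonneg fun j _ => (P.a_pos j).le
  refine ⟨P.T * (2 * (s * (d * (2 * a * B)) + d * (2 * a * B))) + 1, by positivity,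
    fun n τ hτ N V hV => ?_⟩
  set H := maxMeshWidth n ^ 2 with hH
  have hH0 : 0 ≤ H := sq_nonneg _
  set B₁ := 2 * a * B * H with hB₁
  have hB₁0 : 0 ≤ B₁ := by positivity
  have htm : ∀ m < N, (m : ℝ) * τ ∈ Icc 0 P.T := fun m hm => ⟨by positivity,
    le_trans (mul_le_mul_of_nonneg_right (by exact_mod_cast hm.le) hτ.le) hV.final⟩
  have hcoef : ∀ m ≤ p + 1, ∀ (j : Fin d), ∀ t ∈ Icc 0 P.T,
      ∑ k, |truncationCoeff P D n m j t k| ^ 2 ≤ B₁ ^ 2 := by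
    intro m hm j t ht
    simp only [sq_abs]
    rw [truncationCoeff, sum_sineCoeff_sq]
    refine pow_le_pow_left₀ (Real.sqrt_nonneg _) ((hD.weightedNorm_sub_le hB0.le hB n j hm ht).trans
      ?_) 2
    have : P.a j ≤ a := Finset.single_le_sum (fun i _ => (P.a_pos i).le) (Finset.mem_univ j)
    rw [hB₁]
    exact mul_le_mul_of_nonneg_right (mul_le_mul_of_nonneg_right (by linarith) hB0.le) hH0
  have hinner : ∀ m ∈ Finset.range N, ∑ k,
      (τ * (∑ i, ∑ j, |truncationCoeff P D n 0 j (m * τ + M.c i * τ) k|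
        + ∑ j, |truncationCoeff P D n 1 j (m * τ) k|)) ^ 2 ≤
      (τ * (2 * (s * (d * B₁) + d * B₁))) ^ 2 := by
    intro m hm
    rw [Finset.mem_range] at hm
    have h1 := sum_sq_sum_le (κ := (l : Fin d) → Fin (n l)) (Finset.univ : Finset (Fin s))
      (fun i k => ∑ j, |truncationCoeff P D n 0 j (m * τ + M.c i * τ) k|) (B := d * B₁)
      fun i _ => by
        have := sum_sq_sum_le (κ := (l : Fin d) → Fin (n l)) (Finset.univ : Finset (Fin d))
          (fun j k => |truncationCoeff P D n 0 j (m * τ + M.c i * τ) k|) (B := B₁)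
          fun j _ => hcoef 0 (by omega) j _ (hV.nodes m hm i)
        simpa using this
    have h2 := sum_sq_sum_le (κ := (l : Fin d) → Fin (n l)) (Finset.univ : Finset (Fin d))
      (fun j k => |truncationCoeff P D n 1 j (m * τ) k|) (B := B₁)
      fun j _ => hcoef 1 (by omega) j _ (htm m hm)
    rw [Finset.card_univ, Fintype.card_fin] at h1 h2
    have h3 := sum_sq_add_le (by positivity) (by positivity) h1 h2
    simp only [mul_pow τ]
    rw [← Finset.mul_sum]
    exact mul_le_mul_of_nonneg_left h3 (sq_nonneg _)
  have h := sum_sq_sum_le (Finset.range N) _ hinner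
  rw [Finset.card_range] at h
  refine h.trans (pow_le_pow_left₀ (by positivity) ?_ 2)
  have h4 : (N : ℝ) * τ * (2 * (s * (d * B₁) + d * B₁)) ≤ P.T * (2 * (s * (d * B₁) + d * B₁)) :=
    mul_le_mul_of_nonneg_right hV.final (by positivity)
  rw [← mul_assoc]
  refine h4.trans ?_
  rw [hB₁]
  linarith

/-- Parseval reduces the norm to the square summability of the mode bounds. The case `N = 0` is
separate because only `N ≥ 1` forces `τ ≤ T`, which is needed to pass from the exponent `e` to a
smaller `q`. -/
theorem globalErrorBound_of_mode_error_le (hD : SmoothSolution P p D) (M : AMFWMethod s)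
    {u : (Fin d → ℝ) → ℝ → ℝ} (hu : ∀ x ∈ Icc 0 1, ∀ t ∈ Icc 0 P.T, D 0 0 x t = u x t) {q e : ℝ}
    (hqe : q ≤ e)
    (h : ∃ C > 0, ∀ (n : Fin d → ℕ) (τ : ℝ), 0 < τ → τ ≤ P.T → ∀ (N : ℕ) (V : ℕ → GridFun n),
      1 ≤ N → P.IsAMFWSolution M n τ N V → ∃ f : GridFun n,
        ∑ k, (modeWeight k * f k) ^ 2 ≤ C ∧
        ∀ k, |derivCoeff D n 0 0 (N * τ) k - sineCoeff n (V N) k| ≤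
          C * τ ^ e * (modeWeight k * (1 + f k)) + C * truncationSum P M D n τ N k) :
    ∃ C₁ > 0, ∃ C₂ > 0, P.GlobalErrorBound M u q C₁ C₂ := by
  obtain ⟨C, hC, h⟩ := h
  obtain ⟨C', hC', h'⟩ := hD.exists_sum_sq_truncationSum_le M
  obtain ⟨C'', hC'', h''⟩ := exists_sum_sq_le_of_le_rpow d (G := 1) (e := 0) (by norm_num)
  have hT := P.T_pos
  refine ⟨2 * (C * (2 * (√C'' + √C)) * P.T ^ (e - q)), by positivity, 2 * (C * C'),
    by positivity, ?_⟩
  intro n τ hτ N V hV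
  have hu' : ∀ t ∈ Icc 0 P.T, (gridRestrict n fun x => u x t) = gridRestrict n fun x => D 0 0 x t :=
    fun t ht => funext fun i =>
      (hu _ (unitCube_subset d (gridNode_mem_unitCube n i)) t ht).symm
  rcases Nat.eq_zero_or_pos N with rfl | hN
  · have h0 : (gridRestrict n fun x => u x ((0 : ℕ) * τ)) - V 0 = 0 := by
      rw [Nat.cast_zero, zero_mul, hu' 0 ⟨le_rfl, hT.le⟩, hV.init, sub_eq_zero]
      exact funext fun i => (hD.ic _ (gridNode_mem_unitCube n i)).symm
    rw [h0]
    have h1 : weightedNorm (0 : GridFun n) = 0 := by simp [weightedNorm]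
    rw [h1]
    positivity
  · have hN1 : (1 : ℝ) ≤ N := by exact_mod_cast hN
    have hτT : τ ≤ P.T := le_trans (by nlinarith) hV.final
    obtain ⟨f, hf, hle⟩ := h n τ hτ hτT N V hN hV
    have hmem : (N : ℝ) * τ ∈ Icc 0 P.T := ⟨by positivity, hV.final⟩
    have e1 : ∑ k : (l : Fin d) → Fin (n l), (modeWeight k) ^ 2 ≤ √C'' ^ 2 := by
      rw [Real.sq_sqrt hC''.le]
      simpa using h'' n (fun _ => 1) (fun _ => zero_le_one) fun k => by simp
    have e2 : ∑ k, (modeWeight k * f k) ^ 2 ≤ √C ^ 2 := by rwa [Real.sq_sqrt hC.le]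
    have e3 := sum_sq_add_le (Real.sqrt_nonneg _) (Real.sqrt_nonneg _) e1 e2
    have e4 : ∑ k, (C * τ ^ e * (modeWeight k * (1 + f k))) ^ 2 ≤
        (C * τ ^ e * (2 * (√C'' + √C))) ^ 2 := by
      simp only [mul_pow (C * τ ^ e)]
      rw [← Finset.mul_sum]
      refine mul_le_mul_of_nonneg_left ?_ (sq_nonneg _)
      simpa only [mul_add, mul_one] using e3
    have e5 : ∑ k, (C * truncationSum P M D n τ N k) ^ 2 ≤ (C * (C' * maxMeshWidth n ^ 2)) ^ 2 := by
      simp only [mul_pow C]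
      rw [← Finset.mul_sum]
      exact mul_le_mul_of_nonneg_left (h' n τ hτ N V hV) (sq_nonneg _)
    have e6 := sum_sq_add_le (by positivity) (by positivity) e4 e5
    have e7 : weightedNorm ((gridRestrict n fun x => u x (N * τ)) - V N) ^ 2 ≤
        (2 * (C * τ ^ e * (2 * (√C'' + √C)) + C * (C' * maxMeshWidth n ^ 2))) ^ 2 := by
      rw [← sum_sineCoeff_sq, hu' _ hmem, map_sub]
      refine le_trans (Finset.sum_le_sum fun k _ => ?_) e6
      exact sq_le_sq' (abs_le.1 (hle k)).1 (abs_le.1 (hle k)).2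
    have e8 := abs_le_of_sq_le_sq e7 (by positivity)
    refine (le_abs_self _).trans (e8.trans ?_)
    have e9 := mul_le_mul_of_nonneg_left (rpow_le_mul_rpow hτ hτT hqe)
      (by positivity : 0 ≤ 2 * (C * (2 * (√C'' + √C))))
    linarith

theorem exists_mode_error_le_truncationSum (hD : SmoothSolution P p D) (hp : 1 ≤ p)
    (M : AMFWMethod s) (hθ : 0 < M.θ) (hb : dotProduct M.b M.rho = 1) (N₀ : ℕ) (hN₀ : N₀ + 1 ≤ p) :
    ∃ C > 0, ∀ (n : Fin d → ℕ) (τ : ℝ), 0 < τ → τ ≤ P.T → ∀ (N : ℕ) (V : ℕ → GridFun n),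
      P.IsAMFWSolution M n τ N V → ∀ k : (l : Fin d) → Fin (n l),
      |M.stabilityFunction (modeArg P n τ k)| ≤ 1 →
      |derivCoeff D n 0 0 (N * τ) k - sineCoeff n (V N) k| ≤
        |accum (M.stabilityFunction (modeArg P n τ k)) (fun m => M.mainSource (modeArg P n τ k)
          (fun j => P.a j * derivCoeff D n 1 (Pi.single j 2) (m * τ) k) τ N₀
          (fun q => derivCoeff D n q 0 (m * τ) k)) N|
        + C * τ ^ (N₀ + 1) * modeWeight k + C * truncationSum P M D n τ N k := by
  obtain ⟨C, hC, h⟩ := hD.exists_mode_error_le hp M hθ hb N₀ hN₀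
  obtain ⟨C', hC', h'⟩ := M.exists_stageFun_rho_mul_partialAmpl_le (d := d) hθ
  have hT := P.T_pos
  refine ⟨C * (1 + P.T * C'), by positivity, fun n τ hτ hτT N V hV k hR => ?_⟩
  refine (h n τ hτ N V hV k hR).trans ?_
  have hxneg := modeArg_neg P n hτ k
  have h1 : 0 ≤ C * τ ^ (N₀ + 1) * modeWeight k := by have := modeWeight_pos k; positivity
  have h2 : ∑ m ∈ Finset.range N,
      τ * (∑ i, ∑ j, |truncationCoeff P D n 0 j (m * τ + M.c i * τ) k|
        + τ * |M.stageFun (modeArg P n τ k) M.rho *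
          ∑ j, M.partialAmpl (modeArg P n τ k) j * truncationCoeff P D n 1 j (m * τ) k|) ≤
      (1 + P.T * C') * truncationSum P M D n τ N k := by
    rw [truncationSum, Finset.mul_sum]
    refine Finset.sum_le_sum fun m _ => ?_
    rw [mul_left_comm (1 + P.T * C')]
    refine mul_le_mul_of_nonneg_left ?_ hτ.le
    have e1 : |M.stageFun (modeArg P n τ k) M.rho *
          ∑ j, M.partialAmpl (modeArg P n τ k) j * truncationCoeff P D n 1 j (m * τ) k| ≤
        C' * ∑ j, |truncationCoeff P D n 1 j (m * τ) k| := by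
      rw [Finset.mul_sum, Finset.mul_sum]
      refine (Finset.abs_sum_le_sum_abs _ _).trans (Finset.sum_le_sum fun j _ => ?_)
      rw [← mul_assoc, abs_mul]
      exact mul_le_mul_of_nonneg_right (h' _ hxneg j).2 (abs_nonneg _)
    have hA : 0 ≤ ∑ i, ∑ j, |truncationCoeff P D n 0 j (m * τ + M.c i * τ) k| :=
      Finset.sum_nonneg fun _ _ => Finset.sum_nonneg fun _ _ => abs_nonneg _
    have hA' : 0 ≤ ∑ j, |truncationCoeff P D n 1 j (m * τ) k| :=
      Finset.sum_nonneg fun _ _ => abs_nonneg _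
    have e2 := mul_le_mul_of_nonneg_left e1 hτ.le
    have e3 := mul_le_mul_of_nonneg_right hτT (mul_nonneg hC'.le hA')
    have e4 := mul_nonneg (mul_nonneg hT.le hC'.le) hA
    refine (add_le_add le_rfl (e2.trans e3)).trans ?_
    rw [add_mul, one_mul, mul_add, mul_assoc P.T C']
    linarith
  have h3 := mul_le_mul_of_nonneg_left h2 hC.le
  have h4 : 0 ≤ P.T * C' * (C * τ ^ (N₀ + 1) * modeWeight k) := by positivity
  linarith

end SmoothSolution

namespace AMFWMethod

theorem abs_stabilityFunction_le {d s : ℕ} {M : AMFWMethod s} (hθ : 0 < M.θ) {C : ℝ} (hC : 0 < C)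
    (hstab : ∀ x : Fin d → ℝ, (∀ j, x j < 0) →
      -1 ≤ M.stabilityFunction x ∧
      M.stabilityFunction x ≤ 1 + C * ((∑ j, x j) / ∏ j, (1 - M.θ * x j)))
    {x : Fin d → ℝ} (hx : ∀ j, x j < 0) : |M.stabilityFunction x| ≤ 1 := by
  obtain ⟨h1, h2⟩ := hstab x hx
  have h3 : (∑ j, x j) / ∏ j, (1 - M.θ * x j) ≤ 0 :=
    div_nonpos_of_nonpos_of_nonneg (Finset.sum_nonpos fun j _ => (hx j).le) (M.ampl_pos hθ hx).le
  exact abs_le.2 ⟨h1, h2.trans (by nlinarith)⟩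

end AMFWMethod

/-! ### The error bounds of order one, of order two, and for time-independent boundary values. -/

namespace SmoothSolution

variable {d s p : ℕ} {P : DiffusionProblem d} {D : ℕ → (Fin d → ℕ) → (Fin d → ℝ) → ℝ → ℝ}

theorem exists_globalErrorBound_one (hD : SmoothSolution P 1 D) (hd : 1 ≤ d) {M : AMFWMethod s}
    (hord : M.HasRosenbrockOrder 1) {C₀ : ℝ} (hC₀ : 0 < C₀)
    (hstab : ∀ x : Fin d → ℝ, (∀ j, x j < 0) →
      -1 ≤ M.stabilityFunction x ∧
      M.stabilityFunction x ≤ 1 + C₀ * ((∑ j, x j) / ∏ j, (1 - M.θ * x j)))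
    {u : (Fin d → ℝ) → ℝ → ℝ} (hu : ∀ x ∈ Icc 0 1, ∀ t ∈ Icc 0 P.T, D 0 0 x t = u x t) {q : ℝ}
    (hq : q ≤ 1) : ∃ C₁ > 0, ∃ C₂ > 0, P.GlobalErrorBound M u q C₁ C₂ := by
  have hθ := AMFWMethod.theta_pos_of_stable hd hC₀ hstab
  obtain ⟨C, hC, h⟩ := hD.exists_mode_error_le_truncationSum le_rfl M hθ
    (hord.dotProduct_rho le_rfl) 0 le_rfl
  obtain ⟨C', hC', h'⟩ := hD.exists_accum_mainSource_zero_le le_rfl M hθ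
  refine hD.globalErrorBound_of_mode_error_le M hu hq ⟨C + C', by positivity,
    fun n τ hτ hτT N V hN hV => ⟨0, by simp; positivity, fun k => ?_⟩⟩
  have hR := AMFWMethod.abs_stabilityFunction_le hθ hC₀ hstab (modeArg_neg P n hτ k)
  refine (h n τ hτ hτT N V hV k hR).trans ?_
  have e1 := h' n τ hτ N hV.final k _ hR
  have e2 := mul_nonneg hC'.le (truncationSum_nonneg P M D n hτ.le N k)
  rw [Real.rpow_one, Pi.zero_apply, add_zero, mul_one]
  rw [zero_add, pow_one]
  linarith

theorem exists_globalErrorBound_two (hD : SmoothSolution P 2 D) (hd : 1 ≤ d) {M : AMFWMethod s}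
    (hord : M.HasRosenbrockOrder 2) {C₀ : ℝ} (hC₀ : 0 < C₀)
    (hstab : ∀ x : Fin d → ℝ, (∀ j, x j < 0) →
      -1 ≤ M.stabilityFunction x ∧
      M.stabilityFunction x ≤ 1 + C₀ * ((∑ j, x j) / ∏ j, (1 - M.θ * x j)))
    {u : (Fin d → ℝ) → ℝ → ℝ} (hu : ∀ x ∈ Icc 0 1, ∀ t ∈ Icc 0 P.T, D 0 0 x t = u x t) {q : ℝ}
    (hq : q ≤ 2) : ∃ C₁ > 0, ∃ C₂ > 0, P.GlobalErrorBound M u q C₁ C₂ := by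
  have hθ := AMFWMethod.theta_pos_of_stable hd hC₀ hstab
  obtain ⟨C, hC, h⟩ := hD.exists_mode_error_le_truncationSum (by omega) M hθ
    (hord.dotProduct_rho (by omega)) 1 le_rfl
  obtain ⟨C', hC', h'⟩ := hD.exists_accum_mainSource_one_le hd le_rfl M hθ hord hC₀
  obtain ⟨C'', hC'', h''⟩ := exists_sum_sq_modeWeight_mul_min_le hd P M hθ
  refine hD.globalErrorBound_of_mode_error_le M hu hq ⟨C + C' + C'', by positivity,
    fun n τ hτ hτT N V hN hV => ⟨fun k => min (N : ℝ)
        (min 1 (∑ j, -modeArg P n τ k j) * M.ampl (modeArg P n τ k) /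
          ∑ j, -modeArg P n τ k j), (h'' n τ N hτ hN hV.final).trans (by linarith), fun k => ?_⟩⟩
  have hxneg := modeArg_neg P n hτ k
  have hR := AMFWMethod.abs_stabilityFunction_le hθ hC₀ hstab hxneg
  refine (h n τ hτ hτT N V hV k hR).trans ?_
  have e1 := h' n τ hτ N hV.final k _ hR (M.ampl_mul_one_sub_ge hθ hxneg (hstab _ hxneg).2)
  have e2 := mul_nonneg (add_pos hC' hC'').le (truncationSum_nonneg P M D n hτ.le N k)
  have hw := sum_neg_modeArg_pos hd P n hτ k
  have hA := M.ampl_pos hθ hxneg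
  have hm : 0 < min 1 (∑ j, -modeArg P n τ k j) := lt_min one_pos hw
  have hmin : 0 ≤ min (N : ℝ) (min 1 (∑ j, -modeArg P n τ k j) * M.ampl (modeArg P n τ k) /
          ∑ j, -modeArg P n τ k j) := le_min (Nat.cast_nonneg N) (by positivity)
  have hmw := modeWeight_pos k
  have e3 := mul_nonneg (mul_nonneg (add_pos hC' hC'').le (sq_nonneg τ)) hmw.le
  have e4 := mul_nonneg (mul_nonneg (add_pos hC hC'').le (sq_nonneg τ)) (mul_nonneg hmw.le hmin)
  rw [Real.rpow_two]
  linarith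

theorem exists_globalErrorBound_of_timeIndependent (hD : SmoothSolution P p D) (hd : 1 ≤ d)
    (hp : 3 ≤ p) (hP : P.TimeIndependentBC) {M : AMFWMethod s}
    (hord : M.HasRosenbrockOrder p) {C₀ : ℝ} (hC₀ : 0 < C₀)
    (hstab : ∀ x : Fin d → ℝ, (∀ j, x j < 0) →
      -1 ≤ M.stabilityFunction x ∧
      M.stabilityFunction x ≤ 1 + C₀ * ((∑ j, x j) / ∏ j, (1 - M.θ * x j)))
    {u : (Fin d → ℝ) → ℝ → ℝ} (hu : ∀ x ∈ Icc 0 1, ∀ t ∈ Icc 0 P.T, D 0 0 x t = u x t) {q : ℝ}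
    (hq : q < 3.25) (hqp : q ≤ p) : ∃ C₁ > 0, ∃ C₂ > 0, P.GlobalErrorBound M u q C₁ C₂ := by
  have hθ := AMFWMethod.theta_pos_of_stable hd hC₀ hstab
  have hT := P.T_pos
  have hp' : (3 : ℝ) ≤ p := by exact_mod_cast hp
  -- The condition `q < 3.25` makes `2σ < 1/2`, the threshold of square summability; the maximum
  -- with 0 covers `q < 3`.
  set σ := max 0 (q - 3) with hσ
  have hσ0 : 0 ≤ σ := le_max_left _ _
  have hσp : 3 + σ ≤ p := by
    have : σ ≤ p - 3 := max_le (by linarith) (by linarith)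
    linarith
  have hσ4 : 2 * σ < 1 / 2 := by
    have : σ < 1 / 4 := max_lt (by norm_num) (by norm_num at hq ⊢; linarith)
    linarith
  have hqσ : q ≤ 3 + σ := by linarith [le_max_right 0 (q - 3)]
  obtain ⟨C, hC, h⟩ := hD.exists_mode_error_le_truncationSum (by omega) M hθ
    (hord.dotProduct_rho (by omega)) (p - 1) (by omega)
  obtain ⟨C', hC', h'⟩ :=
    hD.exists_accum_mainSource_le_of_timeIndependent hP hd hθ hord hσ0 hσp hC₀
  obtain ⟨C'', hC'', h''⟩ := exists_sum_sq_le_of_le_rpow d (G := 1) hσ4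
  set K := P.T ^ ((p : ℝ) - (3 + σ)) with hK
  have hK0 : 0 < K := by positivity
  refine hD.globalErrorBound_of_mode_error_le M hu hqσ ⟨C + C * K + C' + C' * P.T + C'', by positivity,
    fun n τ hτ hτT N V hN hV => ⟨fun k => (∏ l, ((k l : ℕ) + 1 : ℝ)) ^ (2 * σ),
      (h'' n _ (fun k => by positivity) fun k => by rw [one_mul]).trans ?_, fun k => ?_⟩⟩
  · have : 0 < C + C * K + C' + C' * P.T := by positivity
    linarith
  have hxneg := modeArg_neg P n hτ k
  have hR := AMFWMethod.abs_stabilityFunction_le hθ hC₀ hstab hxneg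
  refine (h n τ hτ hτT N V hV k hR).trans ?_
  have e1 := h' n τ hτ hτT N hV.final k _ hR (M.ampl_mul_one_sub_ge hθ hxneg (hstab _ hxneg).2)
  have hZ := truncationSum_nonneg P M D n hτ.le N k
  have hmw := modeWeight_pos k
  set Q := ∏ l, ((k l : ℕ) + 1 : ℝ) with hQ
  have hQ0 : 0 < Q := Finset.prod_pos fun l _ => by positivity
  have hmQ : modeWeight k * Q ^ (2 * σ) = Q ^ (-1 + 2 * σ) := by
    rw [Real.rpow_add hQ0, Real.rpow_neg hQ0.le, Real.rpow_one, modeWeight, hQ,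
      ← Finset.prod_inv_distrib]
    simp only [one_div]
  have e2 : ∑ m ∈ Finset.range N, τ * (τ * ∑ j, |truncationCoeff P D n 1 j (m * τ) k|) ≤
      P.T * truncationSum P M D n τ N k := by
    rw [truncationSum, Finset.mul_sum]
    refine Finset.sum_le_sum fun m _ => ?_
    rw [mul_left_comm P.T]
    refine mul_le_mul_of_nonneg_left ?_ hτ.le
    have f1 : 0 ≤ ∑ i, ∑ j, |truncationCoeff P D n 0 j (m * τ + M.c i * τ) k| :=
      Finset.sum_nonneg fun _ _ => Finset.sum_nonneg fun _ _ => abs_nonneg _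
    have f2 : 0 ≤ ∑ j, |truncationCoeff P D n 1 j (m * τ) k| :=
      Finset.sum_nonneg fun _ _ => abs_nonneg _
    exact mul_le_mul hτT (by linarith) f2 hT.le
  have e3 := mul_le_mul_of_nonneg_left e2 hC'.le
  have e4 : τ ^ p ≤ K * τ ^ (3 + σ) := by
    rw [← Real.rpow_natCast]
    exact rpow_le_mul_rpow hτ hτT hσp
  have e5 := mul_le_mul_of_nonneg_left (mul_le_mul_of_nonneg_right e4 hmw.le) hC.le
  rw [mul_add, mul_one, hmQ, show p - 1 + 1 = p by omega]
  set Y := τ ^ (3 + σ) with hY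
  have hY0 : 0 < Y := by positivity
  set X := Q ^ (-1 + 2 * σ) with hX
  have hX0 : 0 < X := by positivity
  have g1 : 0 ≤ (C + C' + C' * P.T + C'') * (Y * modeWeight k) := by positivity
  have g2 : 0 ≤ (C + C * K + C' * P.T + C'') * (Y * X) := by positivity
  have g3 : 0 ≤ (C * K + C' + C'') * truncationSum P M D n τ N k :=
    mul_nonneg (by positivity) hZ
  linarith

end SmoothSolution

end

theorem theorem1 (d : ℕ) (hd : 1 ≤ d) (s : ℕ) (M : AMFWMethod s)
    (p : ℕ) (hp : 1 ≤ p) (hord : M.HasRosenbrockOrder p)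
    (C : ℝ) (hC : 0 < C)
    (hstab : ∀ x : Fin d → ℝ, (∀ j, x j < 0) →
      -1 ≤ M.stabilityFunction x ∧
      M.stabilityFunction x ≤ 1 + C * ((∑ j, x j) / ∏ j, (1 - M.θ * x j)))
    (P : DiffusionProblem d) (u : (Fin d → ℝ) → ℝ → ℝ) (hu : P.IsSolution u)
    (hreg : HasContinuousPartials P.T (p + 1) (max (p + 1) 4) u) :
    (P.TimeIndependentBC → ∀ q : ℝ, q < 3.25 → ∃ C₁ > 0, ∃ C₂ > 0,
      P.GlobalErrorBound M u (min (p : ℝ) q) C₁ C₂) ∧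
    (∃ C₁ > 0, ∃ C₂ > 0, P.GlobalErrorBound M u (min (p : ℝ) 2) C₁ C₂) := by
  obtain ⟨D₁, hD₁, hu₁⟩ := exists_smoothSolution hp hu hreg
  have hlow : ∀ q : ℝ, q ≤ p → q ≤ 2 → ∃ C₁ > 0, ∃ C₂ > 0, P.GlobalErrorBound M u q C₁ C₂ := by
    intro q hqp hq2
    rcases Nat.lt_or_ge p 2 with h | h
    · obtain rfl : p = 1 := by omega
      exact hD₁.exists_globalErrorBound_one hd hord hC hstab hu₁ (by exact_mod_cast hqp)
    -- An exponent of at most 2 is all that is claimed here, so method and solution are used only to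
    -- order two.
    · obtain ⟨D₂, hD₂, hu₂⟩ := exists_smoothSolution h hu hreg
      exact hD₂.exists_globalErrorBound_two hd (hord.mono h) hC hstab hu₂ hq2
  refine ⟨fun hP q hq => ?_, hlow _ (min_le_left _ _) (min_le_right _ _)⟩
  -- For `p ≤ 2` the exponent `min p q` is at most 2, and the bound for general boundary values
  -- already suffices.
  rcases Nat.lt_or_ge p 3 with h | h
  · exact hlow _ (min_le_left _ _)
      ((min_le_left _ _).trans (by exact_mod_cast Nat.lt_succ_iff.1 h))
  · obtain ⟨D, hD, hu'⟩ := exists_smoothSolution le_rfl hu hreg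
    exact hD.exists_globalErrorBound_of_timeIndependent hd h hP hord hC hstab hu'
      ((min_le_right _ _).trans_lt hq) (min_le_left _ _)
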